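/- Let $n,d,m\ge 1$, $\mathbb S=\{1,\dots,m\}$, let $|\cdot|$ be the Euclidean norm on vectors and $|A|=\sqrt{\operatorname{trace}(A^TA)}$ on matrices. Let $f:\mathbb R^n\times\mathbb S\to\mathbb R^n$ and $g:\mathbb R^n\times\mathbb S\to\mathbb R^{n\times d}$ be locally Lipschitz in $x$: for every $N>0$ there is $C_N>0$ with $|f(x,i)-f(y,i)|\vee|g(x,i)-g(y,i)|\le C_N|x-y|$ for $|x|\vee|y|\le N$, $i\in\mathbb S$. Let $\Gamma=(\gamma_{ij})\in\mathbb R^{m\times m}$ satisfy $\gamma_{ij}\ge 0$ for $i\ne j$ and $\sum_j\gamma_{ij}=0$, and be irreducible: $\pi\Gamma=0$, $\sum_i\pi_i=1$ has a unique solution $\pi$, and $\pi_i>0$ for all $i$. Assume: (i) there are $\bar p>0$, a symmetric positive definite matrix $Q\in\mathbb R^{n\times n}$ and real $\alpha_i$ such that for each $i\in\mathbb S$ $$\limsup_{|x|\to\infty}\frac{(1+x^TQx)\,\psi(x,i)-(2-\bar p)\,|x^TQg(x,i)|^2}{(x^TQx)^2}\le\alpha_i,\qquad \psi(x,i)=2x^TQf(x,i)+\operatorname{trace}\big(g(x,i)^TQg(x,i)\big);$$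 (ii) there are $\rho>0$ and real $\beta_i$ such that for all $x,y\in\mathbb R^n$, $i\in\mathbb S$, with $F=f(x,i)-f(y,i)$ and $G=g(x,i)-g(y,i)$, $$|x-y|^2\big(2(x-y)^TF+|G|^2\big)-(2-\rho)\,|(x-y)^TG|^2\le\beta_i|x-y|^4;$$ (iii) $\sum_i\pi_i\alpha_i<0$ and $\sum_i\pi_i\beta_i<0$. For each $i$ let $\bar\varphi_i:[0,\infty)\to[0,\infty)$ satisfy $$\sup_{|x|\vee|y|\le u,\ x\ne y}\Big(\frac{|f(x,i)-f(y,i)|}{|x-y|}\vee\frac{|g(x,i)-g(y,i)|^2}{|x-y|^2}\Big)\le\bar\varphi_i(u),\qquad u\ge 1,$$ and be either continuous, strictly increasing and unbounded, or constant on $[1,\infty)$; in the second case put $\bar\varphi_i^{-1}\equiv+\infty$ on $[\bar\varphi_i(1),\infty)$. Let $\bar h:(0,1]\to\mathbb R$ be strictly decreasing with $\bar h\ge\max_i\bar\varphi_i(1)$, $\bar h(1)\ge\max_i(|f(0,i)|\vee|g(0,i)|^2)$, $\lim_{\Delta\to0}\bar h(\Delta)=\infty$ and, for some $\bar\theta\in(0,\tfrac12)$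 and $K>0$, $\Delta^{1/2-\bar\theta}\,\bar h(\Delta)\le K$ for all $\Delta\in(0,1]$. Put $$\bar\pi^i_\Delta(x)=\big(|x|\wedge\bar\varphi_i^{-1}(\bar h(\Delta))\big)\frac{x}{|x|},\qquad \bar\pi^i_\Delta(0)=0 .$$ Let $B$ be a $d$-dimensional Brownian motion and, for each $\ell\in\mathbb S$, let $r^\ell$ be a right-continuous Markov chain on $\mathbb S$ with generator $\Gamma$ and $r^\ell(0)=\ell$, independent of $B$. For $(x_0,\ell)\in\mathbb R^n\times\mathbb S$ and $\Delta\in(0,1]$ let $t_k=k\Delta$, $r_k=r^\ell(t_k)$ and $$\tilde Z_0=x_0,\qquad Z_k=\bar\pi^{r_k}_\Delta(\tilde Z_k),\qquad \tilde Z_{k+1}=Z_k+f(Z_k,r_k)\Delta+g(Z_k,r_k)\big(B(t_{k+1})-B(t_k)\big),\qquad k\ge0,$$ and let $\mathbf P^\Delta_{k\Delta}(x_0,\ell;\cdot)$ be the law of $(Z_k,r_k)$. A probability measure $\mu$ on $\mathbb R^n\times\mathbb S$ is called invariant for $(Z_k,r_k)$ if, for all $k\ge0$, all Borel $\Upsilon\subseteq\mathbb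 R^n$ and all $j\in\mathbb S$, $$\mu(\Upsilon\times\{j\})=\sum_{i=1}^m\int_{\mathbb R^n}\mathbf P^\Delta_{k\Delta}(x,i;\Upsilon\times\{j\})\,\mu(dx\times\{i\}).$$ Then there is a constant $\Delta^{**}\in(0,1]$ such that for every $\Delta\in(0,\Delta^{**}]$ the chain $(Z_k,r_k)$ has a unique invariant probability measure $\mu^\Delta$ on $\mathbb R^n\times\mathbb S$. -/

import Mathlib

open MeasureTheory ProbabilityTheory Filter Topology Set
open scoped NNReal ENNReal Matrix

noncomputable section

namespace SwitchingEM

/-- The trace norm `|A| = √(trace (Aᵀ A))` of a real matrix. -/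
def trNorm {n d : ℕ} (A : Matrix (Fin n) (Fin d) ℝ) : ℝ :=
  Real.sqrt (Matrix.trace (Aᵀ * A))

/-- The row vector `xᵀ A`, as a Euclidean vector. -/
def rowMul {n d : ℕ} (x : EuclideanSpace ℝ (Fin n)) (A : Matrix (Fin n) (Fin d) ℝ) :
    EuclideanSpace ℝ (Fin d) :=
  WithLp.toLp 2 (x.ofLp ᵥ* A)

/-- The product `A v`, as a Euclidean vector. -/
def mulVecE {n d : ℕ} (A : Matrix (Fin n) (Fin d) ℝ) (v : EuclideanSpace ℝ (Fin d)) :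
    EuclideanSpace ℝ (Fin n) :=
  WithLp.toLp 2 (A *ᵥ v.ofLp)

/-- The bilinear expression `xᵀ Q y`. -/
def bil {n : ℕ} (Q : Matrix (Fin n) (Fin n) ℝ) (x y : EuclideanSpace ℝ (Fin n)) : ℝ :=
  x.ofLp ⬝ᵥ (Q *ᵥ y.ofLp)

section Coefficients

variable {n d m : ℕ}

/-- Local Lipschitz continuity of the coefficients, with a constant common to all modes. -/
def LocallyLipschitzCoeff (f : EuclideanSpace ℝ (Fin n) → Fin m → EuclideanSpace ℝ (Fin n))
    (g : EuclideanSpace ℝ (Fin n) → Fin m → Matrix (Fin n) (Fin d) ℝ) : Prop :=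
  ∀ N : ℝ, 0 < N → ∃ C : ℝ, 0 < C ∧ ∀ (x y : EuclideanSpace ℝ (Fin n)) (i : Fin m),
    max ‖x‖ ‖y‖ ≤ N → max ‖f x i - f y i‖ (trNorm (g x i - g y i)) ≤ C * ‖x - y‖

/-- `ψ(x,i) = 2 xᵀ Q f(x,i) + trace (g(x,i)ᵀ Q g(x,i))`. -/
def psi (f : EuclideanSpace ℝ (Fin n) → Fin m → EuclideanSpace ℝ (Fin n))
    (g : EuclideanSpace ℝ (Fin n) → Fin m → Matrix (Fin n) (Fin d) ℝ)
    (Q : Matrix (Fin n) (Fin n) ℝ) (x : EuclideanSpace ℝ (Fin n)) (i : Fin m) : ℝ :=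
  2 * bil Q x (f x i) + Matrix.trace ((g x i)ᵀ * Q * g x i)

/-- The growth condition at infinity, for one matrix `Q` common to all modes. The upper limit
is taken in the extended reals, so that it is the true one also when it is infinite. -/
def GrowthCondition (f : EuclideanSpace ℝ (Fin n) → Fin m → EuclideanSpace ℝ (Fin n))
    (g : EuclideanSpace ℝ (Fin n) → Fin m → Matrix (Fin n) (Fin d) ℝ)
    (Q : Matrix (Fin n) (Fin n) ℝ) (pbar : ℝ) (α : Fin m → ℝ) : Prop :=
  ∀ i : Fin m,
    limsup (fun x : EuclideanSpace ℝ (Fin n) =>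
      ((((1 + bil Q x x) * psi f g Q x i - (2 - pbar) * ‖rowMul x (Q * g x i)‖ ^ 2)
        / bil Q x x ^ 2 : ℝ) : EReal)) (Bornology.cobounded (EuclideanSpace ℝ (Fin n)))
      ≤ (α i : EReal)

/-- The condition on differences of the coefficients: with `F = f(x,i) - f(y,i)` and
`G = g(x,i) - g(y,i)`,
`|x-y|² (2 (x-y)ᵀ F + |G|²) - (2-ρ) |(x-y)ᵀ G|² ≤ β i |x-y|⁴`. -/
def DifferenceCondition (f : EuclideanSpace ℝ (Fin n) → Fin m → EuclideanSpace ℝ (Fin n))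
    (g : EuclideanSpace ℝ (Fin n) → Fin m → Matrix (Fin n) (Fin d) ℝ)
    (ρ : ℝ) (β : Fin m → ℝ) : Prop :=
  ∀ (x y : EuclideanSpace ℝ (Fin n)) (i : Fin m),
    ‖x - y‖ ^ 2 * (2 * inner ℝ (x - y) (f x i - f y i) + trNorm (g x i - g y i) ^ 2)
      - (2 - ρ) * ‖rowMul (x - y) (g x i - g y i)‖ ^ 2 ≤ β i * ‖x - y‖ ^ 4

end Coefficients

section Chain

variable {m : ℕ}

/-- `Γ` is the generator of a Markov chain with state space `Fin m`. -/
def IsGenerator (Γ : Matrix (Fin m) (Fin m) ℝ) : Prop :=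
  (∀ i j, i ≠ j → 0 ≤ Γ i j) ∧ ∀ i, ∑ j, Γ i j = 0

/-- `π` is the only solution of `π Γ = 0`, `∑ π i = 1`, and all its entries are positive. The
existence of such a `π` is the irreducibility of `Γ`; `π` is its stationary distribution. -/
def IsIrreducibleWith (Γ : Matrix (Fin m) (Fin m) ℝ) (π : Fin m → ℝ) : Prop :=
  (π ᵥ* Γ = 0 ∧ ∑ i, π i = 1) ∧ (∀ π' : Fin m → ℝ, π' ᵥ* Γ = 0 → ∑ i, π' i = 1 → π' = π) ∧
    ∀ i, 0 < π i

variable {Ω : Type*} [MeasurableSpace Ω]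

/-- `r` is, under `P`, a right-continuous Markov chain with generator `Γ` that starts from `ℓ`:
given the past up to time `s`, the chain moves from `r s = i` to `r (s + t) = j` with
probability `exp (t Γ) i j`. -/
structure IsMarkovChain (P : Measure Ω) (Γ : Matrix (Fin m) (Fin m) ℝ) (ℓ : Fin m)
    (r : ℝ≥0 → Ω → Fin m) : Prop where
  measurable : ∀ t, Measurable (r t)
  start : ∀ᵐ ω ∂P, r 0 ω = ℓ
  rightContinuous : ∀ᵐ ω ∂P, ∀ t, ContinuousWithinAt (fun s => r s ω) (Ici t) t
  markov : ∀ (s t : ℝ≥0) (i j : Fin m) (A : Set Ω),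
    MeasurableSet[⨆ u ∈ Iic s, MeasurableSpace.comap (r u) inferInstance] A →
    P (A ∩ {ω | r s ω = i} ∩ {ω | r (s + t) ω = j}) =
      P (A ∩ {ω | r s ω = i}) * ENNReal.ofReal (NormedSpace.exp ((t : ℝ) • Γ) i j)

/-- `B` is a `d`-dimensional standard Brownian motion under `P`: its coordinates are independent
real Brownian motions. -/
structure IsBrownianMotion {d : ℕ} (P : Measure Ω)
    (B : ℝ≥0 → Ω → EuclideanSpace ℝ (Fin d)) : Prop where
  measurable : ∀ t, Measurable (B t)
  coord : ∀ a : Fin d, IsBrownianReal (fun t ω => B t ω a) P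
  indep : iIndepFun (fun (a : Fin d) ω (t : ℝ≥0) => B t ω a) P

end Chain

section Scheme

variable {n d m : ℕ}

/-- `φ` is an admissible gauge for the mode `i`: it dominates the local Lipschitz quotients of
`f(·,i)` and `g(·,i)`, and it is either continuous, strictly increasing and unbounded, or (for
globally Lipschitz modes) constant on `[1,∞)`. -/
structure IsGauge (f : EuclideanSpace ℝ (Fin n) → Fin m → EuclideanSpace ℝ (Fin n))
    (g : EuclideanSpace ℝ (Fin n) → Fin m → Matrix (Fin n) (Fin d) ℝ) (i : Fin m)
    (φ : ℝ → ℝ) : Prop where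
  nonneg : ∀ u, 0 ≤ u → 0 ≤ φ u
  shape : (ContinuousOn φ (Ici 0) ∧ StrictMonoOn φ (Ici 0) ∧ Tendsto φ atTop atTop) ∨
    ∃ C : ℝ, ∀ u, 1 ≤ u → φ u = C
  bound : ∀ u, 1 ≤ u → ∀ x y : EuclideanSpace ℝ (Fin n), max ‖x‖ ‖y‖ ≤ u → x ≠ y →
    max (‖f x i - f y i‖ / ‖x - y‖) (trNorm (g x i - g y i) ^ 2 / ‖x - y‖ ^ 2) ≤ φ u

/-- `h` is an admissible truncation rate for the gauges `φ i`. -/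
structure IsTruncationRate (f : EuclideanSpace ℝ (Fin n) → Fin m → EuclideanSpace ℝ (Fin n))
    (g : EuclideanSpace ℝ (Fin n) → Fin m → Matrix (Fin n) (Fin d) ℝ)
    (φ : Fin m → ℝ → ℝ) (h : ℝ → ℝ) : Prop where
  strictAnti : StrictAntiOn h (Ioc 0 1)
  gauge_le : ∀ Δ ∈ Ioc (0 : ℝ) 1, ∀ i, φ i 1 ≤ h Δ
  zero_le : ∀ i, max ‖f 0 i‖ (trNorm (g 0 i) ^ 2) ≤ h 1
  tendsto : Tendsto h (𝓝[>] 0) atTop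
  rate : ∃ θ : ℝ, 0 < θ ∧ θ < 1 / 2 ∧ ∃ K : ℝ, 0 < K ∧
    ∀ Δ ∈ Ioc (0 : ℝ) 1, Δ ^ (1 / 2 - θ) * h Δ ≤ K

/-- The truncation radius `φ⁻¹(v)`, as `sup {u ≥ 0 | φ u ≤ v}` in `[0,∞]`: see
`gaugeInv_of_strictMono` and `gaugeInv_of_const` for the two kinds of gauges. -/
def gaugeInv (φ : ℝ → ℝ) (v : ℝ) : ℝ≥0∞ :=
  ⨆ u ∈ {t : ℝ | 0 ≤ t ∧ φ t ≤ v}, ENNReal.ofReal u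

/-- For a strictly increasing gauge the truncation radius is the value of the inverse function. -/
theorem gaugeInv_of_strictMono {φ : ℝ → ℝ} (hφ : StrictMonoOn φ (Ici 0)) {u : ℝ} (hu : 0 ≤ u) :
    gaugeInv φ (φ u) = ENNReal.ofReal u := by
  apply le_antisymm
  · refine iSup₂_le fun t ht => ENNReal.ofReal_le_ofReal ?_
    exact (hφ.le_iff_le ht.1 hu).1 ht.2
  · exact le_iSup₂_of_le u ⟨hu, le_rfl⟩ le_rfl

/-- For a constant gauge the truncation radius is infinite. -/
theorem gaugeInv_of_const {φ : ℝ → ℝ} {C v : ℝ} (hφ : ∀ u, 1 ≤ u → φ u = C) (hv : C ≤ v) :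
    gaugeInv φ v = ⊤ := by
  refine ENNReal.eq_top_of_forall_nnreal_le fun q => ?_
  refine le_iSup₂_of_le (max 1 (q : ℝ)) ⟨by positivity, ?_⟩ ?_
  · rw [hφ _ (le_max_left _ _)]; exact hv
  · rw [← ENNReal.ofReal_coe_nnreal]
    exact ENNReal.ofReal_le_ofReal (le_max_right _ _)

/-- The truncation map `x ↦ (|x| ∧ R) x / |x|`, with `x / |x| = 0` at `x = 0`. -/
def trunc (R : ℝ≥0∞) (x : EuclideanSpace ℝ (Fin n)) : EuclideanSpace ℝ (Fin n) :=
  (min (ENNReal.ofReal ‖x‖) R).toReal • (‖x‖⁻¹ • x)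

/-- The values before truncation of the truncated Euler-Maruyama scheme with step `Δ` and
radii `R i`, started from `x`, along a mode sequence `r` and noise increments `w`. -/
def preScheme (f : EuclideanSpace ℝ (Fin n) → Fin m → EuclideanSpace ℝ (Fin n))
    (g : EuclideanSpace ℝ (Fin n) → Fin m → Matrix (Fin n) (Fin d) ℝ)
    (R : Fin m → ℝ≥0∞) (Δ : ℝ) (x : EuclideanSpace ℝ (Fin n)) (r : ℕ → Fin m)
    (w : ℕ → EuclideanSpace ℝ (Fin d)) : ℕ → EuclideanSpace ℝ (Fin n)
  | 0 => x
  | k + 1 =>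
    let z := trunc (R (r k)) (preScheme f g R Δ x r w k)
    z + Δ • f z (r k) + mulVecE (g z (r k)) (w k)

/-- The truncated Euler-Maruyama scheme itself. -/
def scheme (f : EuclideanSpace ℝ (Fin n) → Fin m → EuclideanSpace ℝ (Fin n))
    (g : EuclideanSpace ℝ (Fin n) → Fin m → Matrix (Fin n) (Fin d) ℝ)
    (R : Fin m → ℝ≥0∞) (Δ : ℝ) (x : EuclideanSpace ℝ (Fin n)) (r : ℕ → Fin m)
    (w : ℕ → EuclideanSpace ℝ (Fin d)) (k : ℕ) : EuclideanSpace ℝ (Fin n) :=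
  trunc (R (r k)) (preScheme f g R Δ x r w k)

variable {Ω : Type*} [MeasurableSpace Ω]

/-- The transition probability `P_{kΔ}(x, i; A)`: the probability that the pair `(Z_k, r_k)`, for
the scheme with initial data `(x, i)`, is in `A`. Here `B` is the Brownian motion, `r i` is the
chain started from `i`, and `t_k = kΔ`. -/
def transProb (f : EuclideanSpace ℝ (Fin n) → Fin m → EuclideanSpace ℝ (Fin n))
    (g : EuclideanSpace ℝ (Fin n) → Fin m → Matrix (Fin n) (Fin d) ℝ)
    (R : Fin m → ℝ≥0∞) (Δ : ℝ≥0) (P : Measure Ω)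
    (B : ℝ≥0 → Ω → EuclideanSpace ℝ (Fin d)) (r : Fin m → ℝ≥0 → Ω → Fin m) (k : ℕ)
    (z : EuclideanSpace ℝ (Fin n) × Fin m) (A : Set (EuclideanSpace ℝ (Fin n) × Fin m)) : ℝ≥0∞ :=
  P {ω | (scheme f g R Δ z.1 (fun j => r z.2 (j * Δ) ω)
      (fun j => B ((j + 1) * Δ) ω - B (j * Δ) ω) k, r z.2 (k * Δ) ω) ∈ A}

/-- `μ` is an invariant probability measure of the chain `(Z_k, r_k)`. -/
def IsInvariantLaw (f : EuclideanSpace ℝ (Fin n) → Fin m → EuclideanSpace ℝ (Fin n))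
    (g : EuclideanSpace ℝ (Fin n) → Fin m → Matrix (Fin n) (Fin d) ℝ)
    (R : Fin m → ℝ≥0∞) (Δ : ℝ≥0) (P : Measure Ω)
    (B : ℝ≥0 → Ω → EuclideanSpace ℝ (Fin d)) (r : Fin m → ℝ≥0 → Ω → Fin m)
    (μ : Measure (EuclideanSpace ℝ (Fin n) × Fin m)) : Prop :=
  IsProbabilityMeasure μ ∧
    ∀ (k : ℕ) (A : Set (EuclideanSpace ℝ (Fin n))) (j : Fin m), MeasurableSet A →
      μ (A ×ˢ {j}) = ∫⁻ z, transProb f g R Δ P B r k z (A ×ˢ {j}) ∂μ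

end Scheme

end SwitchingEM

end

/-! Two copies of the chain that start in the same mode can be run with the same mode path and the
same noise. The theorem holds because this synchronous coupling contracts, in each mode, the
weighted distance `c i * |x - y| ^ (2q)`, for a small power `q` and suitable weights `c`.

For one Euler step from a difference `D`, a Taylor expansion of `|D + ΔF + √Δ G ξ| ^ (2q)`, averaged
over `ξ` and `-ξ`, gives at most `|D| ^ (2q)` times `1 + qΔβ i + C (h(Δ)Δ)²`
(`integral_rpow_norm_step_le`); the condition on differences enters here through `2q ≤ ρ`.
Truncation supplies the Lipschitz bounds in terms of `h(Δ)` and, being a projection onto a ball,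
does not increase distances. The rate of `h` makes `(h(Δ)Δ)²` of order `o(Δ)`
(`IsTruncationRate.tendsto_sq_mul`).

Single modes may have `β i > 0`; only the average over `π` is negative. With `b = ∑ π i β i` and a
solution `u` of the Poisson equation `Γu = b - β`, the weights `c = 1 + qu` satisfy `Γc + qβc = q(b
+ quβ) < 0` for small `q`, so that one step of the skeleton chain contracts in every mode
(`exists_weights`).

The rest is soft (`IsContracting.existsUnique_invariant`). Laws with the same mode marginal have a
coupling with equal modes, along which Lipschitz test functions merge. For small `Δ` the skeleton
chain has only the invariant law `π`, so two invariant laws have the same marginal and must agree.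
For existence, the chain starts at the origin with mode law `π`. Comparison with one step from the
origin gives a Lyapunov bound and hence tightness; the laws after `k` and `k + 1` steps merge, so by
the Feller property a weak limit point is invariant.

It remains to identify the transition probabilities of the scheme with this abstract chain
(`transProb_eq_iterLaw`, `isInvariantLaw_iff`). -/

noncomputable section

namespace SwitchingEM

/-! ### Taylor bounds for fractional powers, symmetrised in the noise -/

/-- Bernoulli's inequality for an exponent `-s` with `s ≥ 0`. -/
theorem one_sub_mul_le_rpow_neg {s t : ℝ} (hs : 1 ≤ s) (ht : -1 < t) :
    1 - s * t ≤ (1 + t) ^ (-s) := by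
  have h0 : 0 < 1 + t := by linarith
  have h1 : -1 ≤ (1 + t)⁻¹ - 1 := by have := inv_pos.2 h0; linarith
  -- Bernoulli with exponent `s` at the point `(1 + t)⁻¹`; what remains is `(1 + t)⁻¹ ≥ 1 - t`.
  have h2 := one_add_mul_self_le_rpow_one_add h1 hs
  rw [add_sub_cancel, Real.inv_rpow h0.le, ← Real.rpow_neg h0.le] at h2
  refine le_trans ?_ h2
  have h3 : -t ≤ (1 + t)⁻¹ - 1 := by
    rw [le_sub_iff_add_le, inv_eq_one_div, le_div_iff₀ h0]; nlinarith [sq_nonneg t]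
  nlinarith

/-- The third Taylor polynomial at `0` of `(1 + t) ^ q` dominates this function if `0 < q < 1`. -/
theorem rpow_one_add_le_cubic {q t : ℝ} (hq : 0 < q) (hq1 : q < 1) (ht : -1 ≤ t) :
    (1 + t) ^ q ≤ 1 + q * t - q * (1 - q) / 2 * t ^ 2 + q * (1 - q) * (2 - q) / 6 * t ^ 3 := by
  rcases eq_or_lt_of_le ht with rfl | ht
  · rw [add_neg_cancel, Real.zero_rpow hq.ne']
    have : 0 < 1 - q := by linarith
    nlinarith [mul_pos hq this, mul_pos (mul_pos hq this) this]
  set F : ℝ → ℝ := fun t => 1 + q * t - q * (1 - q) / 2 * t ^ 2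
    + q * (1 - q) * (2 - q) / 6 * t ^ 3 - (1 + t) ^ q with hF
  set F' : ℝ → ℝ := fun t => q - q * (1 - q) * t + q * (1 - q) * (2 - q) / 2 * t ^ 2
    - q * (1 + t) ^ (q - 1) with hF'
  set F'' : ℝ → ℝ := fun t => - (q * (1 - q)) + q * (1 - q) * (2 - q) * t
    - q * ((q - 1) * (1 + t) ^ (q - 1 - 1)) with hF''
  have hd : ∀ s ∈ Ioi (-1 : ℝ), HasDerivAt F (F' s) s := by
    intro s hs
    have hs' : 0 < 1 + s := by have := mem_Ioi.1 hs; linarith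
    have h1 : HasDerivAt (fun t : ℝ => (1 + t) ^ q) (1 * q * (1 + s) ^ (q - 1)) s :=
      ((hasDerivAt_id s).const_add 1).rpow_const (Or.inl hs'.ne')
    have h2 := ((((hasDerivAt_id s).const_mul q).const_add 1).sub
      (((hasDerivAt_id s).pow 2).const_mul (q * (1 - q) / 2))).add
      (((hasDerivAt_id s).pow 3).const_mul (q * (1 - q) * (2 - q) / 6))
    refine (h2.sub h1).congr_deriv ?_
    simp only [hF', id]; push_cast; ring
  have hd' : ∀ s ∈ Ioi (-1 : ℝ), HasDerivAt F' (F'' s) s := by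
    intro s hs
    have hs' : 0 < 1 + s := by have := mem_Ioi.1 hs; linarith
    have h1 : HasDerivAt (fun t : ℝ => (1 + t) ^ (q - 1)) (1 * (q - 1) * (1 + s) ^ (q - 1 - 1)) s :=
      ((hasDerivAt_id s).const_add 1).rpow_const (Or.inl hs'.ne')
    have h2 := (((hasDerivAt_id s).const_mul (q * (1 - q))).const_sub q).add
      (((hasDerivAt_id s).pow 2).const_mul (q * (1 - q) * (2 - q) / 2))
    refine (h2.sub (h1.const_mul q)).congr_deriv ?_
    simp only [hF'', id]; push_cast; ring
  have hconv : ConvexOn ℝ (Ioi (-1)) F := by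
    refine convexOn_of_hasDerivWithinAt2_nonneg (f' := F') (f'' := F'') (convex_Ioi _)
      (fun s hs => (hd s hs).continuousAt.continuousWithinAt) ?_ ?_ ?_
    · intro s hs; rw [interior_Ioi] at *; exact (hd s hs).hasDerivWithinAt
    · intro s hs; rw [interior_Ioi] at *; exact (hd' s hs).hasDerivWithinAt
    · intro s hs
      rw [interior_Ioi] at hs
      -- `F''` is `q(1 - q)` times `(1 + s) ^ (-(2 - q)) - (1 - (2 - q)s)`, which Bernoulli makes
      -- nonnegative.
      have := one_sub_mul_le_rpow_neg (s := 2 - q) (by linarith) hs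
      have h2 : q - 1 - 1 = -(2 - q) := by ring
      have h3 : 0 < q * (1 - q) := mul_pos hq (by linarith)
      simp only [hF'', h2]
      nlinarith
  -- The polynomial is the Taylor polynomial at `0`, so `F 0 = F' 0 = 0` and convexity gives `F ≥
  -- 0`.
  have hmin : IsMinOn F (Ioi (-1)) 0 := by
    refine hconv.isMinOn_of_rightDeriv_eq_zero ?_ ?_
    · rw [interior_Ioi]; simp
    · have h0 := hd 0 (by simp)
      rw [(h0.hasDerivWithinAt).derivWithin (uniqueDiffWithinAt_Ioi 0)]
      simp [hF']
  have := hmin (mem_Ioi.2 ht)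
  simp [hF] at this
  linarith

/-- `E` and `O` are the parts that are even and odd in the noise. In the sum of the two cubic bounds
the odd powers of `O` cancel, `-E²` is dropped, and the cubic coefficient is at most `1/3`. -/
theorem rpow_symm_le {q E O : ℝ} (hq : 0 < q) (hq1 : q < 1) (h1 : 0 ≤ 1 + (E + O))
    (h2 : 0 ≤ 1 + (E - O)) :
    (1 + (E + O)) ^ q + (1 + (E - O)) ^ q ≤ 2 * (1 + q * E - q * (1 - q) / 2 * O ^ 2
      + |E| ^ 3 + |E| * O ^ 2) := by
  have a1 := rpow_one_add_le_cubic hq hq1 (by linarith : -1 ≤ E + O)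
  have a2 := rpow_one_add_le_cubic hq hq1 (by linarith : -1 ≤ E - O)
  have h3 : 0 < q * (1 - q) := mul_pos hq (by linarith)
  have h4 : 0 ≤ q * (1 - q) * (2 - q) / 6 := by
    have : 0 < 2 - q := by linarith
    positivity
  have h5 : q * (1 - q) * (2 - q) / 6 ≤ 1 / 3 := by nlinarith [sq_nonneg (q - 1/2)]
  have h6 : E ^ 3 ≤ |E| ^ 3 := by rw [← abs_pow]; exact le_abs_self _
  have h7 : E * O ^ 2 ≤ |E| * O ^ 2 := by gcongr; exact le_abs_self _
  have h8 : 0 ≤ |E| ^ 3 := by positivity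
  have h9 : 0 ≤ |E| * O ^ 2 := by positivity
  have h10 : q * (1 - q) * (2 - q) / 6 * (E ^ 3 + 3 * (E * O ^ 2)) ≤ 1 / 3 * (|E| ^ 3 + 3 * (|E| * O ^ 2)) := by
    calc _ ≤ q * (1 - q) * (2 - q) / 6 * (|E| ^ 3 + 3 * (|E| * O ^ 2)) := by gcongr
      _ ≤ _ := by gcongr
  have h11 : 0 ≤ q * (1 - q) / 2 * E ^ 2 := by positivity
  nlinarith

/-- Bookkeeping for the next lemma: `A`, `b`, `e`, `l`, `M` are `⟨D,f⟩`, `|v|²`, `|f|²`, `⟨D,v⟩`,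
`⟨f,v⟩` divided by `|D|²`. The even part is at most `3η(1 + X)` and the square of the odd part at
most `16ηX`; only `2A + b` and `l²` are kept, all else being of order `η²`. -/
theorem symm_expansion_le {q η X A b e l M : ℝ} (hq : 0 < q) (hq1 : q < 1) (hη : 0 ≤ η)
    (hη1 : η ≤ 1) (hX : 0 ≤ X) (hAη : |A| ≤ η) (hb0 : 0 ≤ b) (hbX : b ≤ η * X) (he0 : 0 ≤ e)
    (heη : e ≤ η ^ 2) (hl2 : l ^ 2 ≤ η * X) (hM2 : M ^ 2 ≤ η ^ 2 * (η * X)) :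
    1 + q * (2 * A + b + e) - q * (1 - q) / 2 * (2 * l + 2 * M) ^ 2 + |2 * A + b + e| ^ 3
      + |2 * A + b + e| * (2 * l + 2 * M) ^ 2 ≤
    1 + q * (2 * A + b) - 2 * q * (1 - q) * l ^ 2 + 100 * η ^ 2 * (1 + X) ^ 3 := by
  have hX1 : X ≤ (1 + X) ^ 3 := by nlinarith only [hX, pow_nonneg hX 3, pow_nonneg hX 2]
  have hX2 : (1 + X) * X ≤ (1 + X) ^ 3 := by nlinarith only [hX, pow_nonneg hX 3, pow_nonneg hX 2]
  have hX3 : 1 ≤ (1 + X) ^ 3 := by nlinarith only [hX, pow_nonneg hX 3, pow_nonneg hX 2]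
  have hη2 : η ^ 2 ≤ η := by nlinarith
  have hE : |2 * A + b + e| ≤ 3 * η * (1 + X) := by
    rw [abs_le] at hAη ⊢
    have : 0 ≤ η * X := by positivity
    constructor <;> linarith
  have hηX : 0 ≤ η * X := by positivity
  have hlM : -(η ^ 2 * X) ≤ l * M := by
    have h1 : |l * M| ≤ η ^ 2 * X := by
      refine abs_le_of_sq_le_sq ?_ (by positivity)
      calc (l * M) ^ 2 = l ^ 2 * M ^ 2 := by ring
        _ ≤ (η * X) * (η ^ 2 * (η * X)) := by gcongr
        _ = (η ^ 2 * X) ^ 2 := by ring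
    exact (abs_le.1 h1).1
  have hO1 : 4 * l ^ 2 - 8 * (η ^ 2 * X) ≤ (2 * l + 2 * M) ^ 2 := by nlinarith [sq_nonneg M]
  have hO2 : (2 * l + 2 * M) ^ 2 ≤ 16 * (η * X) := by
    have : η ^ 2 * (η * X) ≤ 1 * (η * X) := by gcongr; nlinarith
    nlinarith [sq_nonneg (l - M)]
  have t1 : |2 * A + b + e| ^ 3 ≤ 27 * (η ^ 2 * (1 + X) ^ 3) := by
    calc _ ≤ (3 * η * (1 + X)) ^ 3 := by gcongr
      _ = 27 * (η ^ 2 * (1 + X) ^ 3) * η := by ring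
      _ ≤ _ := mul_le_of_le_one_right (by positivity) hη1
  have t2 : |2 * A + b + e| * (2 * l + 2 * M) ^ 2 ≤ 48 * (η ^ 2 * (1 + X) ^ 3) := by
    calc _ ≤ (3 * η * (1 + X)) * (16 * (η * X)) := by gcongr
      _ = 48 * (η ^ 2 * ((1 + X) * X)) := by ring
      _ ≤ _ := by gcongr
  have t3 : q * e ≤ η ^ 2 * (1 + X) ^ 3 := by
    calc q * e ≤ 1 * η ^ 2 := by gcongr
      _ ≤ _ := by rw [one_mul]; exact le_mul_of_one_le_right (by positivity) hX3
  have h3 : 0 < q * (1 - q) := mul_pos hq (by linarith)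
  have h4 : q * (1 - q) ≤ 1 / 4 := by nlinarith [sq_nonneg (q - 1 / 2)]
  have t4 : q * (1 - q) / 2 * (4 * l ^ 2 - 8 * (η ^ 2 * X)) ≤
      q * (1 - q) / 2 * (2 * l + 2 * M) ^ 2 := by gcongr
  have t5 : q * (1 - q) * (4 * (η ^ 2 * X)) ≤ η ^ 2 * (1 + X) ^ 3 := by
    calc _ ≤ 1 / 4 * (4 * (η ^ 2 * X)) := by gcongr
      _ = η ^ 2 * X := by ring
      _ ≤ _ := by gcongr
  have t6 : 0 ≤ η ^ 2 * (1 + X) ^ 3 := by positivity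
  -- The errors add up to `27 + 48 + 1 + 1 = 77` times `η²(1 + X)³`; `100` leaves room.
  linarith

/-- Symmetrising in `v` is essential: it removes the terms of odd order in `v`, among them cubic
ones of size `η ^ (3/2)`, which for `η = h(Δ)Δ` need not be `o(Δ)`. The remainder is then of order
`η²`. -/
theorem norm_rpow_symm_le {E : Type*} [NormedAddCommGroup E] [InnerProductSpace ℝ E]
    {D f v : E} (hD : D ≠ 0) {q η X : ℝ} (hq : 0 < q) (hq1 : q < 1) (hη : 0 ≤ η) (hη1 : η ≤ 1)
    (hX : 0 ≤ X) (hf : ‖f‖ ≤ η * ‖D‖) (hv : ‖v‖ ^ 2 ≤ η * X * ‖D‖ ^ 2) :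
    (‖D + f + v‖ ^ 2) ^ q + (‖D + f - v‖ ^ 2) ^ q ≤ 2 * ((‖D‖ ^ 2) ^ q *
      (1 + q * ((2 * inner ℝ D f + ‖v‖ ^ 2) / ‖D‖ ^ 2)
        - 2 * q * (1 - q) * (inner ℝ D v / ‖D‖ ^ 2) ^ 2 + 100 * η ^ 2 * (1 + X) ^ 3)) := by
  have hn : 0 < ‖D‖ := norm_pos_iff.2 hD
  have ha : 0 < ‖D‖ ^ 2 := by positivity
  set a := ‖D‖ ^ 2 with ha_def
  set A := inner ℝ D f / a with hA
  set b := ‖v‖ ^ 2 / a with hb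
  set e := ‖f‖ ^ 2 / a with he
  set l := inner ℝ D v / a with hl
  set M := inner ℝ f v / a with hM
  have e1 : ‖D + f + v‖ ^ 2 = a * (1 + ((2 * A + b + e) + (2 * l + 2 * M))) := by
    rw [norm_add_sq_real, norm_add_sq_real, inner_add_left, hA, hb, he, hl, hM]
    field_simp; ring
  have e2 : ‖D + f - v‖ ^ 2 = a * (1 + ((2 * A + b + e) - (2 * l + 2 * M))) := by
    rw [norm_sub_sq_real, norm_add_sq_real, inner_add_left, hA, hb, he, hl, hM]
    field_simp; ring
  have p1 : 0 ≤ 1 + ((2 * A + b + e) + (2 * l + 2 * M)) := by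
    refine nonneg_of_mul_nonneg_right (a := a) ?_ ha; rw [← e1]; positivity
  have p2 : 0 ≤ 1 + ((2 * A + b + e) - (2 * l + 2 * M)) := by
    refine nonneg_of_mul_nonneg_right (a := a) ?_ ha; rw [← e2]; positivity
  have key := rpow_symm_le hq hq1 p1 p2
  rw [e1, e2, Real.mul_rpow ha.le p1, Real.mul_rpow ha.le p2, ← mul_add, mul_left_comm]
  refine mul_le_mul_of_nonneg_left (key.trans ?_) (by positivity)
  have hb0 : 0 ≤ b := by positivity
  have he0 : 0 ≤ e := by positivity
  have hbX : b ≤ η * X := by rw [hb, div_le_iff₀ ha]; exact hv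
  have hff : ‖f‖ ^ 2 ≤ η ^ 2 * a := by
    rw [ha_def, ← mul_pow]; gcongr
  have heη : e ≤ η ^ 2 := by rw [he, div_le_iff₀ ha]; exact hff
  have hAη : |A| ≤ η := by
    rw [hA, abs_div, abs_of_pos ha, div_le_iff₀ ha]
    calc _ ≤ ‖D‖ * ‖f‖ := abs_real_inner_le_norm _ _
      _ ≤ ‖D‖ * (η * ‖D‖) := by gcongr
      _ = η * a := by rw [ha_def]; ring
  have hl2 : l ^ 2 ≤ η * X := by
    have h1 : (inner ℝ D v : ℝ) ^ 2 ≤ ‖D‖ ^ 2 * ‖v‖ ^ 2 := by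
      rw [← mul_pow, ← sq_abs]; gcongr; exact abs_real_inner_le_norm _ _
    rw [hl, div_pow, div_le_iff₀ (by positivity)]
    nlinarith
  have hM2 : M ^ 2 ≤ η ^ 2 * (η * X) := by
    have h1 : (inner ℝ f v : ℝ) ^ 2 ≤ ‖f‖ ^ 2 * ‖v‖ ^ 2 := by
      rw [← mul_pow, ← sq_abs]; gcongr; exact abs_real_inner_le_norm _ _
    rw [hM, div_pow, div_le_iff₀ (by positivity)]
    calc _ ≤ ‖f‖ ^ 2 * ‖v‖ ^ 2 := h1
      _ ≤ (η ^ 2 * a) * (η * X * a) := by gcongr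
      _ = _ := by ring
  have e3 : (2 * inner ℝ D f + ‖v‖ ^ 2) / a = 2 * A + b := by rw [hA, hb]; ring
  rw [e3]
  exact mul_le_mul_of_nonneg_left (symm_expansion_le hq hq1 hη hη1 hX hAη hb0 hbX he0 heη hl2 hM2)
    zero_le_two

/-! ### The trace norm as the Frobenius norm -/

section Matrix
variable {n d : ℕ}

theorem trNorm_sq (A : Matrix (Fin n) (Fin d) ℝ) : trNorm A ^ 2 = ∑ i, ∑ j, A i j ^ 2 := by
  have h : Matrix.trace (Aᵀ * A) = ∑ i, ∑ j, A i j ^ 2 := by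
    rw [Finset.sum_comm]
    simp [Matrix.trace, Matrix.mul_apply, sq]
  rw [trNorm, h, Real.sq_sqrt (by positivity)]

theorem trNorm_nonneg (A : Matrix (Fin n) (Fin d) ℝ) : 0 ≤ trNorm A := Real.sqrt_nonneg _

theorem continuous_mulVecE (A : Matrix (Fin n) (Fin d) ℝ) : Continuous (mulVecE A) :=
  (LinearMap.toContinuousLinearMap (Matrix.toEuclideanLin A)).continuous

theorem mulVecE_neg (A : Matrix (Fin n) (Fin d) ℝ) (v : EuclideanSpace ℝ (Fin d)) :
    mulVecE A (-v) = -mulVecE A v :=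
  (Matrix.toEuclideanLin A).map_neg v

theorem mulVecE_smul (A : Matrix (Fin n) (Fin d) ℝ) (c : ℝ) (v : EuclideanSpace ℝ (Fin d)) :
    mulVecE A (c • v) = c • mulVecE A v :=
  (Matrix.toEuclideanLin A).map_smul c v

theorem sub_mulVecE (A B : Matrix (Fin n) (Fin d) ℝ) (v : EuclideanSpace ℝ (Fin d)) :
    mulVecE (A - B) v = mulVecE A v - mulVecE B v := by
  simp [mulVecE, Matrix.sub_mulVec]

theorem mulVecE_apply (A : Matrix (Fin n) (Fin d) ℝ) (v : EuclideanSpace ℝ (Fin d)) (i : Fin n) :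
    mulVecE A v i = inner ℝ (WithLp.toLp 2 (A i)) v := by
  simp [mulVecE, Matrix.mulVec, dotProduct, PiLp.inner_apply, mul_comm]

theorem inner_mulVecE (A : Matrix (Fin n) (Fin d) ℝ) (x : EuclideanSpace ℝ (Fin n))
    (v : EuclideanSpace ℝ (Fin d)) : inner ℝ x (mulVecE A v) = inner ℝ (rowMul x A) v := by
  rw [EuclideanSpace.inner_eq_star_dotProduct, EuclideanSpace.inner_eq_star_dotProduct]
  simp only [mulVecE, rowMul, star_trivial]
  rw [dotProduct_comm, Matrix.dotProduct_mulVec, dotProduct_comm]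

theorem norm_mulVecE_sq_eq (A : Matrix (Fin n) (Fin d) ℝ) (v : EuclideanSpace ℝ (Fin d)) :
    ‖mulVecE A v‖ ^ 2 = ∑ i, (inner ℝ (WithLp.toLp 2 (A i)) v : ℝ) ^ 2 := by
  rw [EuclideanSpace.norm_sq_eq]
  simp_rw [mulVecE_apply, Real.norm_eq_abs, sq_abs]

theorem trNorm_sq_eq (A : Matrix (Fin n) (Fin d) ℝ) :
    trNorm A ^ 2 = ∑ i, ‖(WithLp.toLp 2 (A i) : EuclideanSpace ℝ (Fin d))‖ ^ 2 := by
  rw [trNorm_sq]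
  simp [EuclideanSpace.norm_sq_eq]

theorem norm_mulVecE_sq_le (A : Matrix (Fin n) (Fin d) ℝ) (v : EuclideanSpace ℝ (Fin d)) :
    ‖mulVecE A v‖ ^ 2 ≤ trNorm A ^ 2 * ‖v‖ ^ 2 := by
  rw [norm_mulVecE_sq_eq, trNorm_sq_eq, Finset.sum_mul]
  refine Finset.sum_le_sum fun i _ => ?_
  rw [← mul_pow, ← sq_abs]
  gcongr
  exact abs_real_inner_le_norm _ _

end Matrix

/-! ### Gaussian moments and the one-step moment estimate -/

section Gaussian
variable {n d : ℕ}

theorem integrable_norm_pow_stdGaussian (k : ℕ) :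
    Integrable (fun ξ => ‖ξ‖ ^ k) (stdGaussian (EuclideanSpace ℝ (Fin d))) := by
  have := (IsGaussian.memLp_id (stdGaussian (EuclideanSpace ℝ (Fin d))) k (by simp))
  exact this.integrable_norm_pow'

theorem integrable_one_add_norm_sq_pow_stdGaussian :
    Integrable (fun ξ => (1 + ‖ξ‖ ^ 2) ^ 3) (stdGaussian (EuclideanSpace ℝ (Fin d))) := by
  have : (fun ξ : EuclideanSpace ℝ (Fin d) => (1 + ‖ξ‖ ^ 2) ^ 3) =
      fun ξ => 1 + 3 * ‖ξ‖ ^ 2 + 3 * ‖ξ‖ ^ 4 + ‖ξ‖ ^ 6 := by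
    ext; ring
  rw [this]
  exact (((integrable_const _).add ((integrable_norm_pow_stdGaussian 2).const_mul 3)).add
    ((integrable_norm_pow_stdGaussian 4).const_mul 3)).add (integrable_norm_pow_stdGaussian 6)

theorem integrable_inner_sq_stdGaussian (u : EuclideanSpace ℝ (Fin d)) :
    Integrable (fun ξ => (inner ℝ u ξ : ℝ) ^ 2) (stdGaussian (EuclideanSpace ℝ (Fin d))) := by
  refine ((integrable_norm_pow_stdGaussian 2).const_mul (‖u‖ ^ 2)).mono'
    (by fun_prop) (ae_of_all _ fun ξ => ?_)
  rw [Real.norm_eq_abs, abs_of_nonneg (sq_nonneg _), ← mul_pow, ← sq_abs]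
  gcongr
  exact abs_real_inner_le_norm _ _

theorem integral_inner_sq_stdGaussian (u : EuclideanSpace ℝ (Fin d)) :
    ∫ ξ, (inner ℝ u ξ : ℝ) ^ 2 ∂stdGaussian (EuclideanSpace ℝ (Fin d)) = ‖u‖ ^ 2 := by
  have h := variance_dual_stdGaussian (innerSL ℝ u)
  rw [variance_of_integral_eq_zero (by fun_prop) (integral_strongDual_stdGaussian _)] at h
  simpa using h

theorem integrable_norm_mulVecE_sq (A : Matrix (Fin n) (Fin d) ℝ) :
    Integrable (fun ξ => ‖mulVecE A ξ‖ ^ 2) (stdGaussian (EuclideanSpace ℝ (Fin d))) := by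
  simp_rw [norm_mulVecE_sq_eq]
  exact integrable_finsetSum _ fun i _ => integrable_inner_sq_stdGaussian _

theorem integral_norm_mulVecE_sq (A : Matrix (Fin n) (Fin d) ℝ) :
    ∫ ξ, ‖mulVecE A ξ‖ ^ 2 ∂stdGaussian (EuclideanSpace ℝ (Fin d)) = trNorm A ^ 2 := by
  simp_rw [norm_mulVecE_sq_eq]
  rw [integral_finsetSum _ fun i _ => integrable_inner_sq_stdGaussian _, trNorm_sq_eq]
  simp_rw [integral_inner_sq_stdGaussian]

theorem integral_comp_neg_stdGaussian (φ : EuclideanSpace ℝ (Fin d) → ℝ) :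
    ∫ ξ, φ (-ξ) ∂stdGaussian (EuclideanSpace ℝ (Fin d)) =
      ∫ ξ, φ ξ ∂stdGaussian (EuclideanSpace ℝ (Fin d)) := by
  have h : MeasurePreserving (LinearIsometryEquiv.neg ℝ (E := EuclideanSpace ℝ (Fin d)))
      (stdGaussian (EuclideanSpace ℝ (Fin d))) (stdGaussian (EuclideanSpace ℝ (Fin d))) :=
    ⟨(LinearIsometryEquiv.continuous _).measurable, stdGaussian_map _⟩
  exact h.integral_comp (LinearIsometryEquiv.neg ℝ
    (E := EuclideanSpace ℝ (Fin d))).toHomeomorph.measurableEmbedding φ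

theorem integrable_rpow_norm_affine {q : ℝ} (hq : 0 < q) (hq1 : q ≤ 1)
    (x : EuclideanSpace ℝ (Fin n)) (A : Matrix (Fin n) (Fin d) ℝ) :
    Integrable (fun ξ => (‖x + mulVecE A ξ‖ ^ 2) ^ q)
      (stdGaussian (EuclideanSpace ℝ (Fin d))) := by
  have hc := continuous_mulVecE A
  refine (((integrable_const (1 + 2 * ‖x‖ ^ 2)).add
    ((integrable_norm_mulVecE_sq A).const_mul 2))).mono' ?_ (ae_of_all _ fun ξ => ?_)
  · exact Continuous.aestronglyMeasurable
      (((continuous_const.add hc).norm.pow 2).rpow_const fun _ => Or.inr hq.le)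
  · have h0 : 0 ≤ ‖x + mulVecE A ξ‖ ^ 2 := by positivity
    rw [Real.norm_of_nonneg (by positivity)]
    have h1 : (‖x + mulVecE A ξ‖ ^ 2) ^ q ≤ 1 + ‖x + mulVecE A ξ‖ ^ 2 := by
      calc _ ≤ (1 + ‖x + mulVecE A ξ‖ ^ 2) ^ q := by gcongr; linarith
        _ ≤ (1 + ‖x + mulVecE A ξ‖ ^ 2) ^ (1 : ℝ) := by gcongr; linarith
        _ = _ := Real.rpow_one _
    have h2 : ‖x + mulVecE A ξ‖ ^ 2 ≤ 2 * ‖x‖ ^ 2 + 2 * ‖mulVecE A ξ‖ ^ 2 := by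
      have := norm_add_le x (mulVecE A ξ)
      calc _ ≤ (‖x‖ + ‖mulVecE A ξ‖) ^ 2 := by gcongr
        _ ≤ _ := by nlinarith [sq_nonneg (‖x‖ - ‖mulVecE A ξ‖)]
    simp only [Pi.add_apply]
    linarith

/-- The constant of the second-order error term in the one-step estimate. -/
def stepConst (d : ℕ) : ℝ :=
  100 * ∫ ξ, (1 + ‖ξ‖ ^ 2) ^ 3 ∂stdGaussian (EuclideanSpace ℝ (Fin d))

/-- One Euler step for the difference of two solutions, in the mean of order `2q`. -/
theorem integral_rpow_norm_step_le {D F : EuclideanSpace ℝ (Fin n)}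
    {G : Matrix (Fin n) (Fin d) ℝ} (hD : D ≠ 0) {q h Δ ρ β : ℝ} (hq : 0 < q) (hq1 : q < 1)
    (hΔ : 0 < Δ) (hh : 0 ≤ h) (hhΔ : h * Δ ≤ 1) (hF : ‖F‖ ≤ h * ‖D‖)
    (hG : trNorm G ^ 2 ≤ h * ‖D‖ ^ 2) (hqρ : 2 * q ≤ ρ)
    (hcond : ‖D‖ ^ 2 * (2 * inner ℝ D F + trNorm G ^ 2) - (2 - ρ) * ‖rowMul D G‖ ^ 2
      ≤ β * ‖D‖ ^ 4) :
    ∫ ξ, (‖D + Δ • F + mulVecE (√Δ • G) ξ‖ ^ 2) ^ q ∂stdGaussian (EuclideanSpace ℝ (Fin d)) ≤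
      (‖D‖ ^ 2) ^ q * (1 + q * Δ * β + stepConst d * (h * Δ) ^ 2) := by
  have hn : 0 < ‖D‖ := norm_pos_iff.2 hD
  set γ := stdGaussian (EuclideanSpace ℝ (Fin d)) with hγ
  set A := √Δ • G with hA
  set a := ‖D‖ ^ 2 with ha
  have ha0 : 0 < a := by positivity
  have hAG : trNorm A ^ 2 = Δ * trNorm G ^ 2 := by
    simp [trNorm_sq, hA, mul_pow, Real.sq_sqrt hΔ.le, Finset.mul_sum]
  have hrow : rowMul D A = √Δ • rowMul D G := by
    simp [rowMul, hA, Matrix.vecMul_smul]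
  have hrow2 : ‖rowMul D A‖ ^ 2 = Δ * ‖rowMul D G‖ ^ 2 := by
    rw [hrow, norm_smul, mul_pow, Real.norm_of_nonneg (Real.sqrt_nonneg _), Real.sq_sqrt hΔ.le]
  -- The symmetrised bound with `η = hΔ`, `X = |ξ|²`, drift `ΔF` and noise `√Δ Gξ`.
  have pt : ∀ ξ, (‖D + Δ • F + mulVecE A ξ‖ ^ 2) ^ q + (‖D + Δ • F + mulVecE A (-ξ)‖ ^ 2) ^ q ≤
      2 * (a ^ q * (1 + q * ((2 * inner ℝ D (Δ • F) + ‖mulVecE A ξ‖ ^ 2) / a)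
        - 2 * q * (1 - q) * (inner ℝ (rowMul D A) ξ / a) ^ 2
        + 100 * (h * Δ) ^ 2 * (1 + ‖ξ‖ ^ 2) ^ 3)) := by
    intro ξ
    rw [mulVecE_neg, ← sub_eq_add_neg, ← inner_mulVecE]
    refine norm_rpow_symm_le hD hq hq1 (by positivity) hhΔ (by positivity) ?_ ?_
    · rw [norm_smul, Real.norm_of_nonneg hΔ.le]; nlinarith
    · refine (norm_mulVecE_sq_le A ξ).trans ?_
      rw [hAG]
      calc Δ * trNorm G ^ 2 * ‖ξ‖ ^ 2 ≤ Δ * (h * a) * ‖ξ‖ ^ 2 := by gcongr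
        _ = _ := by ring
  have i1 : Integrable (fun ξ => (‖D + Δ • F + mulVecE A ξ‖ ^ 2) ^ q) γ :=
    integrable_rpow_norm_affine hq hq1.le _ _
  have i2 : Integrable (fun ξ => (‖D + Δ • F + mulVecE A (-ξ)‖ ^ 2) ^ q) γ := by
    have := integrable_rpow_norm_affine hq hq1.le (D + Δ • F) (-A)
    refine this.congr (ae_of_all _ fun ξ => ?_)
    simp only [mulVecE, Matrix.neg_mulVec, WithLp.ofLp_neg, Matrix.mulVec_neg]
  have j1 : Integrable (fun ξ => ‖mulVecE A ξ‖ ^ 2) γ := integrable_norm_mulVecE_sq A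
  have j2 : Integrable (fun ξ => (inner ℝ (rowMul D A) ξ : ℝ) ^ 2) γ :=
    integrable_inner_sq_stdGaussian _
  have j3 : Integrable (fun ξ => (1 + ‖ξ‖ ^ 2) ^ 3) γ := integrable_one_add_norm_sq_pow_stdGaussian
  -- The bound is a linear combination of functions with known or finite Gaussian mean.
  have e : ∀ ξ, 2 * (a ^ q * (1 + q * ((2 * inner ℝ D (Δ • F) + ‖mulVecE A ξ‖ ^ 2) / a)
        - 2 * q * (1 - q) * (inner ℝ (rowMul D A) ξ / a) ^ 2
        + 100 * (h * Δ) ^ 2 * (1 + ‖ξ‖ ^ 2) ^ 3)) =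
      2 * a ^ q * (1 + q * (2 * inner ℝ D (Δ • F)) / a)
      + 2 * a ^ q * (q / a) * ‖mulVecE A ξ‖ ^ 2
      + (- (2 * a ^ q * (2 * q * (1 - q) / a ^ 2))) * (inner ℝ (rowMul D A) ξ) ^ 2
      + 2 * a ^ q * (100 * (h * Δ) ^ 2) * (1 + ‖ξ‖ ^ 2) ^ 3 := by
    intro ξ; field_simp; ring
  have key := integral_mono (i1.add i2) ?_ pt
  · simp only [Pi.add_apply] at key
    -- By symmetry of the Gaussian law both integrals on the left are equal, and the factor `2`
    -- cancels in the end.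
    rw [integral_add i1 i2, integral_comp_neg_stdGaussian
      (fun ξ => (‖D + Δ • F + mulVecE A ξ‖ ^ 2) ^ q), integral_congr_ae (ae_of_all _ e),
      integral_add (by fun_prop) (by fun_prop), integral_add (by fun_prop) (by fun_prop),
      integral_add (by fun_prop) (by fun_prop), integral_const, integral_const_mul,
      integral_const_mul, integral_const_mul, integral_norm_mulVecE_sq, integral_inner_sq_stdGaussian, hAG, hrow2,
      inner_smul_right] at key
    simp only [probReal_univ, one_smul] at key
    rw [stepConst, ← hγ]
    set J := ∫ ξ, (1 + ‖ξ‖ ^ 2) ^ 3 ∂γ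
    have haq : 0 < a ^ q := Real.rpow_pos_of_pos ha0 q
    -- The second-order Taylor term leaves the coefficient `2 - 2q`, which is at least `2 - ρ`; this
    -- is where `2 * q ≤ ρ` turns `hcond` into the rate `β`.
    have main : q * Δ * ((2 * inner ℝ D F + trNorm G ^ 2) / a
        - 2 * (1 - q) * ‖rowMul D G‖ ^ 2 / a ^ 2) ≤ q * Δ * β := by
      refine mul_le_mul_of_nonneg_left ?_ (by positivity)
      have e4 : β * ‖D‖ ^ 4 = β * a ^ 2 := by rw [ha]; ring
      rw [e4] at hcond
      have e5 : (2 * inner ℝ D F + trNorm G ^ 2) / a - 2 * (1 - q) * ‖rowMul D G‖ ^ 2 / a ^ 2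
        = (a * (2 * inner ℝ D F + trNorm G ^ 2) - (2 - 2 * q) * ‖rowMul D G‖ ^ 2) / a ^ 2 := by
        field_simp
      rw [e5, div_le_iff₀ (by positivity)]
      nlinarith [sq_nonneg ‖rowMul D G‖]
    have e6 : 2 * a ^ q * (1 + q * (2 * (Δ * inner ℝ D F)) / a)
        + 2 * a ^ q * (q / a) * (Δ * trNorm G ^ 2)
        + (- (2 * a ^ q * (2 * q * (1 - q) / a ^ 2))) * (Δ * ‖rowMul D G‖ ^ 2)
        + 2 * a ^ q * (100 * (h * Δ) ^ 2) * J =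
      2 * (a ^ q * (1 + q * Δ * ((2 * inner ℝ D F + trNorm G ^ 2) / a
        - 2 * (1 - q) * ‖rowMul D G‖ ^ 2 / a ^ 2) + 100 * J * (h * Δ) ^ 2)) := by
      field_simp; ring
    rw [e6] at key
    have := mul_le_mul_of_nonneg_left (add_le_add_left (add_le_add_right main 1)
      (100 * J * (h * Δ) ^ 2)) haq.le
    linarith
  · refine Integrable.congr ?_ (ae_of_all _ fun ξ => (e ξ).symm)
    fun_prop

end Gaussian

/-! ### Truncation as projection onto a ball; Lipschitz bounds on that ball -/

section Trunc
variable {n d m : ℕ}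

theorem trunc_of_le {R : ℝ≥0∞} {x : EuclideanSpace ℝ (Fin n)} (hx : ENNReal.ofReal ‖x‖ ≤ R) :
    trunc R x = x := by
  rw [trunc, min_eq_left hx, ENNReal.toReal_ofReal (norm_nonneg x), smul_smul]
  rcases eq_or_ne x 0 with rfl | h
  · simp
  · rw [mul_inv_cancel₀ (norm_ne_zero_iff.2 h), one_smul]

theorem trunc_zero (R : ℝ≥0∞) : trunc R (0 : EuclideanSpace ℝ (Fin n)) = 0 := by
  simp [trunc]

theorem norm_trunc (R : ℝ≥0∞) (x : EuclideanSpace ℝ (Fin n)) :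
    ‖trunc R x‖ = (min (ENNReal.ofReal ‖x‖) R).toReal := by
  rw [trunc, norm_smul, Real.norm_of_nonneg ENNReal.toReal_nonneg]
  rcases eq_or_ne x 0 with rfl | h
  · simp
  · rw [norm_smul, norm_inv, norm_norm, inv_mul_cancel₀ (norm_ne_zero_iff.2 h), mul_one]

theorem ofReal_norm_trunc_le (R : ℝ≥0∞) (x : EuclideanSpace ℝ (Fin n)) :
    ENNReal.ofReal ‖trunc R x‖ ≤ R := by
  rw [norm_trunc, ENNReal.ofReal_toReal]
  · exact min_le_right _ _
  · exact ne_top_of_le_ne_top ENNReal.ofReal_ne_top (min_le_left _ _)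

theorem trunc_trunc (R : ℝ≥0∞) (x : EuclideanSpace ℝ (Fin n)) :
    trunc R (trunc R x) = trunc R x :=
  trunc_of_le (ofReal_norm_trunc_le R x)

/-- The variational inequality of the projection onto a ball. -/
theorem inner_sub_trunc_nonpos {R : ℝ≥0∞} (x : EuclideanSpace ℝ (Fin n))
    {y : EuclideanSpace ℝ (Fin n)} (hy : ENNReal.ofReal ‖y‖ ≤ R) :
    inner ℝ (x - trunc R x) (y - trunc R x) ≤ 0 := by
  rcases le_total (ENNReal.ofReal ‖x‖) R with h | h
  · simp [trunc_of_le h]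
  have hR : R ≠ ⊤ := ne_top_of_le_ne_top ENNReal.ofReal_ne_top h
  rcases eq_or_ne x 0 with rfl | hx
  · simp [trunc_zero]
  have hx0 : 0 < ‖x‖ := norm_pos_iff.2 hx
  set s := R.toReal / ‖x‖ with hs
  have hsx : trunc R x = s • x := by rw [trunc, min_eq_right h, smul_smul]; rfl
  have hRx : R.toReal ≤ ‖x‖ := ENNReal.toReal_le_of_le_ofReal (norm_nonneg x) h
  have hyR : ‖y‖ ≤ R.toReal := (ENNReal.ofReal_le_iff_le_toReal hR).1 hy
  have hs1 : s ≤ 1 := by rw [hs, div_le_one hx0]; exact hRx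
  have hxx : s * ‖x‖ ^ 2 = R.toReal * ‖x‖ := by rw [hs]; field_simp
  have e : x - s • x = (1 - s) • x := by rw [sub_smul, one_smul]
  rw [hsx, e, inner_smul_left, inner_sub_right, inner_smul_right, real_inner_self_eq_norm_sq, hxx]
  refine mul_nonpos_of_nonneg_of_nonpos (by simpa using hs1) ?_
  have := real_inner_le_norm x y
  nlinarith

/-- A projection onto a convex set is nonexpansive: the variational inequalities at both points are
added, and Cauchy–Schwarz does the rest. -/
theorem norm_trunc_sub_le (R : ℝ≥0∞) (x y : EuclideanSpace ℝ (Fin n)) :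
    ‖trunc R x - trunc R y‖ ≤ ‖x - y‖ := by
  have h1 := inner_sub_trunc_nonpos x (ofReal_norm_trunc_le R y)
  have h2 := inner_sub_trunc_nonpos y (ofReal_norm_trunc_le R x)
  set a := trunc R x
  set b := trunc R y
  have e : ‖a - b‖ ^ 2 = inner ℝ (x - y) (a - b) + inner ℝ (x - a) (b - a)
      + inner ℝ (y - b) (a - b) := by
    rw [← real_inner_self_eq_norm_sq, ← neg_sub a b, inner_neg_right, ← sub_eq_add_neg,
      ← inner_sub_left, ← inner_add_left]
    congr 1; abel
  have h3 := real_inner_le_norm (x - y) (a - b)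
  rcases (norm_nonneg (a - b)).eq_or_lt with h0 | h0
  · rw [← h0]; exact norm_nonneg _
  · nlinarith

theorem continuous_trunc (R : ℝ≥0∞) :
    Continuous (trunc R : EuclideanSpace ℝ (Fin n) → EuclideanSpace ℝ (Fin n)) :=
  (LipschitzWith.of_dist_le_mul (K := 1) fun x y => by
    simpa [dist_eq_norm] using norm_trunc_sub_le R x y).continuous

variable {f : EuclideanSpace ℝ (Fin n) → Fin m → EuclideanSpace ℝ (Fin n)}
  {g : EuclideanSpace ℝ (Fin n) → Fin m → Matrix (Fin n) (Fin d) ℝ} {i : Fin m} {φ : ℝ → ℝ}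

/-- Two points of the ball of radius `φ⁻¹(v)` are in a ball on which the gauge is at most `v`. -/
theorem IsGauge.exists_radius (hφ : IsGauge f g i φ) {v : ℝ} (hv : φ 1 ≤ v)
    {x y : EuclideanSpace ℝ (Fin n)} (hx : ENNReal.ofReal ‖x‖ ≤ gaugeInv φ v)
    (hy : ENNReal.ofReal ‖y‖ ≤ gaugeInv φ v) : ∃ u, 1 ≤ u ∧ φ u ≤ v ∧ max ‖x‖ ‖y‖ ≤ u := by
  rcases hφ.shape with ⟨hc, hm, ht⟩ | ⟨C, hC⟩
  · obtain ⟨b, hb, hb1⟩ := ((ht.eventually_ge_atTop v).and (eventually_ge_atTop 1)).exists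
    -- The level `v` is a value of the gauge, so the truncation radius is its preimage `u`. A
    -- constant gauge, in the other case, allows any radius.
    obtain ⟨u, hu, rfl⟩ := intermediate_value_Icc hb1
      (hc.mono fun t ht => zero_le_one.trans ht.1) ⟨hv, hb⟩
    have hu0 : 0 ≤ u := zero_le_one.trans hu.1
    rw [gaugeInv_of_strictMono hm hu0, ENNReal.ofReal_le_ofReal_iff hu0] at hx hy
    exact ⟨u, hu.1, le_rfl, max_le hx hy⟩
  · refine ⟨max 1 (max ‖x‖ ‖y‖), le_max_left _ _, ?_, le_max_right _ _⟩
    rw [hC _ (le_max_left _ _)]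
    exact (hC 1 le_rfl).symm.trans_le hv

/-- This is what truncation achieves: among truncated points the drift is Lipschitz with constant
`v` and the diffusion with `√v`, as `integral_rpow_norm_step_le` requires with `h = v`. -/
theorem IsGauge.lipschitz (hφ : IsGauge f g i φ) {v : ℝ} (hv : φ 1 ≤ v)
    {x y : EuclideanSpace ℝ (Fin n)} (hx : ENNReal.ofReal ‖x‖ ≤ gaugeInv φ v)
    (hy : ENNReal.ofReal ‖y‖ ≤ gaugeInv φ v) :
    ‖f x i - f y i‖ ≤ v * ‖x - y‖ ∧ trNorm (g x i - g y i) ^ 2 ≤ v * ‖x - y‖ ^ 2 := by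
  rcases eq_or_ne x y with rfl | hxy
  · simp [trNorm]
  obtain ⟨u, hu1, hu, hmax⟩ := hφ.exists_radius hv hx hy
  have h0 : 0 < ‖x - y‖ := norm_pos_iff.2 (sub_ne_zero.2 hxy)
  have := (hφ.bound u hu1 x y hmax hxy).trans hu
  rw [max_le_iff, div_le_iff₀ h0, div_le_iff₀ (by positivity)] at this
  exact this

end Trunc

/-! ### Continuity of the coefficients -/

section Coefficients
variable {n d m : ℕ} {f : EuclideanSpace ℝ (Fin n) → Fin m → EuclideanSpace ℝ (Fin n)}
  {g : EuclideanSpace ℝ (Fin n) → Fin m → Matrix (Fin n) (Fin d) ℝ}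

theorem LocallyLipschitzCoeff.continuous_drift (hfg : LocallyLipschitzCoeff f g) (i : Fin m) :
    Continuous (fun x => f x i) := by
  refine continuous_iff_continuousAt.2 fun x => ?_
  obtain ⟨C, hC, h⟩ := hfg (‖x‖ + 1) (by positivity)
  refine continuousAt_of_locally_lipschitz (r := 1) one_pos C fun y hy => ?_
  have hy' : ‖y - x‖ < 1 := by rwa [← dist_eq_norm]
  have : ‖y‖ ≤ ‖x‖ + 1 := by have := norm_le_norm_add_norm_sub x y; rw [norm_sub_rev] at this; linarith
  rw [dist_eq_norm, dist_eq_norm]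
  exact (le_max_left _ _).trans (h y x i (max_le this (by linarith)))

theorem LocallyLipschitzCoeff.continuous_diffusion (hfg : LocallyLipschitzCoeff f g) (i : Fin m) :
    Continuous (fun x => g x i) := by
  refine continuous_matrix fun a b => continuous_iff_continuousAt.2 fun x => ?_
  obtain ⟨C, hC, h⟩ := hfg (‖x‖ + 1) (by positivity)
  refine continuousAt_of_locally_lipschitz (r := 1) one_pos C fun y hy => ?_
  have hy' : ‖y - x‖ < 1 := by rwa [← dist_eq_norm]
  have : ‖y‖ ≤ ‖x‖ + 1 := by have := norm_le_norm_add_norm_sub x y; rw [norm_sub_rev] at this; linarith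
  rw [dist_eq_norm]
  refine le_trans ?_ ((le_max_right _ _).trans (h y x i (max_le this (by linarith))))
  rw [Real.norm_eq_abs]
  refine abs_le_of_sq_le_sq ?_ (trNorm_nonneg _)
  rw [trNorm_sq]
  calc (g y i a b - g x i a b) ^ 2 = (g y i - g x i) a b ^ 2 := rfl
    _ ≤ ∑ b', (g y i - g x i) a b' ^ 2 :=
        Finset.single_le_sum (f := fun b' => (g y i - g x i) a b' ^ 2)
          (fun _ _ => sq_nonneg _) (Finset.mem_univ b)
    _ ≤ _ := Finset.single_le_sum (f := fun a' => ∑ b', (g y i - g x i) a' b' ^ 2)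
          (fun _ _ => Finset.sum_nonneg fun _ _ => sq_nonneg _) (Finset.mem_univ a)

end Coefficients

/-! ### The generator: Poisson equation, skeleton chain and weights -/

section Generator
variable {m : ℕ} {Γ : Matrix (Fin m) (Fin m) ℝ} {π : Fin m → ℝ}

/-- The left kernel is spanned by `π`: an element with nonzero sum can be normalised, one with sum
zero can be added to `π`, and uniqueness of `π` decides both cases. -/
theorem IsIrreducibleWith.eq_smul (hπ : IsIrreducibleWith Γ π) {v : Fin m → ℝ}
    (hv : v ᵥ* Γ = 0) : v = (∑ i, v i) • π := by
  obtain ⟨⟨h0, h1⟩, hu, -⟩ := hπ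
  rcases eq_or_ne (∑ i, v i) 0 with hs | hs
  · have := hu (π + v) (by rw [Matrix.add_vecMul, h0, hv, add_zero])
      (by simp [Finset.sum_add_distrib, h1, hs])
    rw [hs, zero_smul]
    simpa using this
  · have := hu ((∑ i, v i)⁻¹ • v) (by rw [Matrix.smul_vecMul, hv, smul_zero])
      (by simp [← Finset.mul_sum, hs])
    rw [← this, smul_smul, mul_inv_cancel₀ hs, one_smul]

/-- Solvability of the Poisson equation of an irreducible generator. -/
theorem IsIrreducibleWith.exists_mulVec_eq (hπ : IsIrreducibleWith Γ π) {b : Fin m → ℝ}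
    (hb : π ⬝ᵥ b = 0) : ∃ u, Γ *ᵥ u = b := by
  by_contra hne
  have hmem : b ∉ LinearMap.range Γ.mulVecLin := by
    rintro ⟨u, hu⟩; exact hne ⟨u, hu⟩
  -- Fredholm alternative: a functional that vanishes on the range of `Γ` but not at `b` would be a
  -- left null vector, hence a multiple of `π`, and so would kill `b`.
  obtain ⟨ψ, hψ, hker⟩ := Submodule.exists_dual_map_eq_bot_of_notMem hmem inferInstance
  set v : Fin m → ℝ := fun i => ψ (Pi.single i 1) with hv
  have hψv : ∀ x, ψ x = v ⬝ᵥ x := by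
    intro x
    rw [LinearMap.pi_apply_eq_sum_univ ψ x]
    refine Finset.sum_congr rfl fun i _ => ?_
    rw [smul_eq_mul, mul_comm, hv]
    congr 2
    ext j; simp [Pi.single_apply, eq_comm]
  have hvΓ : v ᵥ* Γ = 0 := by
    ext j
    have h0 : ψ (Γ *ᵥ Pi.single j 1) = 0 := by
      have : ψ (Γ *ᵥ Pi.single j 1) ∈ Submodule.map ψ (LinearMap.range Γ.mulVecLin) :=
        ⟨_, ⟨_, rfl⟩, rfl⟩
      rwa [hker, Submodule.mem_bot] at this
    rw [hψv, Matrix.dotProduct_mulVec] at h0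
    simpa using h0
  apply hψ
  rw [hψv, hπ.eq_smul hvΓ, smul_dotProduct, hb, smul_zero]

section Exp
attribute [local instance] Matrix.linftyOpNormedRing Matrix.linftyOpNormedAlgebra

theorem hasDerivAt_exp_smul (Γ : Matrix (Fin m) (Fin m) ℝ) (t : ℝ) :
    HasDerivAt (fun t : ℝ => NormedSpace.exp (t • Γ)) (NormedSpace.exp (t • Γ) * Γ) t :=
  hasDerivAt_exp_smul_const Γ t

/-- The derivative of `exp (tΓ) v` is `exp (tΓ) Γ v = 0`. -/
theorem exp_smul_mulVec_of_mulVec_eq_zero {v : Fin m → ℝ} (hv : Γ *ᵥ v = 0) (t : ℝ) :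
    NormedSpace.exp (t • Γ) *ᵥ v = v := by
  let L : Matrix (Fin m) (Fin m) ℝ →L[ℝ] (Fin m → ℝ) :=
    LinearMap.toContinuousLinearMap ((Matrix.mulVecBilin ℝ ℝ).flip v)
  have h : ∀ s, HasDerivAt (fun t : ℝ => L (NormedSpace.exp (t • Γ))) 0 s := by
    intro s
    refine (L.hasFDerivAt.comp_hasDerivAt s (hasDerivAt_exp_smul Γ s)).congr_deriv ?_
    change (_ * Γ) *ᵥ v = 0
    rw [← Matrix.mulVec_mulVec, hv, Matrix.mulVec_zero]
  have := is_const_of_deriv_eq_zero (fun s => (h s).differentiableAt) (fun s => (h s).deriv) t 0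
  change NormedSpace.exp (t • Γ) *ᵥ v = NormedSpace.exp ((0 : ℝ) • Γ) *ᵥ v at this
  rw [this, zero_smul, NormedSpace.exp_zero, Matrix.one_mulVec]

theorem vecMul_exp_smul_of_vecMul_eq_zero {v : Fin m → ℝ} (hv : v ᵥ* Γ = 0) (t : ℝ) :
    v ᵥ* NormedSpace.exp (t • Γ) = v := by
  have h := exp_smul_mulVec_of_mulVec_eq_zero (Γ := Γᵀ) (v := v) (by rwa [Matrix.mulVec_transpose]) t
  rwa [← Matrix.transpose_smul, Matrix.exp_transpose, Matrix.mulVec_transpose] at h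

theorem tendsto_exp_smul_sub_one_div (Γ : Matrix (Fin m) (Fin m) ℝ) :
    Tendsto (fun t : ℝ => t⁻¹ • (NormedSpace.exp (t • Γ) - 1)) (𝓝[>] 0) (𝓝 Γ) := by
  have h := hasDerivAt_iff_tendsto_slope_zero.1 (hasDerivAt_exp_smul_const Γ (0 : ℝ))
  simp only [zero_add, zero_smul, NormedSpace.exp_zero, one_mul] at h
  exact h.mono_left (nhdsWithin_mono _ fun x hx => ne_of_gt hx)

theorem tendsto_exp_smul (Γ : Matrix (Fin m) (Fin m) ℝ) :
    Tendsto (fun t : ℝ => NormedSpace.exp (t • Γ)) (𝓝[>] 0) (𝓝 1) := by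
  have h := (hasDerivAt_exp_smul Γ 0).continuousAt.tendsto
  simp only [zero_smul, NormedSpace.exp_zero] at h
  exact h.mono_left nhdsWithin_le_nhds

end Exp

theorem exp_smul_row_sum (hΓ : IsGenerator Γ) (t : ℝ) (i : Fin m) :
    ∑ j, NormedSpace.exp (t • Γ) i j = 1 := by
  have h := congrFun (exp_smul_mulVec_of_mulVec_eq_zero (Γ := Γ) (v := fun _ => 1) (by
    ext i; simpa [Matrix.mulVec, dotProduct] using hΓ.2 i) t) i
  simpa [Matrix.mulVec, dotProduct] using h

/-- For small `Δ`, the skeleton chain has no invariant distribution other than `π`. -/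
theorem eventually_skeleton_unique (hΓ : IsGenerator Γ) (hπ : IsIrreducibleWith Γ π) :
    ∀ᶠ Δ : ℝ in 𝓝[>] 0, ∀ v : Fin m → ℝ, v ᵥ* NormedSpace.exp (Δ • Γ) = v → ∑ i, v i = 1 →
      v = π := by
  -- The rank-one matrix with all rows `π` makes `Γ` invertible: it acts on the direction of nonzero
  -- sum, which the left kernel of `Γ` occupies. Invertibility passes to `Δ⁻¹ (exp (ΔΓ) - 1) + N`
  -- for small `Δ`.
  set N : Matrix (Fin m) (Fin m) ℝ := Matrix.of fun _ j => π j with hN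
  have hvN : ∀ v : Fin m → ℝ, v ᵥ* N = (∑ i, v i) • π := by
    intro v; ext j; simp [Matrix.vecMul, dotProduct, hN, Finset.sum_mul]
  have hdet : (Γ + N).det ≠ 0 := by
    intro h0
    obtain ⟨v, hv, hv0⟩ := Matrix.exists_vecMul_eq_zero_iff.2 h0
    rw [Matrix.vecMul_add, hvN] at hv0
    have hs : ∑ i, v i = 0 := by
      have h1 := congrArg (fun w => w ⬝ᵥ (fun _ => (1 : ℝ))) hv0
      have h2 : Γ *ᵥ (fun _ => (1 : ℝ)) = 0 := by
        ext i; simpa [Matrix.mulVec, dotProduct] using hΓ.2 i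
      have h3 : π ⬝ᵥ (fun _ => (1 : ℝ)) = 1 := by simpa [dotProduct] using hπ.1.2
      simpa [add_dotProduct, ← Matrix.dotProduct_mulVec, h2, h3] using h1
    rw [hs, zero_smul, add_zero] at hv0
    apply hv
    rw [hπ.eq_smul hv0, hs, zero_smul]
  have hlim : Tendsto (fun t : ℝ => (t⁻¹ • (NormedSpace.exp (t • Γ) - 1) + N).det) (𝓝[>] 0)
      (𝓝 (Γ + N).det) :=
    (Continuous.matrix_det continuous_id).continuousAt.tendsto.comp
      ((tendsto_exp_smul_sub_one_div Γ).add_const N)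
  filter_upwards [hlim.eventually_ne hdet] with Δ hΔ v hv hv1
  by_contra hne
  -- The difference of two invariant distributions has sum zero, so `N` kills it as well.
  refine hΔ (Matrix.exists_vecMul_eq_zero_iff.1 ⟨v - π, sub_ne_zero.2 hne, ?_⟩)
  rw [Matrix.vecMul_add, hvN, Matrix.vecMul_smul, Matrix.vecMul_sub, Matrix.vecMul_one,
    Matrix.sub_vecMul, hv, vecMul_exp_smul_of_vecMul_eq_zero hπ.1.1]
  simp [hv1, hπ.1.2]

/-- Weights for the modes that turn the averaged negativity `∑ π i * β i < 0` into a one-step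
contraction for every mode. -/
theorem exists_weights (hΓ : IsGenerator Γ) (hπ : IsIrreducibleWith Γ π) {β : Fin m → ℝ} (hβ : ∑ i, π i * β i < 0)
    {q₀ : ℝ} (hq₀ : 0 < q₀) : ∃ q : ℝ, 0 < q ∧ q ≤ q₀ ∧ ∃ c : Fin m → ℝ, (∀ i, 0 < c i) ∧
      ∀ ε : ℝ → ℝ, Tendsto ε (𝓝[>] 0) (𝓝 0) → ∀ᶠ Δ : ℝ in 𝓝[>] 0, ∀ i,
        (∑ j, NormedSpace.exp (Δ • Γ) i j * c j) * (1 + q * Δ * β i + Δ * ε Δ) < c i := by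
  set b := ∑ i, π i * β i with hb
  -- `b - β` is orthogonal to `π` because `∑ π i = 1`.
  obtain ⟨u, hu⟩ := hπ.exists_mulVec_eq (b := fun i => b - β i) (by
    simp [dotProduct, mul_sub, Finset.sum_sub_distrib, ← Finset.sum_mul, hπ.1.2, ← hb])
  -- For small `q` the weights `1 + qu` are positive and the error `q u β` of the Poisson correction
  -- does not spoil `b < 0`.
  have h1 : ∀ᶠ q : ℝ in 𝓝[>] 0, ∀ i, 0 < 1 + q * u i ∧ b + q * (u i * β i) < 0 := by
    refine eventually_all.2 fun i => ?_
    refine Eventually.filter_mono nhdsWithin_le_nhds (Eventually.and ?_ ?_)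
    · have : Tendsto (fun q : ℝ => 1 + q * u i) (𝓝 0) (𝓝 (1 + 0 * u i)) :=
        Continuous.tendsto (by fun_prop) 0
      exact this.eventually_const_lt (by simp)
    · have : Tendsto (fun q : ℝ => b + q * (u i * β i)) (𝓝 0) (𝓝 (b + 0 * (u i * β i))) :=
        Continuous.tendsto (by fun_prop) 0
      exact this.eventually_lt_const (by simpa using hβ)
  obtain ⟨q, hq, hq0, hq1⟩ := (h1.and (Ioc_mem_nhdsGT hq₀)).exists
  refine ⟨q, hq0, hq1, fun i => 1 + q * u i, fun i => (hq i).1, fun ε hε => ?_⟩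
  set c : Fin m → ℝ := fun i => 1 + q * u i with hc
  refine eventually_all.2 fun i => ?_
  have t1 : Tendsto (fun Δ : ℝ => ((Δ⁻¹ • (NormedSpace.exp (Δ • Γ) - 1)) *ᵥ c) i) (𝓝[>] 0)
      (𝓝 ((Γ *ᵥ c) i)) :=
    (Continuous.tendsto (f := fun M : Matrix (Fin m) (Fin m) ℝ => (M *ᵥ c) i) (by fun_prop) Γ).comp
      (tendsto_exp_smul_sub_one_div Γ)
  have t2 : Tendsto (fun Δ : ℝ => (NormedSpace.exp (Δ • Γ) *ᵥ c) i) (𝓝[>] 0)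
      (𝓝 (((1 : Matrix (Fin m) (Fin m) ℝ) *ᵥ c) i)) :=
    (Continuous.tendsto (f := fun M : Matrix (Fin m) (Fin m) ℝ => (M *ᵥ c) i) (by fun_prop) 1).comp
      (tendsto_exp_smul Γ)
  -- The limit of (factor times averaged weight minus weight), divided by `Δ`: it is `Γc + qβc`, and
  -- its sign decides the inequality for small `Δ`.
  have t3 := t1.add (t2.mul (hε.const_add (q * β i)))
  have hΓ1 : Γ *ᵥ c = fun i => q * (b - β i) := by
    have h1 : c = q • u + fun _ => 1 := by ext; simp [hc, add_comm]
    have h2 : Γ *ᵥ (fun _ => (1 : ℝ)) = 0 := by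
      ext i; simpa [Matrix.mulVec, dotProduct] using hΓ.2 i
    rw [h1, Matrix.mulVec_add, Matrix.mulVec_smul, hu, h2, add_zero]; rfl
  have hneg : (Γ *ᵥ c) i + ((1 : Matrix (Fin m) (Fin m) ℝ) *ᵥ c) i * (q * β i + 0) < 0 := by
    rw [hΓ1, Matrix.one_mulVec]
    have : q * (b + q * (u i * β i)) < 0 := mul_neg_of_pos_of_neg hq0 (hq i).2
    simp only [hc]
    linarith
  filter_upwards [t3.eventually_lt_const hneg, self_mem_nhdsWithin] with Δ hΔ hΔ0
  have hΔ0 : 0 < Δ := hΔ0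
  rw [Matrix.smul_mulVec, Matrix.sub_mulVec, Matrix.one_mulVec] at hΔ
  set S := NormedSpace.exp (Δ • Γ) *ᵥ c with hS
  have hS' : ∑ j, NormedSpace.exp (Δ • Γ) i j * c j = S i := rfl
  rw [hS']
  simp only [Pi.smul_apply, Pi.sub_apply, smul_eq_mul] at hΔ
  have := mul_neg_of_pos_of_neg hΔ0 hΔ
  rw [mul_add, mul_inv_cancel_left₀ hΔ0.ne'] at this
  change S i * (1 + q * Δ * β i + Δ * ε Δ) < c i
  linarith

end Generator

/-! ### Abstract switching chains: transition operator and evolution of laws -/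

section StepOp
variable {m : ℕ} {Y W : Type*} [MeasurableSpace W]
  {p : Fin m → Fin m → ℝ≥0∞} {γ : Measure W} {S : Y → Fin m → Fin m → W → Y}

/-- The transition operator of the chain whose mode moves from `i` to `j`
with probability `p i j` and whose position is then `S y i j w`, where `w` has the law `γ`. -/
def stepOp (p : Fin m → Fin m → ℝ≥0∞) (γ : Measure W) (S : Y → Fin m → Fin m → W → Y)
    (F : Y × Fin m → ℝ≥0∞) (z : Y × Fin m) : ℝ≥0∞ :=
  ∑ j, p z.2 j * ∫⁻ w, F (S z.1 z.2 j w, j) ∂γ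

theorem stepOp_mono {F F' : Y × Fin m → ℝ≥0∞} (h : ∀ x, F x ≤ F' x) (z : Y × Fin m) :
    stepOp p γ S F z ≤ stepOp p γ S F' z := by
  unfold stepOp
  gcongr
  exact h _

theorem stepOp_const_mul {F : Y × Fin m → ℝ≥0∞} {a : ℝ≥0∞} (ha : a ≠ ⊤) (z : Y × Fin m) :
    stepOp p γ S (fun x => a * F x) z = a * stepOp p γ S F z := by
  simp_rw [stepOp, lintegral_const_mul' _ _ ha, Finset.mul_sum]
  exact Finset.sum_congr rfl fun j _ => by ring

theorem stepOp_one [IsProbabilityMeasure γ] (hp : ∀ i, ∑ j, p i j = 1) (z : Y × Fin m) :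
    stepOp p γ S (fun _ => 1) z = 1 := by
  simp [stepOp, hp]

end StepOp

section StepLaw
variable {m : ℕ} {Y W : Type*} [MeasurableSpace Y] [MeasurableSpace W]
  {p : Fin m → Fin m → ℝ≥0∞} {γ : Measure W} {S : Y → Fin m → Fin m → W → Y}

/-- The one-step law, from the state `z = (y, i)`, of the chain whose mode moves from `i` to `j`
with probability `p i j` and whose position is then `S y i j w`, where `w` has the law `γ`. -/
def stepLaw (p : Fin m → Fin m → ℝ≥0∞) (γ : Measure W) (S : Y → Fin m → Fin m → W → Y)
    (z : Y × Fin m) : Measure (Y × Fin m) :=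
  ∑ j, p z.2 j • γ.map (fun w => (S z.1 z.2 j w, j))

theorem measurable_section (hS : ∀ i j, Measurable fun q : Y × W => S q.1 i j q.2) (z : Y × Fin m)
    (j : Fin m) : Measurable fun w => (S z.1 z.2 j w, j) :=
  ((hS z.2 j).comp measurable_prodMk_left).prodMk measurable_const

theorem lintegral_stepLaw (hS : ∀ i j, Measurable fun q : Y × W => S q.1 i j q.2)
    {F : Y × Fin m → ℝ≥0∞} (hF : Measurable F) (z : Y × Fin m) :
    ∫⁻ x, F x ∂stepLaw p γ S z = stepOp p γ S F z := by
  rw [stepLaw, lintegral_finsetSum_measure, stepOp]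
  refine Finset.sum_congr rfl fun j _ => ?_
  rw [lintegral_smul_measure, lintegral_map hF (measurable_section hS z j), smul_eq_mul]

theorem measurable_stepOp [SFinite γ] (hS : ∀ i j, Measurable fun q : Y × W => S q.1 i j q.2)
    {F : Y × Fin m → ℝ≥0∞} (hF : Measurable F) : Measurable (stepOp p γ S F) := by
  refine measurable_from_prod_countable_left fun i => ?_
  refine Finset.measurable_sum _ fun j _ => ?_
  refine Measurable.const_mul (f := fun y => ∫⁻ w, F (S y i j w, j) ∂γ) ?_ (p i j)
  exact Measurable.lintegral_prod_right' (f := fun q : Y × W => F (S q.1 i j q.2, j))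
    (hF.comp ((hS i j).prodMk measurable_const))

theorem measurable_stepLaw [SFinite γ] (hS : ∀ i j, Measurable fun q : Y × W => S q.1 i j q.2) :
    Measurable (stepLaw p γ S) := by
  refine Measure.measurable_of_measurable_coe _ fun A hA => ?_
  have h := measurable_stepOp (p := p) (γ := γ) hS (measurable_one.indicator hA)
  convert h using 1
  ext z
  rw [← lintegral_stepLaw hS (measurable_one.indicator hA), lintegral_indicator_one hA]

theorem lintegral_bind_stepLaw [SFinite γ] (hS : ∀ i j, Measurable fun q : Y × W => S q.1 i j q.2)
    {F : Y × Fin m → ℝ≥0∞} (hF : Measurable F) (μ : Measure (Y × Fin m)) :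
    ∫⁻ x, F x ∂μ.bind (stepLaw p γ S) = ∫⁻ z, stepOp p γ S F z ∂μ := by
  rw [Measure.lintegral_bind (measurable_stepLaw hS).aemeasurable hF.aemeasurable]
  simp_rw [lintegral_stepLaw hS hF]

theorem isProbabilityMeasure_bind_stepLaw [IsProbabilityMeasure γ] (hp : ∀ i, ∑ j, p i j = 1)
    (hS : ∀ i j, Measurable fun q : Y × W => S q.1 i j q.2) (μ : Measure (Y × Fin m))
    [IsProbabilityMeasure μ] : IsProbabilityMeasure (μ.bind (stepLaw p γ S)) := by
  refine ⟨?_⟩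
  have := lintegral_bind_stepLaw (p := p) (γ := γ) hS (F := fun _ => 1) measurable_const μ
  simpa [stepOp_one hp] using this

/-- The law after `k` steps. -/
def iterLaw (p : Fin m → Fin m → ℝ≥0∞) (γ : Measure W) (S : Y → Fin m → Fin m → W → Y)
    (μ : Measure (Y × Fin m)) (k : ℕ) : Measure (Y × Fin m) :=
  (fun ν => ν.bind (stepLaw p γ S))^[k] μ

theorem iterLaw_succ (μ : Measure (Y × Fin m)) (k : ℕ) :
    iterLaw p γ S μ (k + 1) = (iterLaw p γ S μ k).bind (stepLaw p γ S) :=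
  Function.iterate_succ_apply' _ _ _

theorem iterLaw_of_invariant {μ : Measure (Y × Fin m)} (hμ : μ.bind (stepLaw p γ S) = μ) (k : ℕ) :
    iterLaw p γ S μ k = μ :=
  Function.iterate_fixed hμ k

theorem isProbabilityMeasure_iterLaw [IsProbabilityMeasure γ] (hp : ∀ i, ∑ j, p i j = 1)
    (hS : ∀ i j, Measurable fun q : Y × W => S q.1 i j q.2) (μ : Measure (Y × Fin m))
    [IsProbabilityMeasure μ] (k : ℕ) : IsProbabilityMeasure (iterLaw p γ S μ k) := by
  induction k with
  | zero => assumption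
  | succ k ih => rw [iterLaw_succ]; exact isProbabilityMeasure_bind_stepLaw hp hS _

theorem measurable_iterate_stepOp [SFinite γ] (hS : ∀ i j, Measurable fun q : Y × W => S q.1 i j q.2)
    {F : Y × Fin m → ℝ≥0∞} (hF : Measurable F) (k : ℕ) : Measurable ((stepOp p γ S)^[k] F) := by
  induction k with
  | zero => exact hF
  | succ k ih => rw [Function.iterate_succ_apply']; exact measurable_stepOp hS ih

theorem lintegral_iterLaw [SFinite γ] (hS : ∀ i j, Measurable fun q : Y × W => S q.1 i j q.2)
    {F : Y × Fin m → ℝ≥0∞} (hF : Measurable F) (μ : Measure (Y × Fin m)) (k : ℕ) :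
    ∫⁻ x, F x ∂iterLaw p γ S μ k = ∫⁻ z, (stepOp p γ S)^[k] F z ∂μ := by
  induction k generalizing F with
  | zero => rfl
  | succ k ih =>
    rw [iterLaw_succ, lintegral_bind_stepLaw hS hF, ih (measurable_stepOp hS hF),
      Function.iterate_succ_apply]

/-- A map of the positions that commutes with the steps commutes with the evolution of laws. -/
theorem map_bind_stepLaw [SFinite γ] {Y' : Type*} [MeasurableSpace Y']
    {S' : Y' → Fin m → Fin m → W → Y'}
    (hS : ∀ i j, Measurable fun q : Y × W => S q.1 i j q.2)
    (hS' : ∀ i j, Measurable fun q : Y' × W => S' q.1 i j q.2) {e : Y → Y'} (he : Measurable e)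
    (h : ∀ y i j w, e (S y i j w) = S' (e y) i j w) (μ : Measure (Y × Fin m)) :
    (μ.bind (stepLaw p γ S)).map (Prod.map e id) =
      (μ.map (Prod.map e id)).bind (stepLaw p γ S') := by
  have hm : Measurable (Prod.map e (id : Fin m → Fin m)) := he.prodMap measurable_id
  refine Measure.ext_of_lintegral _ fun F hF => ?_
  rw [lintegral_map hF hm, lintegral_bind_stepLaw hS (F := fun a => F (Prod.map e id a)) (hF.comp hm),
    lintegral_bind_stepLaw hS' hF,
    lintegral_map (measurable_stepOp hS' hF) hm]
  simp [stepOp, h]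

theorem map_iterLaw [SFinite γ] {Y' : Type*} [MeasurableSpace Y']
    {S' : Y' → Fin m → Fin m → W → Y'}
    (hS : ∀ i j, Measurable fun q : Y × W => S q.1 i j q.2)
    (hS' : ∀ i j, Measurable fun q : Y' × W => S' q.1 i j q.2) {e : Y → Y'} (he : Measurable e)
    (h : ∀ y i j w, e (S y i j w) = S' (e y) i j w) (μ : Measure (Y × Fin m)) (k : ℕ) :
    (iterLaw p γ S μ k).map (Prod.map e id) = iterLaw p γ S' (μ.map (Prod.map e id)) k := by
  induction k with
  | zero => rfl
  | succ k ih => rw [iterLaw_succ, iterLaw_succ, map_bind_stepLaw hS hS' he h, ih]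

/-- The position does not influence the mode, so the mode marginal evolves by `p` alone. -/
theorem map_snd_bind_stepLaw [IsProbabilityMeasure γ]
    (hS : ∀ i j, Measurable fun q : Y × W => S q.1 i j q.2) (μ : Measure (Y × Fin m)) (j : Fin m) :
    ((μ.bind (stepLaw p γ S)).map Prod.snd) {j} = ∑ i, (μ.map Prod.snd) {i} * p i j := by
  have hj : MeasurableSet ({j} : Set (Fin m)) := MeasurableSet.singleton j
  have hF : Measurable (fun z : Y × Fin m => ({j} : Set (Fin m)).indicator (fun _ => (1 : ℝ≥0∞)) z.2) :=
    (measurable_const.indicator hj).comp measurable_snd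
  rw [← lintegral_indicator_one hj, lintegral_map (measurable_one.indicator hj) measurable_snd]
  have := lintegral_bind_stepLaw (p := p) (γ := γ) hS hF μ
  refine this.trans ?_
  have e : ∀ z : Y × Fin m, stepOp p γ S
      (fun z => ({j} : Set (Fin m)).indicator (fun _ => (1 : ℝ≥0∞)) z.2) z = p z.2 j := by
    intro z
    simp [stepOp, Set.indicator_apply]
  simp_rw [e]
  rw [← lintegral_map (f := fun i => p i j) (measurable_of_countable _) measurable_snd,
    lintegral_fintype]
  exact Finset.sum_congr rfl fun i _ => mul_comm _ _

end StepLaw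

/-! ### Couplings with equal modes, and test functions that determine a law -/

section Glue
variable {m : ℕ} {E : Type*} [MeasurableSpace E] [StandardBorelSpace E] [Nonempty E]

/-- Two laws with the same distribution of the mode have a coupling with equal modes. -/
theorem exists_coupling (μ ν : Measure (E × Fin m)) [IsProbabilityMeasure μ]
    [IsProbabilityMeasure ν] (h : μ.map Prod.snd = ν.map Prod.snd) :
    ∃ η : Measure ((E × E) × Fin m), IsProbabilityMeasure η ∧
      η.map (Prod.map Prod.fst id) = μ ∧ η.map (Prod.map Prod.snd id) = ν := by
  set μ' := μ.map Prod.swap with hμ'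
  set ν' := ν.map Prod.swap with hν'
  have : IsProbabilityMeasure μ' := Measure.isProbabilityMeasure_map measurable_swap.aemeasurable
  have : IsProbabilityMeasure ν' := Measure.isProbabilityMeasure_map measurable_swap.aemeasurable
  have hf : μ'.fst = ν'.fst := by
    rw [Measure.fst, Measure.fst, hμ', hν', Measure.map_map measurable_fst measurable_swap,
      Measure.map_map measurable_fst measurable_swap]
    exact h
  have e1 := μ'.disintegrate μ'.condKernel
  have e2 := ν'.disintegrate ν'.condKernel
  rw [← hf] at e2
  -- The mode is drawn from the common marginal; given the mode, both positions are drawn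
  -- independently from their conditional laws.
  set η' := μ'.fst ⊗ₘ (μ'.condKernel ×ₖ ν'.condKernel) with hη'
  have m1 : η'.map (Prod.map id Prod.fst) = μ' := by
    rw [hη', ← Measure.compProd_map measurable_fst, ← Kernel.fst_eq, Kernel.fst_prod, e1]
  have m2 : η'.map (Prod.map id Prod.snd) = ν' := by
    rw [hη', ← Measure.compProd_map measurable_snd, ← Kernel.snd_eq, Kernel.snd_prod, e2]
  refine ⟨η'.map Prod.swap, Measure.isProbabilityMeasure_map measurable_swap.aemeasurable, ?_, ?_⟩
  · rw [Measure.map_map (by fun_prop) measurable_swap]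
    have : Prod.map Prod.fst id ∘ Prod.swap = Prod.swap ∘ (Prod.map id Prod.fst :
      Fin m × (E × E) → Fin m × E) := rfl
    rw [this, ← Measure.map_map measurable_swap (by fun_prop), m1, hμ',
      Measure.map_map measurable_swap measurable_swap]
    simp
  · rw [Measure.map_map (by fun_prop) measurable_swap]
    have : Prod.map Prod.snd id ∘ Prod.swap = Prod.swap ∘ (Prod.map id Prod.snd :
      Fin m × (E × E) → Fin m × E) := rfl
    rw [this, ← Measure.map_map measurable_swap (by fun_prop), m2, hν',
      Measure.map_map measurable_swap measurable_swap]
    simp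

end Glue

section ModeTest
variable {m : ℕ} {E : Type*}

/-- The test function `(x, i) ↦ 1_{i = j} φ(x)`. -/
def modeTest (j : Fin m) (φ : E → ℝ≥0) (z : E × Fin m) : ℝ≥0 := if z.2 = j then φ z.1 else 0

theorem continuous_modeTest [TopologicalSpace E] (j : Fin m) {φ : E → ℝ≥0} (hφ : Continuous φ) :
    Continuous (modeTest j φ) := by
  refine continuous_prod_of_discrete_right.2 fun i => ?_
  unfold modeTest
  by_cases h : i = j <;> simp [h, hφ, continuous_const]

end ModeTest

/-- Measures on `E × Fin m` are determined by their values on the sets `A × {j}`. -/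
theorem ext_of_prod_singleton {m : ℕ} {E : Type*} [MeasurableSpace E] {μ ν : Measure (E × Fin m)}
    (h : ∀ (A : Set E) (j : Fin m), MeasurableSet A → μ (A ×ˢ {j}) = ν (A ×ˢ {j})) : μ = ν := by
  ext A hA
  have hU : A = ⋃ j : Fin m, ((fun x => (x, j)) ⁻¹' A) ×ˢ {j} := by ext ⟨x, i⟩; simp
  have hm : ∀ j : Fin m, MeasurableSet ((fun x => (x, j)) ⁻¹' A : Set E) := fun j =>
    measurable_prodMk_right hA
  have hd : Pairwise (Function.onFun Disjoint
      fun j : Fin m => ((fun x => (x, j)) ⁻¹' A : Set E) ×ˢ ({j} : Set (Fin m))) := fun i j hij =>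
    Disjoint.set_prod_right (by simpa using hij) _ _
  rw [hU, measure_iUnion hd fun j => (hm j).prod (measurableSet_singleton j),
    measure_iUnion hd fun j => (hm j).prod (measurableSet_singleton j)]
  simp_rw [h _ _ (hm _)]

section Determining
variable {m : ℕ} {E : Type*} [PseudoEMetricSpace E] [MeasurableSpace E] [BorelSpace E]

/-- Finite measures on `E × Fin m` are determined by the integrals of Lipschitz functions with
values in `[0, 1]` on the modes. -/
theorem ext_of_lintegral_modeTest {μ ν : Measure (E × Fin m)} [IsFiniteMeasure μ]
    [IsFiniteMeasure ν]
    (h : ∀ (j : Fin m) (φ : E → ℝ≥0) (L : ℝ≥0), LipschitzWith L φ → (∀ x, φ x ≤ 1) →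
      ∫⁻ z, modeTest j φ z ∂μ = ∫⁻ z, modeTest j φ z ∂ν) : μ = ν := by
  have slice : ∀ (ρ : Measure (E × Fin m)) (j : Fin m) (φ : E → ℝ≥0), Continuous φ →
      ∫⁻ z, modeTest j φ z ∂ρ =
        ∫⁻ x, φ x ∂((ρ.restrict (univ ×ˢ {j})).map Prod.fst) := by
    intro ρ j φ hφ
    have hm : MeasurableSet ((univ : Set E) ×ˢ ({j} : Set (Fin m))) :=
      MeasurableSet.univ.prod (MeasurableSet.singleton j)
    rw [lintegral_map (by fun_prop) measurable_fst, ← lintegral_indicator hm]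
    refine lintegral_congr fun z => ?_
    by_cases hz : z.2 = j <;> simp [modeTest, hz]
  have key : ∀ j, (μ.restrict (univ ×ˢ {j})).map Prod.fst = (ν.restrict (univ ×ˢ {j})).map Prod.fst := by
    intro j
    set μ' := (μ.restrict (univ ×ˢ {j})).map Prod.fst
    set ν' := (ν.restrict (univ ×ˢ {j})).map Prod.fst
    -- Thickened indicators are Lipschitz and converge to the indicator of the closed set; closed
    -- sets are a generating π-system.
    have hclosed : ∀ A : Set E, IsClosed A → μ' A = ν' A := by
      intro A hA
      have hpos : ∀ k : ℕ, (0 : ℝ) < 1 / (k + 1) := fun k => by positivity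
      have l1 := tendsto_lintegral_thickenedIndicator_of_isClosed μ' hA hpos
        tendsto_one_div_add_atTop_nhds_zero_nat
      have l2 := tendsto_lintegral_thickenedIndicator_of_isClosed ν' hA hpos
        tendsto_one_div_add_atTop_nhds_zero_nat
      refine tendsto_nhds_unique l1 (l2.congr fun k => ?_)
      rw [← slice _ _ _ (thickenedIndicator (hpos k) A).continuous,
        ← slice _ _ _ (thickenedIndicator (hpos k) A).continuous]
      exact (h j _ _ (lipschitzWith_thickenedIndicator (hpos k) A)
        (thickenedIndicator_le_one (hpos k) A)).symm
    exact ext_of_generate_finite _ (BorelSpace.measurable_eq.trans borel_eq_generateFrom_isClosed)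
      isPiSystem_isClosed hclosed (hclosed _ isClosed_univ)
  refine ext_of_prod_singleton fun A j hA => ?_
  have h1 : ∀ ρ : Measure (E × Fin m),
      ((ρ.restrict (univ ×ˢ {j})).map Prod.fst) A = ρ (A ×ˢ {j}) := fun ρ => by
    rw [Measure.map_apply measurable_fst hA, Measure.restrict_apply (measurable_fst hA),
      ← prod_univ, prod_inter_prod, univ_inter, inter_univ]
  rw [← h1, ← h1, key]

end Determining

/-! ### The synchronous coupling and its contraction -/

section Pair
variable {m : ℕ} {E W : Type*} [MeasurableSpace W] {S : E → Fin m → Fin m → W → E}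

/-- Two copies of the chain with the same modes and the same noise. -/
def pairStep (S : E → Fin m → Fin m → W → E) (x : E × E) (i j : Fin m) (w : W) : E × E :=
  (S x.1 i j w, S x.2 i j w)

theorem measurable_pairStep [MeasurableSpace E]
    (hS : ∀ i j, Measurable fun q : E × W => S q.1 i j q.2) (i j : Fin m) :
    Measurable fun q : (E × E) × W => pairStep S q.1 i j q.2 :=
  ((hS i j).comp (by fun_prop : Measurable fun q : (E × E) × W => (q.1.1, q.2))).prodMk
    ((hS i j).comp (by fun_prop : Measurable fun q : (E × E) × W => (q.1.2, q.2)))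

end Pair

section Contraction
variable {m : ℕ} {E W : Type*} [NormedAddCommGroup E] [MeasurableSpace W]
  {p : Fin m → Fin m → ℝ≥0∞} {γ : Measure W} {S : E → Fin m → Fin m → W → E}
  {c : Fin m → ℝ≥0} {κ : ℝ≥0} {a : ℝ}

/-- The steps of the chain contract weighted distances of order `a`, for equal modes and the same
noise. -/
def IsContracting (p : Fin m → Fin m → ℝ≥0∞) (γ : Measure W) (S : E → Fin m → Fin m → W → E)
    (c : Fin m → ℝ≥0) (κ : ℝ≥0) (a : ℝ) : Prop :=
  ∀ (x y : E) (i : Fin m), ∑ j, p i j * ∫⁻ w, c j * ‖S x i j w - S y i j w‖ₑ ^ a ∂γ ≤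
    κ * (c i * ‖x - y‖ₑ ^ a)

/-- The weighted distance of order `a`. -/
def pairDist (c : Fin m → ℝ≥0) (a : ℝ) (z : (E × E) × Fin m) : ℝ≥0∞ :=
  c z.2 * ‖z.1.1 - z.1.2‖ₑ ^ a

/-- The distance of order `a`, cut off at `1`. -/
def cutDist (a : ℝ) (z : (E × E) × Fin m) : ℝ≥0∞ := min 1 (‖z.1.1 - z.1.2‖ₑ ^ a)

theorem IsContracting.stepOp_iterate_le (h : IsContracting p γ S c κ a) (k : ℕ)
    (z : (E × E) × Fin m) :
    (stepOp p γ (pairStep S))^[k] (pairDist c a) z ≤ κ ^ k * pairDist c a z := by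
  induction k generalizing z with
  | zero => simp
  | succ k ih =>
    rw [Function.iterate_succ_apply']
    refine (stepOp_mono ih z).trans ?_
    rw [stepOp_const_mul (by finiteness), pow_succ, mul_assoc]
    gcongr
    exact h z.1.1 z.1.2 z.2

theorem stepOp_iterate_mono {Y : Type*} {S : Y → Fin m → Fin m → W → Y}
    {F F' : Y × Fin m → ℝ≥0∞} (h : ∀ x, F x ≤ F' x) (k : ℕ) (z : Y × Fin m) :
    (stepOp p γ S)^[k] F z ≤ (stepOp p γ S)^[k] F' z := by
  induction k generalizing z with
  | zero => exact h z
  | succ k ih => simp only [Function.iterate_succ_apply']; exact stepOp_mono ih z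

theorem stepOp_iterate_one [IsProbabilityMeasure γ] {Y : Type*} {S : Y → Fin m → Fin m → W → Y}
    (hp : ∀ i, ∑ j, p i j = 1) (k : ℕ) :
    (stepOp p γ S)^[k] (fun _ => 1) = fun _ => 1 := by
  refine Function.iterate_fixed ?_ k
  ext z; exact stepOp_one hp z

theorem stepOp_iterate_const_mul {Y : Type*} {S : Y → Fin m → Fin m → W → Y}
    {F : Y × Fin m → ℝ≥0∞} {b : ℝ≥0∞} (hb : b ≠ ⊤) (k : ℕ) (z : Y × Fin m) :
    (stepOp p γ S)^[k] (fun x => b * F x) z = b * (stepOp p γ S)^[k] F z := by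
  induction k generalizing z with
  | zero => rfl
  | succ k ih =>
    simp only [Function.iterate_succ_apply']
    rw [show (stepOp p γ S)^[k] (fun x => b * F x) = fun x => b * (stepOp p γ S)^[k] F x from
      funext ih, stepOp_const_mul hb]

theorem IsContracting.tendsto_stepOp_cutDist [IsProbabilityMeasure γ]
    (h : IsContracting p γ S c κ a) (ha : 0 ≤ a) (hc : ∀ i, c i ≠ 0) (hκ : κ < 1)
    (z : (E × E) × Fin m) :
    Tendsto (fun k => (stepOp p γ (pairStep S))^[k] (cutDist a) z) atTop (𝓝 0) := by
  -- A crude common bound for all `(c i)⁻¹`, by which the unweighted distance is controlled by the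
  -- weighted one.
  set b : ℝ≥0 := ∑ i, (c i)⁻¹ with hb
  have hle : ∀ z : (E × E) × Fin m, cutDist a z ≤ b * pairDist c a z := by
    intro z
    refine (min_le_right _ _).trans ?_
    rw [pairDist, ← mul_assoc]
    refine le_mul_of_one_le_left' ?_
    have h1 : (c z.2)⁻¹ ≤ b := Finset.single_le_sum (f := fun i => (c i)⁻¹)
      (fun _ _ => zero_le) (Finset.mem_univ z.2)
    have h2 : 1 ≤ b * c z.2 := by
      calc (1 : ℝ≥0) = (c z.2)⁻¹ * c z.2 := (inv_mul_cancel₀ (hc _)).symm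
        _ ≤ _ := by gcongr
    exact_mod_cast h2
  have hfin : pairDist c a z ≠ ⊤ := by unfold pairDist; finiteness
  have hlim : Tendsto (fun k => (b : ℝ≥0∞) * ((κ : ℝ≥0∞) ^ k * pairDist c a z)) atTop (𝓝 0) := by
    have h1 : Tendsto (fun k : ℕ => (κ : ℝ≥0∞) ^ k) atTop (𝓝 0) :=
      ENNReal.tendsto_pow_atTop_nhds_zero_of_lt_one (by exact_mod_cast hκ)
    have h2 := ENNReal.Tendsto.const_mul (a := (b : ℝ≥0∞))
      (ENNReal.Tendsto.mul_const (b := pairDist c a z) h1 (Or.inr hfin)) (Or.inr (by finiteness))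
    simpa using h2
  refine tendsto_of_tendsto_of_tendsto_of_le_of_le tendsto_const_nhds hlim (fun _ => zero_le)
    fun k => ?_
  refine (stepOp_iterate_mono hle k z).trans ?_
  rw [stepOp_iterate_const_mul (by finiteness)]
  gcongr
  exact h.stepOp_iterate_le k z

/-- At distance at least `1` the cut-off is `1` and `φ ≤ 1` suffices. At distance at most `1` the
Lipschitz bound suffices, since `a ≤ 1` gives `|x - y| ≤ |x - y| ^ a`. -/
theorem modeTest_le_add_cutDist (ha : 0 < a) (ha1 : a ≤ 1) {φ : E → ℝ≥0} {L : ℝ≥0}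
    (hL : LipschitzWith L φ) (h1 : ∀ x, φ x ≤ 1) (j i : Fin m) (x y : E) :
    (modeTest j φ (x, i) : ℝ≥0∞) ≤ modeTest j φ (y, i) + (L + 1) * cutDist a ((x, y), i) := by
  unfold modeTest
  by_cases hij : i = j
  · simp only [hij, if_true, cutDist]
    rcases le_total 1 ‖x - y‖ₑ with h | h
    · rw [min_eq_left (ENNReal.one_le_rpow h ha), mul_one]
      calc (φ x : ℝ≥0∞) ≤ 1 := by exact_mod_cast h1 x
        _ ≤ φ y + (L + 1) := le_add_left le_add_self
    · have h2 : ‖x - y‖ₑ ≤ min 1 (‖x - y‖ₑ ^ a) := by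
        refine le_min h ?_
        calc ‖x - y‖ₑ = ‖x - y‖ₑ ^ (1 : ℝ) := (ENNReal.rpow_one _).symm
          _ ≤ _ := ENNReal.rpow_le_rpow_of_exponent_ge h ha1
      have h3 : φ x ≤ φ y + L * nndist x y :=
        (NNReal.le_add_nndist _ _).trans (by gcongr; exact hL.nndist_le x y)
      calc (φ x : ℝ≥0∞) ≤ φ y + L * nndist x y := by exact_mod_cast h3
        _ = φ y + L * ‖x - y‖ₑ := by rw [← edist_nndist, edist_eq_enorm_sub]
        _ ≤ _ := by gcongr; exact le_self_add
  · simp [hij]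

variable [MeasurableSpace E] [BorelSpace E] [SecondCountableTopology E]

theorem measurable_cutDist : Measurable (cutDist a : (E × E) × Fin m → ℝ≥0∞) := by
  unfold cutDist
  fun_prop

/-- The cut-off permits dominated convergence, so no moments of `η` are needed. This matters for
uniqueness, where an invariant law is not known in advance to have moments. -/
theorem IsContracting.tendsto_lintegral_cutDist [IsProbabilityMeasure γ]
    (h : IsContracting p γ S c κ a) (ha : 0 ≤ a) (hc : ∀ i, c i ≠ 0) (hκ : κ < 1)
    (hp : ∀ i, ∑ j, p i j = 1) (hS : ∀ i j, Measurable fun q : E × W => S q.1 i j q.2)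
    (η : Measure ((E × E) × Fin m)) [IsProbabilityMeasure η] :
    Tendsto (fun k => ∫⁻ z, cutDist a z ∂iterLaw p γ (pairStep S) η k) atTop (𝓝 0) := by
  simp_rw [lintegral_iterLaw (measurable_pairStep hS) measurable_cutDist]
  have := tendsto_lintegral_of_dominated_convergence (μ := η)
    (F := fun k => (stepOp p γ (pairStep S))^[k] (cutDist a)) (f := fun _ => 0) (fun _ => 1)
    (fun k => measurable_iterate_stepOp (measurable_pairStep hS) measurable_cutDist k)
    (fun k => ae_of_all _ fun z => ?_) (by simp)
    (ae_of_all _ fun z => h.tendsto_stepOp_cutDist ha hc hκ z)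
  · simpa using this
  · refine (stepOp_iterate_mono (F' := fun _ => 1) (fun x => min_le_left _ _) k z).trans ?_
    rw [stepOp_iterate_one hp]

end Contraction

/-! ### Existence and uniqueness of the invariant law of a contracting chain -/

section Invariant
variable {m : ℕ} {E W : Type*} [NormedAddCommGroup E] [MeasurableSpace E] [BorelSpace E]
  [ProperSpace E] [MeasurableSpace W]
  {p : Fin m → Fin m → ℝ≥0∞} {γ : Measure W} {S : E → Fin m → Fin m → W → E}
  {c : Fin m → ℝ≥0} {κ : ℝ≥0} {a : ℝ}

/-- Along the laws of two chains with the same initial distribution of the mode, the integrals of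
Lipschitz functions approach each other. -/
theorem IsContracting.exists_modeTest_bound [IsProbabilityMeasure γ]
    (h : IsContracting p γ S c κ a) (ha : 0 < a) (ha1 : a ≤ 1) (hc : ∀ i, c i ≠ 0) (hκ : κ < 1)
    (hp : ∀ i, ∑ j, p i j = 1) (hS : ∀ i j, Measurable fun q : E × W => S q.1 i j q.2)
    (μ ν : Measure (E × Fin m)) [IsProbabilityMeasure μ] [IsProbabilityMeasure ν]
    (hμν : μ.map Prod.snd = ν.map Prod.snd) {φ : E → ℝ≥0} {L : ℝ≥0}
    (hL : LipschitzWith L φ) (h1 : ∀ x, φ x ≤ 1) (j : Fin m) :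
    ∃ δ : ℕ → ℝ≥0∞, Tendsto δ atTop (𝓝 0) ∧ ∀ k,
      ∫⁻ z, modeTest j φ z ∂iterLaw p γ S μ k ≤ ∫⁻ z, modeTest j φ z ∂iterLaw p γ S ν k + δ k := by
  -- The coupled initial law is run with `pairStep`; its two projections are the given chains.
  obtain ⟨η, hη, rfl, rfl⟩ := exists_coupling μ ν hμν
  have hδ := h.tendsto_lintegral_cutDist ha.le hc hκ hp hS η
  refine ⟨fun k => (L + 1) * ∫⁻ z, cutDist a z ∂iterLaw p γ (pairStep S) η k, ?_, fun k => ?_⟩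
  · simpa using ENNReal.Tendsto.const_mul (a := ((L : ℝ≥0∞) + 1)) hδ (Or.inr (by finiteness))
  have hmt : Measurable fun z : E × Fin m => (modeTest j φ z : ℝ≥0∞) :=
    (continuous_modeTest j hL.continuous).measurable.coe_nnreal_ennreal
  dsimp only
  rw [← map_iterLaw (measurable_pairStep hS) hS measurable_fst (fun _ _ _ _ => rfl),
    ← map_iterLaw (measurable_pairStep hS) hS measurable_snd (fun _ _ _ _ => rfl),
    lintegral_map hmt (by fun_prop), lintegral_map hmt (by fun_prop),
    ← lintegral_const_mul _ measurable_cutDist, ← lintegral_add_left]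
  · exact lintegral_mono fun z => modeTest_le_add_cutDist ha ha1 hL h1 j z.2 z.1.1 z.1.2
  · exact hmt.comp (by fun_prop)

/-- The Lyapunov function `c i * ‖x‖ ^ a` has bounded means along the chain. -/
theorem IsContracting.exists_lintegral_le [IsProbabilityMeasure γ]
    (h : IsContracting p γ S c κ a) (ha : 0 < a) (ha1 : a ≤ 1) (hκ : κ < 1)
    (hp : ∀ i, ∑ j, p i j = 1) (hS : ∀ i j, Measurable fun q : E × W => S q.1 i j q.2)
    (hfin : ∀ i j, ∫⁻ w, ‖S 0 i j w‖ₑ ^ a ∂γ ≠ ⊤) :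
    ∃ M : ℝ≥0, ∀ μ : Measure (E × Fin m), IsProbabilityMeasure μ →
      ∫⁻ z, c z.2 * ‖z.1‖ₑ ^ a ∂μ = 0 →
      ∀ k, ∫⁻ z, c z.2 * ‖z.1‖ₑ ^ a ∂iterLaw p γ S μ k ≤ M := by
  set V : E × Fin m → ℝ≥0∞ := fun z => c z.2 * ‖z.1‖ₑ ^ a with hV
  have hVm : Measurable V := by fun_prop
  have hp1 : ∀ i j, p i j ≤ 1 := fun i j =>
    (Finset.single_le_sum (fun _ _ => zero_le) (Finset.mem_univ j)).trans (hp i).le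
  set b : ℝ≥0∞ := ∑ i, ∑ j, p i j * ∫⁻ w, c j * ‖S 0 i j w‖ₑ ^ a ∂γ with hb
  have hbfin : b ≠ ⊤ := by
    refine ENNReal.sum_ne_top.2 fun i _ => ENNReal.sum_ne_top.2 fun j _ => ?_
    refine ENNReal.mul_ne_top ((hp1 i j).trans_lt ENNReal.one_lt_top).ne ?_
    rw [lintegral_const_mul' _ _ (by finiteness)]
    exact ENNReal.mul_ne_top (by finiteness) (hfin i j)
  -- The drift condition follows from contraction towards the step from the origin: `t ↦ t ^ a` is
  -- subadditive for `a ≤ 1`, and `b` bounds the mean of `V` after one step from `0`.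
  have hdrift : ∀ z, stepOp p γ S V z ≤ κ * V z + b := by
    intro z
    have h1 : ∀ j w, V (S z.1 z.2 j w, j) ≤
        c j * ‖S z.1 z.2 j w - S 0 z.2 j w‖ₑ ^ a + c j * ‖S 0 z.2 j w‖ₑ ^ a := by
      intro j w
      rw [hV, ← mul_add]
      dsimp only
      gcongr
      refine le_trans ?_ (ENNReal.rpow_add_le_add_rpow _ _ ha.le ha1)
      gcongr
      simpa using enorm_add_le (S z.1 z.2 j w - S 0 z.2 j w) (S 0 z.2 j w)
    calc stepOp p γ S V z ≤ ∑ j, p z.2 j * (∫⁻ w, c j * ‖S z.1 z.2 j w - S 0 z.2 j w‖ₑ ^ a ∂γ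
          + ∫⁻ w, c j * ‖S 0 z.2 j w‖ₑ ^ a ∂γ) := by
          unfold stepOp
          gcongr with j
          rw [← lintegral_add_right]
          · exact lintegral_mono fun w => h1 j w
          · have := (hS z.2 j).comp (measurable_prodMk_left (x := (0 : E)))
            exact ((this.enorm).pow_const a).const_mul _
      _ = (∑ j, p z.2 j * ∫⁻ w, c j * ‖S z.1 z.2 j w - S 0 z.2 j w‖ₑ ^ a ∂γ)
          + ∑ j, p z.2 j * ∫⁻ w, c j * ‖S 0 z.2 j w‖ₑ ^ a ∂γ := by
          rw [← Finset.sum_add_distrib]; simp_rw [mul_add]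
      _ ≤ κ * V z + b := by
          gcongr
          · simpa [hV] using h z.1 0 z.2
          · exact Finset.single_le_sum (f := fun i => ∑ j, p i j * ∫⁻ w, c j * ‖S 0 i j w‖ₑ ^ a ∂γ)
              (fun _ _ => zero_le) (Finset.mem_univ z.2)
  have hκ' : 1 - κ ≠ 0 := (tsub_pos_of_lt hκ).ne'
  -- The fixed point of `M ↦ κM + b`.
  refine ⟨b.toNNReal / (1 - κ), fun μ hμ h0 k => ?_⟩
  induction k with
  | zero => exact h0.le.trans zero_le
  | succ k ih =>
    have := isProbabilityMeasure_iterLaw (γ := γ) hp hS μ k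
    rw [iterLaw_succ, lintegral_bind_stepLaw hS hVm]
    calc ∫⁻ z, stepOp p γ S V z ∂iterLaw p γ S μ k
        ≤ ∫⁻ z, (κ * V z + b) ∂iterLaw p γ S μ k := lintegral_mono hdrift
      _ = κ * ∫⁻ z, V z ∂iterLaw p γ S μ k + b := by
          rw [lintegral_add_right _ measurable_const, lintegral_const_mul _ hVm]; simp
      _ ≤ κ * ((b.toNNReal / (1 - κ) : ℝ≥0) : ℝ≥0∞) + b := by gcongr
      _ = ((b.toNNReal / (1 - κ) : ℝ≥0) : ℝ≥0∞) := by
          conv_lhs => rw [← ENNReal.coe_toNNReal hbfin]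
          rw [ENNReal.coe_toNNReal hbfin]
          nth_rw 2 [← ENNReal.coe_toNNReal hbfin]
          norm_cast
          have h3 : b.toNNReal = (1 - κ) * (b.toNNReal / (1 - κ)) := (mul_div_cancel₀ _ hκ').symm
          nth_rw 2 [h3]
          rw [← add_mul, add_tsub_cancel_of_le hκ.le, one_mul]

/-- Markov's inequality, with closed balls of the proper space `E` as compact sets and only finitely
many modes. -/
theorem isTightMeasureSet_of_lintegral_le (ha : 0 < a) (hc : ∀ i, c i ≠ 0) {M : ℝ≥0}
    {s : Set (Measure (E × Fin m))} (hs : ∀ μ ∈ s, ∫⁻ z, c z.2 * ‖z.1‖ₑ ^ a ∂μ ≤ M) :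
    IsTightMeasureSet s := by
  rw [isTightMeasureSet_iff_exists_isCompact_measure_compl_le]
  intro ε hε
  set b : ℝ≥0 := ∑ i, (c i)⁻¹ with hb
  have hbc : ∀ i, (1 : ℝ≥0∞) ≤ b * c i := by
    intro i
    have h1 : (c i)⁻¹ ≤ b := Finset.single_le_sum (f := fun i => (c i)⁻¹)
      (fun _ _ => zero_le) (Finset.mem_univ i)
    have h2 : 1 ≤ b * c i := by
      calc (1 : ℝ≥0) = (c i)⁻¹ * c i := (inv_mul_cancel₀ (hc _)).symm
        _ ≤ _ := by gcongr
    exact_mod_cast h2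
  obtain ⟨N, hN, hN0⟩ : ∃ N : ℝ≥0, (b * M : ℝ≥0∞) / (N : ℝ≥0∞) ^ a ≤ ε ∧ N ≠ 0 := by
    have h1 : Tendsto (fun N : ℝ≥0 => (b * M : ℝ≥0∞) / (N : ℝ≥0∞) ^ a) atTop (𝓝 0) := by
      have h2 : Tendsto (fun N : ℝ≥0 => (N : ℝ≥0∞) ^ a) atTop (𝓝 ⊤) := by
        have := (ENNReal.continuous_rpow_const (y := a)).tendsto ⊤
        rw [ENNReal.top_rpow_of_pos ha] at this
        exact this.comp (ENNReal.tendsto_coe_nhds_top.2 tendsto_id)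
      simpa using ENNReal.Tendsto.const_div h2 (Or.inr (by finiteness : (b * M : ℝ≥0∞) ≠ ⊤))
    exact ((h1.eventually_le_const hε).and (eventually_ne_atTop 0)).exists
  refine ⟨Metric.closedBall 0 N ×ˢ univ, (isCompact_closedBall _ _).prod isCompact_univ,
    fun μ hμ => ?_⟩
  have hsub : (Metric.closedBall (0 : E) N ×ˢ (univ : Set (Fin m)))ᶜ ⊆
      {z | (N : ℝ≥0∞) ^ a ≤ b * (c z.2 * ‖z.1‖ₑ ^ a)} := by
    intro z hz
    have hz' : (N : ℝ) < ‖z.1‖ := by simpa using hz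
    have h3 : (N : ℝ≥0∞) ≤ ‖z.1‖ₑ := by
      rw [enorm_eq_nnnorm]
      exact_mod_cast hz'.le
    calc (N : ℝ≥0∞) ^ a ≤ ‖z.1‖ₑ ^ a := by gcongr
      _ ≤ (b * c z.2) * ‖z.1‖ₑ ^ a := le_mul_of_one_le_left' (hbc _)
      _ = _ := mul_assoc _ _ _
  have hNpos : (N : ℝ≥0∞) ^ a ≠ 0 := by
    simp [ENNReal.rpow_eq_zero_iff, hN0]
  calc μ _ ≤ μ {z | (N : ℝ≥0∞) ^ a ≤ b * (c z.2 * ‖z.1‖ₑ ^ a)} := measure_mono hsub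
    _ ≤ (∫⁻ z, b * (c z.2 * ‖z.1‖ₑ ^ a) ∂μ) / (N : ℝ≥0∞) ^ a :=
      meas_ge_le_lintegral_div (by fun_prop) hNpos (by finiteness)
    _ ≤ (b * M : ℝ≥0∞) / (N : ℝ≥0∞) ^ a := by
      rw [lintegral_const_mul _ (by fun_prop)]
      gcongr
      exact hs μ hμ
    _ ≤ ε := hN

end Invariant

section Invariant
variable {m : ℕ} {E W : Type*} [NormedAddCommGroup E] [MeasurableSpace E] [BorelSpace E]
  [MeasurableSpace W]
  {p : Fin m → Fin m → ℝ≥0∞} {γ : Measure W} {S : E → Fin m → Fin m → W → E}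
  {c : Fin m → ℝ≥0} {κ : ℝ≥0} {a : ℝ}

/-- The Feller property. -/
theorem exists_boundedContinuous_stepOp [IsProbabilityMeasure γ] (hp : ∀ i, ∑ j, p i j = 1)
    (hS : ∀ i j, Measurable fun q : E × W => S q.1 i j q.2)
    (hSc : ∀ i j w, Continuous fun x => S x i j w) (F : BoundedContinuousFunction (E × Fin m) ℝ≥0) :
    ∃ G : BoundedContinuousFunction (E × Fin m) ℝ≥0,
      ∀ z, stepOp p γ S (fun x => (F x : ℝ≥0∞)) z = G z := by
  obtain ⟨b, hb⟩ : ∃ b : ℝ≥0, ∀ x, F x ≤ b := ⟨nndist 0 F, fun x => F.apply_le_nndist_zero x⟩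
  have hFm : Measurable fun x => (F x : ℝ≥0∞) := F.continuous.measurable.coe_nnreal_ennreal
  have hp1 : ∀ i j, p i j ≤ 1 := fun i j =>
    (Finset.single_le_sum (fun _ _ => zero_le) (Finset.mem_univ j)).trans (hp i).le
  have hle : ∀ z, stepOp p γ S (fun x => (F x : ℝ≥0∞)) z ≤ b := by
    intro z
    refine (stepOp_mono (F' := fun _ => b * 1) (fun x => ?_) z).trans ?_
    · rw [mul_one]; exact_mod_cast hb x
    · rw [stepOp_const_mul (by finiteness) z, stepOp_one hp, mul_one]
  have hcont : Continuous (stepOp p γ S (fun x => (F x : ℝ≥0∞))) := by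
    refine continuous_prod_of_discrete_right.2 fun i => ?_
    refine continuous_finsetSum _ fun j _ => ?_
    refine (ENNReal.continuous_const_mul ((hp1 i j).trans_lt ENNReal.one_lt_top).ne).comp
      (f := fun x => ∫⁻ w, F (S x i j w, j) ∂γ) ?_
    refine continuous_iff_continuousAt.2 fun x => ?_
    refine tendsto_lintegral_filter_of_dominated_convergence (fun _ => (b : ℝ≥0∞))
      (Eventually.of_forall fun y => ?_) (Eventually.of_forall fun y => ae_of_all _ fun w => ?_)
      (by simp) (ae_of_all _ fun w => ?_)
    · exact hFm.comp (measurable_section hS (y, i) j)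
    · exact_mod_cast hb _
    · exact (Continuous.tendsto (by have := hSc i j w; fun_prop) x :
        Tendsto (fun y => (F (S y i j w, j) : ℝ≥0∞)) _ _)
  have hne : ∀ z, stepOp p γ S (fun x => (F x : ℝ≥0∞)) z ≠ ⊤ := fun z =>
    ((hle z).trans_lt ENNReal.coe_lt_top).ne
  refine ⟨BoundedContinuousFunction.mkOfBound
    ⟨fun z => (stepOp p γ S (fun x => (F x : ℝ≥0∞)) z).toNNReal, ?_⟩ b ?_, fun z => ?_⟩
  · exact ENNReal.continuousOn_toNNReal.comp_continuous hcont hne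
  · intro x y
    have h : ∀ z, (stepOp p γ S (fun x => (F x : ℝ≥0∞)) z).toNNReal ≤ b := fun z =>
      ENNReal.coe_le_coe.1 ((ENNReal.coe_toNNReal (hne z)).trans_le (hle z))
    rw [NNReal.dist_eq]
    have hx : ((stepOp p γ S (fun x => (F x : ℝ≥0∞)) x).toNNReal : ℝ) ≤ b := h x
    have hy : ((stepOp p γ S (fun x => (F x : ℝ≥0∞)) y).toNNReal : ℝ) ≤ b := h y
    exact abs_sub_le_of_nonneg_of_le NNReal.zero_le_coe hx NNReal.zero_le_coe hy
  · exact (ENNReal.coe_toNNReal (hne z)).symm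

variable [ProperSpace E]

/-- A contracting chain whose mode has a unique invariant distribution has a unique invariant
probability measure. -/
theorem IsContracting.existsUnique_invariant [IsProbabilityMeasure γ]
    (h : IsContracting p γ S c κ a) (ha : 0 < a) (ha1 : a ≤ 1) (hc : ∀ i, c i ≠ 0) (hκ : κ < 1)
    (hp : ∀ i, ∑ j, p i j = 1) (hS : ∀ i j, Measurable fun q : E × W => S q.1 i j q.2)
    (hSc : ∀ i j w, Continuous fun x => S x i j w)
    (hfin : ∀ i j, ∫⁻ w, ‖S 0 i j w‖ₑ ^ a ∂γ ≠ ⊤)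
    {π : Fin m → ℝ≥0∞} (hπ1 : ∑ i, π i = 1) (hπ : ∀ j, ∑ i, π i * p i j = π j)
    (huniq : ∀ v : Fin m → ℝ≥0∞, ∑ i, v i = 1 → (∀ j, ∑ i, v i * p i j = v j) → v = π) :
    ∃! μ : Measure (E × Fin m), IsProbabilityMeasure μ ∧ μ.bind (stepLaw p γ S) = μ := by
  refine existsUnique_of_exists_of_unique ?_ ?_
  -- Starting with the stationary mode law gives `μ₀` and its successor the same mode marginal, so
  -- they can be coupled.
  · set μ₀ : Measure (E × Fin m) := ∑ i, π i • Measure.dirac (0, i) with hμ₀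
    have hμ₀p : IsProbabilityMeasure μ₀ := ⟨by simp [hμ₀, hπ1]⟩
    have hsnd : ∀ j, (μ₀.map Prod.snd) {j} = π j := by
      intro j
      rw [Measure.map_apply measurable_snd (MeasurableSet.singleton j), hμ₀]
      simp only [Measure.coe_finsetSum, Finset.sum_apply, Measure.smul_apply, smul_eq_mul,
        Measure.dirac_apply' _ (measurable_snd (MeasurableSet.singleton j))]
      rw [Finset.sum_eq_single j]
      · simp
      · intro i _ hij; simp [hij]
      · simp
    have hμ₁p := isProbabilityMeasure_bind_stepLaw hp hS (γ := γ) μ₀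
    have hmode : μ₀.map Prod.snd = (μ₀.bind (stepLaw p γ S)).map Prod.snd := by
      refine Measure.ext_of_singleton fun j => ?_
      rw [map_snd_bind_stepLaw hS]
      simp_rw [hsnd]
      exact (hπ j).symm
    have hV0 : ∫⁻ z, c z.2 * ‖z.1‖ₑ ^ a ∂μ₀ = 0 := by
      rw [hμ₀, lintegral_finsetSum_measure]
      refine Finset.sum_eq_zero fun i _ => ?_
      rw [lintegral_smul_measure, lintegral_dirac' _ (by fun_prop)]
      simp [ENNReal.zero_rpow_of_pos ha]
    obtain ⟨M, hM⟩ := h.exists_lintegral_le ha ha1 hκ hp hS hfin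
    let μ : ℕ → ProbabilityMeasure (E × Fin m) := fun k =>
      ⟨iterLaw p γ S μ₀ k, isProbabilityMeasure_iterLaw hp hS μ₀ k⟩
    have htight : IsTightMeasureSet
        {((ν : ProbabilityMeasure (E × Fin m)) : Measure (E × Fin m)) | ν ∈ range μ} := by
      refine isTightMeasureSet_of_lintegral_le ha hc (M := M) ?_
      rintro _ ⟨_, ⟨k, rfl⟩, rfl⟩
      exact hM μ₀ hμ₀p hV0 k
    have hcpt := isCompact_closure_of_isTightMeasureSet htight
    -- By Prokhorov the laws lie in a compact set; a nonprincipal ultrafilter replaces the choice of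
    -- a subsequence.
    let U : Ultrafilter ℕ := hyperfilter ℕ
    have hU : (U : Filter ℕ) ≤ atTop := Nat.hyperfilter_le_atTop
    obtain ⟨ν, -, hν⟩ := hcpt.ultrafilter_le_nhds (U.map μ)
      (le_principal_iff.2 (Ultrafilter.mem_map.2 (univ_mem' fun k => subset_closure ⟨k, rfl⟩)))
    have hν : Tendsto μ U (𝓝 ν) := hν
    rw [ProbabilityMeasure.tendsto_iff_forall_lintegral_tendsto] at hν
    refine ⟨ν, inferInstance, ?_⟩
    have := isProbabilityMeasure_bind_stepLaw hp hS (γ := γ) (ν : Measure (E × Fin m))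
    refine ext_of_lintegral_modeTest fun j φ L hL hφ1 => ?_
    let F : BoundedContinuousFunction (E × Fin m) ℝ≥0 :=
      BoundedContinuousFunction.mkOfBound ⟨modeTest j φ, continuous_modeTest j hL.continuous⟩ 1 (by
        have h1 : ∀ z, modeTest j φ z ≤ 1 := by
          intro z; unfold modeTest; split_ifs; exacts [hφ1 _, zero_le]
        intro x y
        rw [NNReal.dist_eq]
        exact abs_sub_le_of_nonneg_of_le NNReal.zero_le_coe (h1 x) NNReal.zero_le_coe (h1 y))
    have hFm : Measurable fun x => (F x : ℝ≥0∞) := F.continuous.measurable.coe_nnreal_ennreal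
    obtain ⟨G, hG⟩ := exists_boundedContinuous_stepOp (γ := γ) hp hS hSc F
    have t0 := hν F
    -- Starting one step later shifts the index by one, and by the Feller property these laws tend
    -- to the image of `ν` under one step.
    have t1 : Tendsto (fun k => ∫⁻ z, F z ∂iterLaw p γ S (μ₀.bind (stepLaw p γ S)) k) U
        (𝓝 (∫⁻ z, F z ∂(ν : Measure (E × Fin m)).bind (stepLaw p γ S))) := by
      rw [lintegral_bind_stepLaw hS hFm]
      simp_rw [hG]
      refine (hν G).congr fun k => ?_
      change ∫⁻ z, G z ∂iterLaw p γ S μ₀ k = _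
      have e : iterLaw p γ S (μ₀.bind (stepLaw p γ S)) k
          = (iterLaw p γ S μ₀ k).bind (stepLaw p γ S) := by
        rw [← iterLaw_succ]; exact (Function.iterate_succ_apply _ _ _).symm
      rw [e, lintegral_bind_stepLaw hS hFm]
      simp_rw [hG]
    obtain ⟨δ, hδ, hle⟩ := h.exists_modeTest_bound ha ha1 hc hκ hp hS _ _ hmode hL hφ1 j
    obtain ⟨δ', hδ', hle'⟩ := h.exists_modeTest_bound ha ha1 hc hκ hp hS _ _ hmode.symm hL hφ1 j
    refine le_antisymm ?_ ?_
    · have := le_of_tendsto_of_tendsto' t1 (t0.add (hδ'.mono_left hU)) hle'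
      rwa [add_zero] at this
    · have := le_of_tendsto_of_tendsto' t0 (t1.add (hδ.mono_left hU)) hle
      rwa [add_zero] at this
  · rintro μ ν ⟨hμ, hμi⟩ ⟨hν, hνi⟩
    -- The mode marginal of an invariant law is invariant for `p`, hence equal to `π`. Invariant
    -- laws do not move along the chain, so merging forces equality.
    have hmarg : ∀ ρ : Measure (E × Fin m), IsProbabilityMeasure ρ → ρ.bind (stepLaw p γ S) = ρ →
        ∀ j, (ρ.map Prod.snd) {j} = π j := by
      intro ρ hρ hρi
      refine congrFun (huniq _ ?_ fun j => ?_)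
      · have : IsProbabilityMeasure (ρ.map Prod.snd) :=
          Measure.isProbabilityMeasure_map measurable_snd.aemeasurable
        rw [sum_measure_singleton, Finset.coe_univ, measure_univ]
      · rw [← map_snd_bind_stepLaw (γ := γ) hS, hρi]
    have hmode : μ.map Prod.snd = ν.map Prod.snd :=
      Measure.ext_of_singleton fun j => by rw [hmarg μ hμ hμi, hmarg ν hν hνi]
    refine ext_of_lintegral_modeTest fun j φ L hL hφ1 => ?_
    obtain ⟨δ, hδ, hle⟩ := h.exists_modeTest_bound ha ha1 hc hκ hp hS _ _ hmode hL hφ1 j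
    obtain ⟨δ', hδ', hle'⟩ := h.exists_modeTest_bound ha ha1 hc hκ hp hS _ _ hmode.symm hL hφ1 j
    simp_rw [iterLaw_of_invariant hμi, iterLaw_of_invariant hνi] at hle hle'
    refine le_antisymm ?_ ?_
    · simpa using ge_of_tendsto' (hδ.const_add (∫⁻ z, modeTest j φ z ∂ν)) hle
    · simpa using ge_of_tendsto' (hδ'.const_add (∫⁻ z, modeTest j φ z ∂μ)) hle'

end Invariant

/-! ### Markov property of a chain driven by modes and independent noise -/

section Drive
variable {m : ℕ} {Y W : Type*}

/-- The positions of the chain with the steps `S` along a mode sequence `s` and a noise sequence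
`w`. -/
def drive (S : Y → Fin m → Fin m → W → Y) (y : Y) (s : ℕ → Fin m) (w : ℕ → W) : ℕ → Y
  | 0 => y
  | k + 1 => S (drive S y s w k) (s k) (s (k + 1)) (w k)

theorem drive_congr {S : Y → Fin m → Fin m → W → Y} {y : Y} {s s' : ℕ → Fin m} {w w' : ℕ → W}
    {k : ℕ} (hs : ∀ l ≤ k, s l = s' l) (hw : ∀ l < k, w l = w' l) :
    drive S y s w k = drive S y s' w' k := by
  induction k with
  | zero => rfl
  | succ k ih =>
    rw [drive, drive, ih (fun l hl => hs l (by omega)) (fun l hl => hw l (by omega)),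
      hs k (by omega), hs (k + 1) le_rfl, hw k (by omega)]

theorem measurable_drive [MeasurableSpace Y] [MeasurableSpace W] {S : Y → Fin m → Fin m → W → Y}
    (hS : ∀ i j, Measurable fun q : Y × W => S q.1 i j q.2) {V : Type*} [MeasurableSpace V]
    (y : Y) {s : V → ℕ → Fin m} {w : V → ℕ → W} (k : ℕ) (hs : ∀ l ≤ k, Measurable fun v => s v l)
    (hw : ∀ l < k, Measurable fun v => w v l) :
    Measurable fun v => drive S y (s v) (w v) k := by
  induction k with
  | zero => exact measurable_const
  | succ k ih =>
    have h : Measurable fun q : (Y × W) × (Fin m × Fin m) => S q.1.1 q.2.1 q.2.2 q.1.2 :=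
      measurable_from_prod_countable_left fun ij => hS ij.1 ij.2
    exact h.comp (((ih (fun l hl => hs l (by omega)) fun l hl => hw l (by omega)).prodMk
      (hw k (by omega))).prodMk ((hs k (by omega)).prodMk (hs (k + 1) le_rfl)))

end Drive

section Law
variable {Ω : Type*} [MeasurableSpace Ω] {P : Measure Ω}

theorem lintegral_eq_sum_fiber {ι : Type*} [Fintype ι] [MeasurableSpace ι]
    [MeasurableSingletonClass ι] {X : Ω → ι} (hX : Measurable X) (H : Ω → ℝ≥0∞) :
    ∫⁻ ω, H ω ∂P = ∑ i, ∫⁻ ω in X ⁻¹' {i}, H ω ∂P := by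
  rw [← tsum_fintype (L := .unconditional _), ← lintegral_iUnion
    (fun i => hX (measurableSet_singleton i))
    (fun i j hij => Disjoint.preimage _ (by simpa using hij))]
  rw [← preimage_iUnion, iUnion_of_singleton, preimage_univ, Measure.restrict_univ]

theorem IndepFun.setLIntegral_comp {A C : Type*} [MeasurableSpace A] [MeasurableSpace C]
    {X : Ω → A} {R : Ω → C} (h : IndepFun X R P) (hX : Measurable X) (hR : Measurable R)
    {φ : A → ℝ≥0∞} (hφ : Measurable φ) {D : Set C} (hD : MeasurableSet D) :
    ∫⁻ ω in R ⁻¹' D, φ (X ω) ∂P = P (R ⁻¹' D) * ∫⁻ ω, φ (X ω) ∂P := by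
  have hDm : Measurable (D.indicator fun _ => (1 : ℝ≥0∞)) := measurable_const.indicator hD
  have h1 := h.comp hφ hDm
  have h2 := lintegral_mul_eq_lintegral_mul_lintegral_of_indepFun (hφ.comp hX)
    (hDm.comp hR) h1
  rw [← lintegral_indicator (hR hD)]
  have e1 : ∀ ω, (R ⁻¹' D).indicator (fun ω => φ (X ω)) ω =
      (φ ∘ X * (D.indicator fun _ => (1 : ℝ≥0∞)) ∘ R : Ω → ℝ≥0∞) ω := by
    intro ω
    by_cases hω : R ω ∈ D <;> simp [Set.indicator, hω]
  simp_rw [e1]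
  rw [h2, mul_comm]
  congr 1
  have e2 : (D.indicator (fun _ => (1 : ℝ≥0∞)) ∘ R) = (R ⁻¹' D).indicator 1 := by
    ext ω; rfl
  rw [e2, lintegral_indicator_one (hR hD)]

variable {m : ℕ} {Y W : Type*} [MeasurableSpace Y] [MeasurableSpace W] [Nonempty W]
  {p : Fin m → Fin m → ℝ≥0∞} {γ : Measure W} [IsProbabilityMeasure γ]
  {S : Y → Fin m → Fin m → W → Y} [IsProbabilityMeasure P]

/-- For independent noise, the next noise variable is independent of the position. -/
theorem lintegral_drive_noise (hS : ∀ i j, Measurable fun q : Y × W => S q.1 i j q.2)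
    {w : ℕ → Ω → W} (hw : ∀ k, Measurable (w k))
    (hind : ∀ k, IndepFun (fun ω (l : Finset.range k) => w l ω) (w k) P)
    (hlaw : ∀ k, P.map (w k) = γ) (y : Y) (s : ℕ → Fin m) (k : ℕ) {K : Y × W → ℝ≥0∞}
    (hK : Measurable K) :
    ∫⁻ ω, K (drive S y s (w · ω) k, w k ω) ∂P =
      ∫⁻ ω, ∫⁻ ξ, K (drive S y s (w · ω) k, ξ) ∂γ ∂P := by
  -- The position after `k` steps reads only the first `k` noise values; the values filled in beyond
  -- are irrelevant.
  let ext : (Finset.range k → W) → ℕ → W := fun u l =>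
    if h : l ∈ Finset.range k then u ⟨l, h⟩ else Classical.arbitrary W
  have hψ : Measurable fun u => drive S y s (ext u) k := by
    refine measurable_drive hS y k (fun _ _ => measurable_const) fun l hl => ?_
    simp only [ext, Finset.mem_range, hl, dif_pos]
    exact measurable_pi_apply _
  have h2 := (hind k).comp hψ measurable_id
  have e : ((fun u => drive S y s (ext u) k) ∘ fun ω (l : Finset.range k) => w l ω) =
      fun ω => drive S y s (w · ω) k := by
    ext ω
    refine drive_congr (fun _ _ => rfl) fun l hl => ?_
    simp [ext, hl]
  rw [e] at h2
  have hd : Measurable fun ω => drive S y s (w · ω) k := measurable_drive hS y k (fun _ _ => measurable_const) fun l _ => hw l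
  have h3 := (indepFun_iff_map_prod_eq_prod_map_map hd.aemeasurable (hw k).aemeasurable).1 h2
  rw [hlaw] at h3
  rw [← lintegral_map (f := K) (g := fun ω => (drive S y s (w · ω) k, w k ω)) hK
    (hd.prodMk (hw k)), h3, lintegral_prod _ hK.aemeasurable,
    lintegral_map hK.lintegral_prod_right' hd]

/-- The position and the mode of a chain driven by a Markov chain of modes and by independent noise
form a Markov chain with the one-step law `stepLaw`. -/
theorem map_drive_succ (hS : ∀ i j, Measurable fun q : Y × W => S q.1 i j q.2)
    {w : ℕ → Ω → W} (hw : ∀ k, Measurable (w k))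
    (hind : ∀ k, IndepFun (fun ω (l : Finset.range k) => w l ω) (w k) P)
    (hlaw : ∀ k, P.map (w k) = γ) {r : ℕ → Ω → Fin m} (hr : ∀ k, Measurable (r k))
    (hwr : IndepFun (fun ω k => w k ω) (fun ω k => r k ω) P)
    (hmarkov : ∀ (k : ℕ) (s : ℕ → Fin m) (j : Fin m),
      P ({ω | ∀ l ≤ k, r l ω = s l} ∩ {ω | r (k + 1) ω = j}) =
        P {ω | ∀ l ≤ k, r l ω = s l} * p (s k) j) (y : Y) (k : ℕ) :
    P.map (fun ω => (drive S y (r · ω) (w · ω) (k + 1), r (k + 1) ω)) =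
      (P.map (fun ω => (drive S y (r · ω) (w · ω) k, r k ω))).bind (stepLaw p γ S) := by
  have hWm : Measurable fun ω k => w k ω := measurable_pi_lambda _ hw
  have hRm : Measurable fun ω k => r k ω := measurable_pi_lambda _ hr
  have hpath : ∀ k, Measurable fun ω (l : Fin (k + 1)) => r l ω := fun k =>
    measurable_pi_lambda _ fun l => hr l
  -- A finite mode path is continued by its last value.
  let ext : ∀ k, (Fin (k + 1) → Fin m) → ℕ → Fin m := fun k s l => s ⟨min l k, by omega⟩
  have hext : ∀ k (s : Fin (k + 1) → Fin m) ω, (fun l : Fin (k + 1) => r l ω) = s →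
      ∀ l ≤ k, r l ω = ext k s l := by
    rintro k s ω rfl l hl
    simp [ext, min_eq_left hl]
  have hfib : ∀ k (s : Fin (k + 1) → Fin m), (fun ω (l : Fin (k + 1)) => r l ω) ⁻¹' {s} =
      {ω | ∀ l ≤ k, r l ω = ext k s l} := by
    intro k s
    ext ω
    refine ⟨fun h => hext k s ω h, fun h => ?_⟩
    refine funext fun l => (h l (by omega)).trans ?_
    have h2 : min (l : ℕ) k = l := by omega
    simp only [ext, h2]
  have hdrive : ∀ k, Measurable fun ω => (drive S y (r · ω) (w · ω) k, r k ω) := fun k =>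
    (measurable_drive hS y k (fun l _ => hr l) fun l _ => hw l).prodMk (hr k)
  refine Measure.ext_of_lintegral _ fun F hF => ?_
  -- Both sides are split by the mode path up to time `k`. On a fibre the modes are fixed, and the
  -- position is a function of the noise, which is independent of the modes.
  rw [lintegral_map hF (hdrive (k + 1)), lintegral_bind_stepLaw hS hF,
    lintegral_map (measurable_stepOp hS hF) (hdrive k),
    lintegral_eq_sum_fiber (hpath k) (P := P),
    lintegral_eq_sum_fiber (hpath k) (P := P) (fun ω => stepOp p γ S F _)]
  refine Finset.sum_congr rfl fun s _ => ?_
  have hm1 := hpath k (measurableSet_singleton s)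
  have hpre : MeasurableSet {v : ℕ → Fin m | ∀ l ≤ k, v l = ext k s l} := by
    simp only [Set.ofPred_forall]
    exact MeasurableSet.iInter fun l => MeasurableSet.iInter fun _ =>
      (measurable_pi_apply l) (measurableSet_singleton _)
  have hstepF := measurable_stepOp (p := p) (γ := γ) hS hF
  have hd1 : Measurable fun v : ℕ → W => drive S y (ext k s) v k :=
    measurable_drive hS y (s := fun _ => ext k s) k (fun _ _ => measurable_const)
      fun l _ => measurable_pi_apply l
  have hKm : ∀ j, Measurable fun q : Y × W => F (S q.1 (ext k s k) j q.2, j) := fun j =>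
    hF.comp ((hS _ _).prodMk measurable_const)
  have hIm : ∀ j, Measurable fun ω =>
      ∫⁻ ξ, F (S (drive S y (ext k s) (w · ω) k) (ext k s k) j ξ, j) ∂γ := fun j =>
    (hKm j).lintegral_prod_right'.comp (hd1.comp hWm)
  have hR : ∫⁻ ω in (fun ω (l : Fin (k + 1)) => r l ω) ⁻¹' {s},
      stepOp p γ S F (drive S y (r · ω) (w · ω) k, r k ω) ∂P =
      P {ω | ∀ l ≤ k, r l ω = ext k s l} *
        ∫⁻ ω, stepOp p γ S F (drive S y (ext k s) (w · ω) k, ext k s k) ∂P := by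
    rw [setLIntegral_congr_fun (g := fun ω =>
      stepOp p γ S F (drive S y (ext k s) (w · ω) k, ext k s k)) hm1]
    · rw [hfib]
      exact IndepFun.setLIntegral_comp hwr hWm hRm
        (φ := fun v => stepOp p γ S F (drive S y (ext k s) v k, ext k s k))
        (hstepF.comp (hd1.prodMk measurable_const)) hpre
    · intro ω hω
      dsimp only
      rw [drive_congr (hext k s ω hω) (fun _ _ => rfl), hext k s ω hω k le_rfl]
  rw [hR, lintegral_eq_sum_fiber (hr (k + 1))]
  -- After a further split by the next mode, independence separates modes from noise, the Markov
  -- property yields the factor `p`, and the last noise variable is integrated out.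
  have hL : ∀ j, ∫⁻ ω in r (k + 1) ⁻¹' {j}, F (drive S y (r · ω) (w · ω) (k + 1), r (k + 1) ω)
      ∂P.restrict ((fun ω (l : Fin (k + 1)) => r l ω) ⁻¹' {s}) =
      P {ω | ∀ l ≤ k, r l ω = ext k s l} * (p (ext k s k) j *
        ∫⁻ ω, ∫⁻ ξ, F (S (drive S y (ext k s) (w · ω) k) (ext k s k) j ξ, j) ∂γ ∂P) := by
    intro j
    rw [Measure.restrict_restrict (hr (k + 1) (measurableSet_singleton j)), inter_comm,
      setLIntegral_congr_fun (g := fun ω =>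
        F (S (drive S y (ext k s) (w · ω) k) (ext k s k) j (w k ω), j))
        (hm1.inter (hr (k + 1) (measurableSet_singleton j))), hfib]
    · have h1 := IndepFun.setLIntegral_comp hwr hWm hRm
        (φ := fun v => F (S (drive S y (ext k s) v k) (ext k s k) j (v k), j))
        ((hKm j).comp (hd1.prodMk (measurable_pi_apply k))) (hpre.inter (measurable_pi_apply (k + 1)
          (measurableSet_singleton j)))
      refine h1.trans ?_
      rw [← mul_assoc]
      congr 1
      · exact hmarkov k (ext k s) j
      · exact lintegral_drive_noise hS hw hind hlaw y (ext k s) k (hKm j)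
    · rintro ω ⟨h1, h2⟩
      have h2 : r (k + 1) ω = j := h2
      dsimp only [drive]
      rw [drive_congr (hext k s ω h1) (fun _ _ => rfl), hext k s ω h1 k le_rfl, h2]
  simp_rw [hL]
  rw [← Finset.mul_sum]
  congr 1
  unfold stepOp
  rw [lintegral_finsetSum]
  · refine Finset.sum_congr rfl fun j _ => ?_
    exact (lintegral_const_mul (p (ext k s k) j) (hIm j)).symm
  · exact fun j _ => (hIm j).const_mul (p (ext k s k) j)

end Law

/-! ### Brownian increments over the time grid -/

section Noise
variable {Ω : Type*} [MeasurableSpace Ω] {P : Measure Ω} {d : ℕ}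
  {B : ℝ≥0 → Ω → EuclideanSpace ℝ (Fin d)}

/-- The law of an increment of a Brownian motion over a time step `Δ`. -/
def noiseLaw (d : ℕ) (Δ : ℝ≥0) : Measure (EuclideanSpace ℝ (Fin d)) :=
  (stdGaussian (EuclideanSpace ℝ (Fin d))).map fun ξ => √(Δ : ℝ) • ξ

instance (Δ : ℝ≥0) : IsProbabilityMeasure (noiseLaw d Δ) :=
  Measure.isProbabilityMeasure_map (by fun_prop)

theorem noiseLaw_eq_map_pi (Δ : ℝ≥0) :
    noiseLaw d Δ = (Measure.pi fun _ : Fin d => gaussianReal 0 Δ).map (WithLp.toLp 2) := by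
  have h1 : gaussianReal 0 Δ = (gaussianReal 0 1).map (√(Δ : ℝ) * ·) := by
    rw [gaussianReal_map_const_mul, mul_zero, mul_one]
    congr 1
    ext
    simp
  rw [noiseLaw, ← map_pi_eq_stdGaussian, Measure.map_map (by fun_prop) (by fun_prop), h1,
    ← Measure.pi_map_pi fun _ => by fun_prop, Measure.map_map (by fun_prop) (by fun_prop)]
  rfl

/-- The increments of `B` over the steps of length `Δ`. -/
def increment (B : ℝ≥0 → Ω → EuclideanSpace ℝ (Fin d)) (Δ : ℝ≥0) (k : ℕ) (ω : Ω) :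
    EuclideanSpace ℝ (Fin d) :=
  B ((k + 1) * Δ) ω - B (k * Δ) ω

theorem IsBrownianMotion.measurable_increment (hB : IsBrownianMotion P B) (Δ : ℝ≥0) (k : ℕ) :
    Measurable (increment B Δ k) :=
  (hB.measurable _).sub (hB.measurable _)

/-- Independence of the coordinate processes and independence of the increments of each one combine
into joint independence over coordinates and times. -/
theorem IsBrownianMotion.iIndepFun_increment (hB : IsBrownianMotion P B) (Δ : ℝ≥0) :
    iIndepFun (fun (q : Fin d × ℕ) ω => increment B Δ q.2 ω q.1) P := by
  have hm : ∀ (a : Fin d) (k : ℕ), Measurable fun ω => increment B Δ k ω a := fun a k =>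
    (by fun_prop : Measurable fun v : EuclideanSpace ℝ (Fin d) => v a).comp
      (hB.measurable_increment Δ k)
  refine iIndepFun_uncurry' (X := fun (a : Fin d) (k : ℕ) ω => increment B Δ k ω a) hm ?_ ?_
  · exact hB.indep.comp (fun _ (v : ℝ≥0 → ℝ) (k : ℕ) => v ((k + 1) * Δ) - v (k * Δ))
      fun _ => by fun_prop
  · intro a
    have h := (hB.coord a).toIsPreBrownianReal.hasIndepIncrements.nat
      (t := fun k : ℕ => (k : ℝ≥0) * Δ) (fun k l hkl => by dsimp only; gcongr)
    simpa [increment] using h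

theorem IsBrownianMotion.indepFun_increment (hB : IsBrownianMotion P B) (Δ : ℝ≥0) (k : ℕ) :
    IndepFun (fun ω (l : Finset.range k) => increment B Δ l ω) (increment B Δ k) P := by
  have h := (hB.iIndepFun_increment Δ).indepFun_finset (Finset.univ ×ˢ Finset.range k)
    (Finset.univ ×ˢ {k}) (by
      rw [Finset.disjoint_left]
      rintro ⟨a, l⟩ h1 h2
      simp at h1 h2
      omega) (fun q => (by fun_prop : Measurable fun v : EuclideanSpace ℝ (Fin d) => v q.1).comp
      (hB.measurable_increment Δ q.2))
  have hφ : Measurable fun (u : (Finset.univ ×ˢ Finset.range k : Finset (Fin d × ℕ)) → ℝ)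
      (l : Finset.range k) => (WithLp.toLp 2 fun a : Fin d =>
        u ⟨(a, (l : ℕ)), by simp⟩ : EuclideanSpace ℝ (Fin d)) := by
    fun_prop
  have hψ : Measurable fun (u : (Finset.univ ×ˢ {k} : Finset (Fin d × ℕ)) → ℝ) =>
      (WithLp.toLp 2 fun a : Fin d => u ⟨(a, k), by simp⟩ : EuclideanSpace ℝ (Fin d)) := by
    fun_prop
  exact h.comp hφ hψ

theorem IsBrownianMotion.map_increment [IsProbabilityMeasure P] (hB : IsBrownianMotion P B) (Δ : ℝ≥0) (k : ℕ) :
    P.map (increment B Δ k) = noiseLaw d Δ := by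
  have hm : ∀ a : Fin d, Measurable fun ω => increment B Δ k ω a := fun a =>
    (by fun_prop : Measurable fun v : EuclideanSpace ℝ (Fin d) => v a).comp
      (hB.measurable_increment Δ k)
  have h := (hB.iIndepFun_increment Δ).precomp (g := fun a : Fin d => (a, k))
    fun a b hab => (Prod.ext_iff.1 hab).1
  have h1 := (iIndepFun_iff_map_fun_eq_pi_map fun a => (hm a).aemeasurable).1 h
  have h2 : ∀ a : Fin d, P.map (fun ω => increment B Δ k ω a) = gaussianReal 0 Δ := by
    intro a
    have h3 := ((hB.coord a).toIsPreBrownianReal.hasLaw_sub ((k + 1) * Δ) (k * Δ)).map_eq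
    have h4 : nndist (((k + 1) * Δ : ℝ≥0) : ℝ) ((k * Δ : ℝ≥0) : ℝ) = Δ := by
      ext
      rw [coe_nndist, Real.dist_eq]
      push_cast
      rw [show ((k : ℝ) + 1) * Δ - k * Δ = Δ by ring]
      exact abs_of_nonneg Δ.2
    have h5 : gaussianReal 0 (nndist (((k + 1) * Δ : ℝ≥0) : ℝ) ((k * Δ : ℝ≥0) : ℝ)) =
      gaussianReal 0 Δ := by rw [h4]
    exact h3.trans h5
  have h6 : increment B Δ k = WithLp.toLp 2 ∘ fun ω (a : Fin d) => increment B Δ k ω a := rfl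
  rw [noiseLaw_eq_map_pi, h6, ← Measure.map_map (by fun_prop) (measurable_pi_lambda _ hm)]
  have h7 : P.map (fun ω (a : Fin d) => increment B Δ k ω a) =
      Measure.pi fun a : Fin d => P.map fun ω => increment B Δ k ω a := h1
  rw [h7]
  simp_rw [h2]

end Noise

/-! ### The skeleton of the mode process -/

section Modes
variable {Ω : Type*} [MeasurableSpace Ω] {P : Measure Ω} {m : ℕ}
  {Γ : Matrix (Fin m) (Fin m) ℝ} {ℓ : Fin m} {r : ℝ≥0 → Ω → Fin m}

/-- The transition probabilities of the skeleton chain with the step `Δ`. -/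
def skeletonProb (Γ : Matrix (Fin m) (Fin m) ℝ) (Δ : ℝ≥0) (i j : Fin m) : ℝ≥0∞ :=
  ENNReal.ofReal (NormedSpace.exp ((Δ : ℝ) • Γ) i j)

theorem IsMarkovChain.skeleton (hr : IsMarkovChain P Γ ℓ r) (Δ : ℝ≥0) (k : ℕ) (s : ℕ → Fin m)
    (j : Fin m) :
    P ({ω | ∀ l ≤ k, r (l * Δ) ω = s l} ∩ {ω | r ((k + 1 : ℕ) * Δ) ω = j}) =
      P {ω | ∀ l ≤ k, r (l * Δ) ω = s l} * skeletonProb Γ Δ (s k) j := by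
  have h := hr.markov (k * Δ) Δ (s k) j {ω | ∀ l ≤ k, r (l * Δ) ω = s l} ?_
  · have e1 : {ω | ∀ l ≤ k, r (l * Δ) ω = s l} ∩ {ω | r (k * Δ) ω = s k} =
        {ω | ∀ l ≤ k, r (l * Δ) ω = s l} :=
      inter_eq_left.2 fun ω hω => hω k le_rfl
    have e2 : ((k + 1 : ℕ) : ℝ≥0) * Δ = k * Δ + Δ := by push_cast; ring
    rw [e1] at h
    rw [e2]
    exact h
  · have e : {ω | ∀ l ≤ k, r (l * Δ) ω = s l} =
        ⋂ l : ℕ, ⋂ (_ : l ≤ k), r (l * Δ) ⁻¹' {s l} := by ext; simp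
    rw [e]
    refine MeasurableSet.iInter fun l => MeasurableSet.iInter fun hl => ?_
    have h1 : MeasurableSpace.comap (r (l * Δ)) inferInstance ≤
        ⨆ u ∈ Iic (k * Δ), MeasurableSpace.comap (r u) inferInstance :=
      le_iSup₂_of_le (f := fun (u : ℝ≥0) (_ : u ∈ Iic (k * Δ)) =>
        MeasurableSpace.comap (r u) inferInstance) (l * Δ)
        (mem_Iic.2 (by gcongr)) le_rfl
    exact h1 _ ⟨{s l}, measurableSet_singleton _, rfl⟩

/-- Since the chain starts at `ℓ`, the row of `ℓ` is the law of its mode at time `Δ`. -/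
theorem IsMarkovChain.sum_skeletonProb [IsProbabilityMeasure P] (hr : IsMarkovChain P Γ ℓ r) (Δ : ℝ≥0) :
    ∑ j, skeletonProb Γ Δ ℓ j = 1 := by
  have h0 : P {ω | r 0 ω = ℓ} = 1 :=
    (mem_ae_iff_prob_eq_one (hr.measurable 0 (measurableSet_singleton ℓ))).1 hr.start
  have h : ∀ j, skeletonProb Γ Δ ℓ j = (P.map (r Δ)) {j} := by
    intro j
    have := hr.markov 0 Δ ℓ j univ MeasurableSet.univ
    rw [univ_inter, zero_add, h0, one_mul] at this
    rw [Measure.map_apply (hr.measurable Δ) (measurableSet_singleton j)]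
    refine this.symm.trans (measure_congr ?_)
    filter_upwards [hr.start] with ω hω
    exact propext ⟨fun h => h.2, fun h => ⟨hω, h⟩⟩
  have := Measure.isProbabilityMeasure_map (μ := P) (hr.measurable Δ).aemeasurable
  simp_rw [h]
  rw [sum_measure_singleton, Finset.coe_univ, measure_univ]

end Modes

/-! ### The truncated scheme as a driven chain -/

section TruncStep
variable {n d m : ℕ} {f : EuclideanSpace ℝ (Fin n) → Fin m → EuclideanSpace ℝ (Fin n)}
  {g : EuclideanSpace ℝ (Fin n) → Fin m → Matrix (Fin n) (Fin d) ℝ} {R : Fin m → ℝ≥0∞} {Δ : ℝ}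

/-- One step of the truncated Euler-Maruyama scheme with the noise increment `w`, while the mode
moves from `i` to `j`. -/
def truncStep (f : EuclideanSpace ℝ (Fin n) → Fin m → EuclideanSpace ℝ (Fin n))
    (g : EuclideanSpace ℝ (Fin n) → Fin m → Matrix (Fin n) (Fin d) ℝ) (R : Fin m → ℝ≥0∞) (Δ : ℝ)
    (x : EuclideanSpace ℝ (Fin n)) (i j : Fin m) (w : EuclideanSpace ℝ (Fin d)) :
    EuclideanSpace ℝ (Fin n) :=
  trunc (R j) (trunc (R i) x + Δ • f (trunc (R i) x) i + mulVecE (g (trunc (R i) x) i) w)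

theorem trunc_truncStep (x : EuclideanSpace ℝ (Fin n)) (i j : Fin m)
    (w : EuclideanSpace ℝ (Fin d)) :
    trunc (R j) (truncStep f g R Δ x i j w) = truncStep f g R Δ x i j w :=
  trunc_trunc _ _

/-- The truncation of the input changes nothing along the scheme, but it extends the step to all
positions with the Lipschitz bounds of the ball. -/
theorem truncStep_trunc (x : EuclideanSpace ℝ (Fin n)) (i j : Fin m)
    (w : EuclideanSpace ℝ (Fin d)) :
    truncStep f g R Δ (trunc (R i) x) i j w = truncStep f g R Δ x i j w := by
  rw [truncStep, truncStep, trunc_trunc]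

theorem continuous_truncStep (hfg : LocallyLipschitzCoeff f g) (i j : Fin m) :
    Continuous fun q : EuclideanSpace ℝ (Fin n) × EuclideanSpace ℝ (Fin d) =>
      truncStep f g R Δ q.1 i j q.2 := by
  have h1 : Continuous fun q : EuclideanSpace ℝ (Fin n) × EuclideanSpace ℝ (Fin d) =>
      trunc (R i) q.1 := (continuous_trunc _).comp continuous_fst
  have h2 := (hfg.continuous_drift i).comp h1
  have h3 := (hfg.continuous_diffusion i).comp h1
  have h4 : Continuous fun q : EuclideanSpace ℝ (Fin n) × EuclideanSpace ℝ (Fin d) =>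
      mulVecE (g (trunc (R i) q.1) i) q.2 :=
    (PiLp.continuous_toLp 2 _).comp
      (h3.matrix_mulVec ((PiLp.continuous_ofLp 2 _).comp continuous_snd))
  exact (continuous_trunc _).comp ((h1.add (h2.const_smul Δ)).add h4)

theorem continuous_truncStep_left (hfg : LocallyLipschitzCoeff f g) (i j : Fin m)
    (w : EuclideanSpace ℝ (Fin d)) : Continuous fun x => truncStep f g R Δ x i j w := by
  have h1 := continuous_trunc (n := n) (R i)
  have h2 := (hfg.continuous_drift i).comp h1
  have h3 := (hfg.continuous_diffusion i).comp h1
  have h4 : Continuous fun x => mulVecE (g (trunc (R i) x) i) w :=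
    (PiLp.continuous_toLp 2 _).comp (h3.matrix_mulVec continuous_const)
  exact (continuous_trunc _).comp ((h1.add (h2.const_smul Δ)).add h4)

/-- The value at time `k + 1` is truncated with the radius of the new mode, which is why a step
depends on both modes; the starting point must be truncated too. -/
theorem scheme_eq_drive (x : EuclideanSpace ℝ (Fin n)) (r : ℕ → Fin m)
    (w : ℕ → EuclideanSpace ℝ (Fin d)) (k : ℕ) :
    scheme f g R Δ x r w k = drive (truncStep f g R Δ) (trunc (R (r 0)) x) r w k := by
  induction k with
  | zero => rfl
  | succ k ih =>
    rw [drive, ← ih, scheme, scheme, truncStep_trunc]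
    rfl

/-- The truncation of the position with the radius of the present mode. -/
def truncState (R : Fin m → ℝ≥0∞) (z : EuclideanSpace ℝ (Fin n) × Fin m) :
    EuclideanSpace ℝ (Fin n) × Fin m :=
  (trunc (R z.2) z.1, z.2)

theorem measurable_truncState : Measurable (truncState R : EuclideanSpace ℝ (Fin n) × Fin m → _) :=
  measurable_from_prod_countable_left fun i =>
    (continuous_trunc (R i)).measurable.prodMk measurable_const

variable {p : Fin m → Fin m → ℝ≥0∞} {γ : Measure (EuclideanSpace ℝ (Fin d))}

theorem stepOp_truncState (F : EuclideanSpace ℝ (Fin n) × Fin m → ℝ≥0∞)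
    (z : EuclideanSpace ℝ (Fin n) × Fin m) :
    stepOp p γ (truncStep f g R Δ) F (truncState R z) = stepOp p γ (truncStep f g R Δ) F z := by
  simp [stepOp, truncState, truncStep_trunc]

theorem stepOp_comp_truncState (F : EuclideanSpace ℝ (Fin n) × Fin m → ℝ≥0∞)
    (z : EuclideanSpace ℝ (Fin n) × Fin m) :
    stepOp p γ (truncStep f g R Δ) (fun y => F (truncState R y)) z =
      stepOp p γ (truncStep f g R Δ) F z := by
  simp [stepOp, truncState, trunc_truncStep]

/-- Each step ends with a truncation, so an invariant law sees only truncated states. -/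
theorem lintegral_truncState_of_invariant [SFinite γ] (hfg : LocallyLipschitzCoeff f g)
    {μ : Measure (EuclideanSpace ℝ (Fin n) × Fin m)}
    (hμ : μ.bind (stepLaw p γ (truncStep f g R Δ)) = μ)
    {F : EuclideanSpace ℝ (Fin n) × Fin m → ℝ≥0∞} (hF : Measurable F) :
    ∫⁻ z, F (truncState R z) ∂μ = ∫⁻ z, F z ∂μ := by
  have hS : ∀ i j, Measurable fun q : EuclideanSpace ℝ (Fin n) × EuclideanSpace ℝ (Fin d) =>
      truncStep f g R Δ q.1 i j q.2 := fun i j => (continuous_truncStep hfg i j).measurable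
  have h1 := lintegral_bind_stepLaw (p := p) (γ := γ) hS hF μ
  have h2 := lintegral_bind_stepLaw (p := p) (γ := γ) hS
    (hF.comp (measurable_truncState (R := R))) μ
  rw [hμ] at h1 h2
  rw [h1]
  refine h2.trans (lintegral_congr fun z => stepOp_comp_truncState F z)

end TruncStep

/-! ### Transition probabilities and invariance of the scheme -/

section Transition
variable {n d m : ℕ} {f : EuclideanSpace ℝ (Fin n) → Fin m → EuclideanSpace ℝ (Fin n)}
  {g : EuclideanSpace ℝ (Fin n) → Fin m → Matrix (Fin n) (Fin d) ℝ} {R : Fin m → ℝ≥0∞}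
  {Γ : Matrix (Fin m) (Fin m) ℝ} {Δ : ℝ≥0}
  {Ω : Type*} [MeasurableSpace Ω] {P : Measure Ω} [IsProbabilityMeasure P]
  {B : ℝ≥0 → Ω → EuclideanSpace ℝ (Fin d)} {r : Fin m → ℝ≥0 → Ω → Fin m}

/-- The transition probabilities of the scheme are those of the Markov chain with the steps
`truncStep`. -/
theorem transProb_eq_iterLaw (hfg : LocallyLipschitzCoeff f g) (hB : IsBrownianMotion P B)
    (hr : ∀ i, IsMarkovChain P Γ i (r i))
    (hBr : ∀ i, IndepFun (fun ω t => B t ω) (fun ω t => r i t ω) P) (k : ℕ)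
    (z : EuclideanSpace ℝ (Fin n) × Fin m) {A : Set (EuclideanSpace ℝ (Fin n) × Fin m)}
    (hA : MeasurableSet A) :
    transProb f g R Δ P B r k z A =
      iterLaw (skeletonProb Γ Δ) (noiseLaw d Δ) (truncStep f g R Δ)
        (Measure.dirac (truncState R z)) k A := by
  obtain ⟨x, i⟩ := z
  set S := truncStep f g R (Δ : ℝ) with hSdef
  have hS : ∀ i j, Measurable fun q : EuclideanSpace ℝ (Fin n) × EuclideanSpace ℝ (Fin d) =>
      S q.1 i j q.2 := fun i j => (continuous_truncStep hfg i j).measurable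
  have hw := hB.measurable_increment Δ
  have hrm : ∀ k : ℕ, Measurable (r i (k * Δ)) := fun k => (hr i).measurable _
  have hwr : IndepFun (fun ω k => increment B Δ k ω) (fun ω (k : ℕ) => r i (k * Δ) ω) P :=
    (hBr i).comp
      (φ := fun (v : ℝ≥0 → EuclideanSpace ℝ (Fin d)) (k : ℕ) => v ((k + 1) * Δ) - v (k * Δ))
      (ψ := fun (v : ℝ≥0 → Fin m) (k : ℕ) => v (k * Δ)) (by fun_prop) (by fun_prop)
  have hlaw : ∀ k, P.map (fun ω => (drive S (trunc (R i) x) (fun l => r i (l * Δ) ω)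
      (increment B Δ · ω) k, r i (k * Δ) ω)) =
      iterLaw (skeletonProb Γ Δ) (noiseLaw d Δ) S (Measure.dirac (truncState R (x, i))) k := by
    intro k
    induction k with
    | zero =>
      have e : (fun ω => (drive S (trunc (R i) x) (fun l => r i (l * Δ) ω)
          (increment B Δ · ω) 0, r i ((0 : ℕ) * Δ) ω)) =ᵐ[P] fun _ => truncState R (x, i) := by
        filter_upwards [(hr i).start] with ω hω
        simp [drive, truncState, hω]
      rw [Measure.map_congr e, Measure.map_const, measure_univ, one_smul]
      rfl
    | succ k ih =>
      rw [iterLaw_succ, ← ih]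
      exact map_drive_succ hS hw (hB.indepFun_increment Δ) (hB.map_increment Δ) hrm hwr
        ((hr i).skeleton Δ) _ k
  rw [← hlaw, Measure.map_apply _ hA]
  · refine measure_congr ?_
    filter_upwards [(hr i).start] with ω hω
    have h0 : r i ((0 : ℕ) * Δ) ω = i := by simpa using hω
    refine propext ?_
    change (scheme f g R Δ x (fun j => r i (j * Δ) ω) (fun j => increment B Δ j ω) k, _) ∈ A ↔ _
    rw [scheme_eq_drive, h0]
    rfl
  · exact (measurable_drive hS _ k (fun l _ => hrm l) fun l _ => hw l).prodMk (hrm k)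

/-- One direction is the case `k = 1`, where the truncation of the initial state is absorbed by the
step. In the other, the initial truncation, present even for `k = 0`, does not affect a law
invariant under one step. -/
theorem isInvariantLaw_iff (hfg : LocallyLipschitzCoeff f g) (hB : IsBrownianMotion P B)
    (hr : ∀ i, IsMarkovChain P Γ i (r i))
    (hBr : ∀ i, IndepFun (fun ω t => B t ω) (fun ω t => r i t ω) P)
    (μ : Measure (EuclideanSpace ℝ (Fin n) × Fin m)) :
    IsInvariantLaw f g R Δ P B r μ ↔ IsProbabilityMeasure μ ∧
      μ.bind (stepLaw (skeletonProb Γ Δ) (noiseLaw d Δ) (truncStep f g R Δ)) = μ := by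
  set S := truncStep f g R (Δ : ℝ) with hSdef
  set T := stepOp (skeletonProb Γ Δ) (noiseLaw d Δ) S with hT
  have hS : ∀ i j, Measurable fun q : EuclideanSpace ℝ (Fin n) × EuclideanSpace ℝ (Fin d) =>
      S q.1 i j q.2 := fun i j => (continuous_truncStep hfg i j).measurable
  have htrans : ∀ (k : ℕ) (A : Set (EuclideanSpace ℝ (Fin n) × Fin m)), MeasurableSet A →
      ∫⁻ z, transProb f g R Δ P B r k z A ∂μ =
        ∫⁻ z, T^[k] (A.indicator 1) (truncState R z) ∂μ := by
    intro k A hA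
    refine lintegral_congr fun z => ?_
    have hF : Measurable (A.indicator (1 : EuclideanSpace ℝ (Fin n) × Fin m → ℝ≥0∞)) := measurable_one.indicator hA
    rw [transProb_eq_iterLaw hfg hB hr hBr k z hA, ← lintegral_indicator_one hA,
      lintegral_iterLaw hS hF, lintegral_dirac' _ (measurable_iterate_stepOp hS hF k)]
  have hprod : ∀ (A : Set (EuclideanSpace ℝ (Fin n))) (j : Fin m), MeasurableSet A →
      MeasurableSet (A ×ˢ ({j} : Set (Fin m))) := fun A j hA => hA.prod (measurableSet_singleton j)
  refine and_congr_right fun _ => ⟨fun h => ?_, fun h k A j hA => ?_⟩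
  · refine ext_of_prod_singleton fun A j hA => ?_
    have hm := hprod A j hA
    have hF : Measurable ((A ×ˢ ({j} : Set (Fin m))).indicator (1 : EuclideanSpace ℝ (Fin n) × Fin m → ℝ≥0∞)) :=
      measurable_one.indicator hm
    rw [h 1 A j hA, htrans 1 _ hm, ← lintegral_indicator_one hm, lintegral_bind_stepLaw hS hF]
    exact lintegral_congr fun z => (stepOp_truncState _ z).symm
  · have hm := hprod A j hA
    have hF : Measurable ((A ×ˢ ({j} : Set (Fin m))).indicator (1 : EuclideanSpace ℝ (Fin n) × Fin m → ℝ≥0∞)) :=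
      measurable_one.indicator hm
    rw [htrans k _ hm, lintegral_truncState_of_invariant hfg h (measurable_iterate_stepOp hS hF k),
      ← lintegral_iterLaw hS hF, iterLaw_of_invariant h, lintegral_indicator_one hm]

end Transition

/-! ### Contraction of the truncated scheme -/

theorem enorm_rpow_two_mul {E : Type*} [SeminormedAddCommGroup E] (v : E) {q : ℝ} (hq : 0 ≤ q) :
    ‖v‖ₑ ^ (2 * q) = ENNReal.ofReal ((‖v‖ ^ 2) ^ q) := by
  rw [← ofReal_norm, ENNReal.ofReal_rpow_of_nonneg (norm_nonneg v) (by positivity)]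
  exact congrArg _ (Real.rpow_natCast_mul (norm_nonneg v) 2 q)

theorem lintegral_enorm_affine_noiseLaw {n d : ℕ} (x : EuclideanSpace ℝ (Fin n))
    (A : Matrix (Fin n) (Fin d) ℝ) (Δ : ℝ≥0) {q : ℝ} (hq : 0 < q) (hq1 : q ≤ 1) :
    ∫⁻ w, ‖x + mulVecE A w‖ₑ ^ (2 * q) ∂noiseLaw d Δ =
      ENNReal.ofReal (∫ ξ, (‖x + mulVecE (√(Δ : ℝ) • A) ξ‖ ^ 2) ^ q
        ∂stdGaussian (EuclideanSpace ℝ (Fin d))) := by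
  have hc := continuous_mulVecE A
  rw [noiseLaw, lintegral_map (by fun_prop) (by fun_prop),
    ofReal_integral_eq_lintegral_ofReal (integrable_rpow_norm_affine hq hq1 x _)
      (ae_of_all _ fun ξ => by positivity)]
  refine lintegral_congr fun ξ => ?_
  rw [enorm_rpow_two_mul _ hq.le, mulVecE_smul]
  simp [mulVecE, Matrix.smul_mulVec]

section Contraction
variable {n d m : ℕ} {f : EuclideanSpace ℝ (Fin n) → Fin m → EuclideanSpace ℝ (Fin n)}
  {g : EuclideanSpace ℝ (Fin n) → Fin m → Matrix (Fin n) (Fin d) ℝ} {R : Fin m → ℝ≥0∞} {Δ : ℝ≥0}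

theorem lintegral_truncStep_zero_ne_top {q : ℝ} (hq : 0 < q) (hq1 : q ≤ 1) (i j : Fin m) :
    ∫⁻ w, ‖truncStep f g R Δ 0 i j w‖ₑ ^ (2 * q) ∂noiseLaw d Δ ≠ ⊤ := by
  refine ne_top_of_le_ne_top (ENNReal.ofReal_ne_top (r := _))
    (le_trans (lintegral_mono fun w => ?_) (lintegral_enorm_affine_noiseLaw
      (trunc (R i) 0 + (Δ : ℝ) • f (trunc (R i) 0) i) (g (trunc (R i) 0) i) Δ hq hq1).le)
  refine ENNReal.rpow_le_rpow ?_ (by positivity)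
  have h := norm_trunc_sub_le (R j)
    (trunc (R i) 0 + (Δ : ℝ) • f (trunc (R i) 0) i + mulVecE (g (trunc (R i) 0) i) w) 0
  rw [trunc_zero (R j), sub_zero, sub_zero] at h
  exact enorm_le_iff_norm_le.2 h

/-- The outer truncation is nonexpansive and can be dropped. The inner one puts both points where
the gauge bounds hold, so the one-step estimate applies, and it does not increase their distance. -/
theorem lintegral_truncStep_sub_le {φ : Fin m → ℝ → ℝ} (hφ : ∀ i, IsGauge f g i (φ i)) {v : ℝ}
    (hv : ∀ i, φ i 1 ≤ v) (hv0 : 0 ≤ v) (hΔ : 0 < Δ) (hvΔ : v * Δ ≤ 1) {ρ : ℝ} {β : Fin m → ℝ}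
    (hdiff : DifferenceCondition f g ρ β) {q : ℝ} (hq : 0 < q) (hq1 : q < 1) (hqρ : 2 * q ≤ ρ)
    (x y : EuclideanSpace ℝ (Fin n)) (i j : Fin m) :
    ∫⁻ w, ‖truncStep f g (fun i => gaugeInv (φ i) v) Δ x i j w -
        truncStep f g (fun i => gaugeInv (φ i) v) Δ y i j w‖ₑ ^ (2 * q) ∂noiseLaw d Δ ≤
      ENNReal.ofReal (1 + q * Δ * β i + stepConst d * (v * Δ) ^ 2) * ‖x - y‖ₑ ^ (2 * q) := by
  have hq2 : 0 < 2 * q := by positivity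
  set x' := trunc (gaugeInv (φ i) v) x with hx'
  set y' := trunc (gaugeInv (φ i) v) y with hy'
  have hle : ‖x' - y'‖ₑ ≤ ‖x - y‖ₑ := enorm_le_iff_norm_le.2 (norm_trunc_sub_le _ _ _)
  rcases eq_or_ne x' y' with hxy | hxy
  · simp [truncStep, ← hx', ← hy', hxy, hq2]
  have hlip := (hφ i).lipschitz (hv i) (ofReal_norm_trunc_le _ x) (ofReal_norm_trunc_le _ y)
  calc _ ≤ ∫⁻ w, ‖x' - y' + (Δ : ℝ) • (f x' i - f y' i) + mulVecE (g x' i - g y' i) w‖ₑ ^ (2 * q)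
        ∂noiseLaw d Δ := by
        refine lintegral_mono fun w => ENNReal.rpow_le_rpow
          (enorm_le_iff_norm_le.2 ((norm_trunc_sub_le _ _ _).trans_eq ?_)) hq2.le
        rw [sub_mulVecE, smul_sub]
        congr 1
        abel
    _ ≤ ENNReal.ofReal ((‖x' - y'‖ ^ 2) ^ q * (1 + q * Δ * β i + stepConst d * (v * Δ) ^ 2)) := by
        rw [lintegral_enorm_affine_noiseLaw _ _ _ hq hq1.le]
        exact ENNReal.ofReal_le_ofReal (integral_rpow_norm_step_le (sub_ne_zero.2 hxy) hq hq1
          (by exact_mod_cast hΔ) hv0 hvΔ hlip.1 hlip.2 hqρ (hdiff x' y' i))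
    _ ≤ _ := by
        rw [ENNReal.ofReal_mul (by positivity), ← enorm_rpow_two_mul _ hq.le, mul_comm]
        gcongr

/-- Weights that make the averaged one-step factor smaller than `1` in every mode give a
contraction. -/
theorem exists_isContracting {φ : Fin m → ℝ → ℝ} (hφ : ∀ i, IsGauge f g i (φ i)) {v : ℝ}
    (hv : ∀ i, φ i 1 ≤ v) (hv0 : 0 ≤ v) (hΔ : 0 < Δ) (hvΔ : v * Δ ≤ 1) {ρ : ℝ} {β : Fin m → ℝ}
    (hdiff : DifferenceCondition f g ρ β) {q : ℝ} (hq : 0 < q) (hq1 : q < 1) (hqρ : 2 * q ≤ ρ)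
    {Γ : Matrix (Fin m) (Fin m) ℝ} (hΓ : ∀ i j, 0 ≤ NormedSpace.exp ((Δ : ℝ) • Γ) i j)
    {c : Fin m → ℝ} (hc : ∀ i, 0 < c i)
    (hcon : ∀ i, (∑ j, NormedSpace.exp ((Δ : ℝ) • Γ) i j * c j) *
      (1 + q * Δ * β i + stepConst d * (v * Δ) ^ 2) < c i) :
    ∃ κ : ℝ≥0, κ < 1 ∧ IsContracting (skeletonProb Γ Δ) (noiseLaw d Δ)
      (truncStep f g (fun i => gaugeInv (φ i) v) Δ) (fun i => (c i).toNNReal) κ (2 * q) := by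
  set X : Fin m → ℝ := fun i => 1 + q * Δ * β i + stepConst d * (v * Δ) ^ 2 with hX
  set s : Fin m → ℝ := fun i => ∑ j, NormedSpace.exp ((Δ : ℝ) • Γ) i j * c j with hs
  -- The worst factor among the finitely many modes; `toNNReal` covers a factor that might be
  -- negative.
  refine ⟨Finset.univ.sup fun i => (s i * X i / c i).toNNReal, ?_, fun x y i => ?_⟩
  · refine (Finset.sup_lt_iff (by simp)).2 fun i _ => ?_
    rw [Real.toNNReal_lt_one, div_lt_one (hc i)]
    exact hcon i
  · have h1 : ∀ j, skeletonProb Γ Δ i j * ∫⁻ w, ((c j).toNNReal : ℝ≥0∞) *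
        ‖truncStep f g (fun i => gaugeInv (φ i) v) Δ x i j w -
          truncStep f g (fun i => gaugeInv (φ i) v) Δ y i j w‖ₑ ^ (2 * q) ∂noiseLaw d Δ ≤
        ENNReal.ofReal (NormedSpace.exp ((Δ : ℝ) • Γ) i j * c j) *
          (ENNReal.ofReal (X i) * ‖x - y‖ₑ ^ (2 * q)) := by
      intro j
      rw [lintegral_const_mul' _ _ ENNReal.coe_ne_top, ← mul_assoc, ENNReal.ofReal_mul (hΓ i j)]
      refine mul_le_mul_right ?_ _
      exact lintegral_truncStep_sub_le hφ hv hv0 hΔ hvΔ hdiff hq hq1 hqρ x y i j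
    refine (Finset.sum_le_sum fun j _ => h1 j).trans ?_
    have hs0 : 0 ≤ s i := Finset.sum_nonneg fun j _ => mul_nonneg (hΓ i j) (hc j).le
    rw [← Finset.sum_mul, ← ENNReal.ofReal_sum_of_nonneg fun j _ => mul_nonneg (hΓ i j) (hc j).le,
      ← mul_assoc, ← mul_assoc, ← ENNReal.ofReal_mul hs0]
    refine mul_le_mul_left ?_ _
    have h2 : s i * X i = s i * X i / c i * c i := (div_mul_cancel₀ _ (hc i).ne').symm
    change ENNReal.ofReal (s i * X i) ≤ _
    rw [h2, ENNReal.ofReal_mul' (hc i).le]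
    refine mul_le_mul_left ?_ _
    exact ENNReal.coe_le_coe.2
      (Finset.le_sup (f := fun i => (s i * X i / c i).toNNReal) (Finset.mem_univ i))

/-- `h²Δ = (Δ ^ (1/2 - θ) h)² Δ ^ (2θ) ≤ K² Δ ^ (2θ)`. Hence the one-step error `(hΔ)²` is `o(Δ)`.
-/
theorem IsTruncationRate.tendsto_sq_mul {φ : Fin m → ℝ → ℝ} {h : ℝ → ℝ}
    (hh : IsTruncationRate f g φ h) : Tendsto (fun Δ => h Δ ^ 2 * Δ) (𝓝[>] 0) (𝓝 0) := by
  obtain ⟨θ, hθ, -, K, hK, hrate⟩ := hh.rate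
  have hlim : Tendsto (fun Δ : ℝ => K ^ 2 * Δ ^ (2 * θ)) (𝓝[>] 0) (𝓝 0) := by
    have h1 : ContinuousAt (fun Δ : ℝ => K ^ 2 * Δ ^ (2 * θ)) 0 :=
      continuousAt_const.mul (Real.continuousAt_rpow_const 0 _ (Or.inr (by positivity)))
    have h2 := h1.tendsto.mono_left (nhdsWithin_le_nhds (s := Ioi 0))
    rwa [Real.zero_rpow (by positivity), mul_zero] at h2
  refine tendsto_of_tendsto_of_tendsto_of_le_of_le' tendsto_const_nhds hlim ?_ ?_
  · filter_upwards [self_mem_nhdsWithin] with Δ hΔ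
    have : 0 < Δ := hΔ
    positivity
  · filter_upwards [Ioc_mem_nhdsGT (zero_lt_one' ℝ), hh.tendsto.eventually_ge_atTop 0]
      with Δ hΔ h0
    have e : h Δ ^ 2 * Δ = (Δ ^ (1 / 2 - θ) * h Δ) ^ 2 * Δ ^ (2 * θ) := by
      have : (Δ ^ (1 / 2 - θ)) ^ 2 * Δ ^ (2 * θ) = Δ := by
        rw [← Real.rpow_mul_natCast hΔ.1.le, ← Real.rpow_add hΔ.1]
        convert Real.rpow_one Δ using 2
        push_cast
        ring
      rw [mul_pow, mul_right_comm, this, mul_comm]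
    rw [e]
    have h1 : 0 ≤ Δ ^ (1 / 2 - θ) * h Δ := mul_nonneg (Real.rpow_nonneg hΔ.1.le _) h0
    have h2 : 0 ≤ Δ ^ (2 * θ) := Real.rpow_nonneg hΔ.1.le _
    gcongr
    exact hrate Δ hΔ

end Contraction

/-! ### Stationary law of the skeleton chain -/

section Stationary
variable {m : ℕ} {Γ : Matrix (Fin m) (Fin m) ℝ} {π : Fin m → ℝ} {Δ : ℝ≥0}

/-- The entries of the row and their positive parts both sum to `1`, so each entry equals its
positive part. -/
theorem exp_nonneg_of_sum_skeletonProb (hΓ : IsGenerator Γ) {i : Fin m}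
    (h : ∑ j, skeletonProb Γ Δ i j = 1) (j : Fin m) : 0 ≤ NormedSpace.exp ((Δ : ℝ) • Γ) i j := by
  have h1 := exp_smul_row_sum hΓ Δ i
  have h2 : ∑ j, max (NormedSpace.exp ((Δ : ℝ) • Γ) i j) 0 = 1 := by
    have := congrArg ENNReal.toReal h
    rw [ENNReal.toReal_sum (f := skeletonProb Γ Δ i) fun j _ => ENNReal.ofReal_ne_top] at this
    simpa [skeletonProb, ENNReal.toReal_ofReal'] using this
  have h3 := (Finset.sum_eq_sum_iff_of_le fun j (_ : j ∈ Finset.univ) =>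
    le_max_left (NormedSpace.exp ((Δ : ℝ) • Γ) i j) 0).1 (h1.trans h2.symm) j (Finset.mem_univ j)
  rw [h3]
  exact le_max_right _ _

theorem sum_ofReal_mul_skeletonProb (hπ : IsIrreducibleWith Γ π)
    (hΓ : ∀ i j, 0 ≤ NormedSpace.exp ((Δ : ℝ) • Γ) i j) (j : Fin m) :
    ∑ i, ENNReal.ofReal (π i) * skeletonProb Γ Δ i j = ENNReal.ofReal (π j) := by
  have h := congrFun (vecMul_exp_smul_of_vecMul_eq_zero hπ.1.1 (Δ : ℝ)) j
  rw [← h]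
  simp_rw [skeletonProb, ← ENNReal.ofReal_mul (hπ.2.2 _).le]
  rw [← ENNReal.ofReal_sum_of_nonneg fun i _ => mul_nonneg (hπ.2.2 i).le (hΓ i j)]
  rfl

theorem eq_ofReal_of_sum_mul_skeletonProb
    (hΓ : ∀ i j, 0 ≤ NormedSpace.exp ((Δ : ℝ) • Γ) i j)
    (huniq : ∀ v : Fin m → ℝ, v ᵥ* NormedSpace.exp ((Δ : ℝ) • Γ) = v → ∑ i, v i = 1 → v = π)
    {v : Fin m → ℝ≥0∞} (h1 : ∑ i, v i = 1) (hv : ∀ j, ∑ i, v i * skeletonProb Γ Δ i j = v j) :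
    v = fun i => ENNReal.ofReal (π i) := by
  have hfin : ∀ i, v i ≠ ⊤ := fun i =>
    ((Finset.single_le_sum (f := v) (fun _ _ => zero_le) (Finset.mem_univ i)).trans
      h1.le).trans_lt ENNReal.one_lt_top |>.ne
  have h2 : (fun i => (v i).toReal) = π := by
    refine huniq _ (funext fun j => ?_) ?_
    · rw [← hv j, ENNReal.toReal_sum (f := fun i => v i * skeletonProb Γ Δ i j) fun i _ =>
        ENNReal.mul_ne_top (hfin i) ENNReal.ofReal_ne_top]
      change ∑ i, (v i).toReal * NormedSpace.exp ((Δ : ℝ) • Γ) i j = _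
      refine Finset.sum_congr rfl fun i _ => ?_
      rw [ENNReal.toReal_mul, skeletonProb, ENNReal.toReal_ofReal (hΓ i j)]
    · rw [← ENNReal.toReal_sum fun i _ => hfin i, h1, ENNReal.toReal_one]
  ext i
  rw [← h2, ENNReal.ofReal_toReal (hfin i)]

end Stationary
-- Assembly
section Invariant
variable {n d m : ℕ} {f : EuclideanSpace ℝ (Fin n) → Fin m → EuclideanSpace ℝ (Fin n)}
  {g : EuclideanSpace ℝ (Fin n) → Fin m → Matrix (Fin n) (Fin d) ℝ}
  {Γ : Matrix (Fin m) (Fin m) ℝ} {π : Fin m → ℝ} {Δ : ℝ≥0}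

/-- The scheme with a fixed step `Δ` has a unique invariant law if its skeleton chain of modes has
the unique stationary law `π` and if there are weights `c` as in `exists_weights`. -/
theorem existsUnique_isInvariantLaw (hfg : LocallyLipschitzCoeff f g) (hΓ : IsGenerator Γ)
    (hπ : IsIrreducibleWith Γ π)
    (huniq : ∀ v : Fin m → ℝ, v ᵥ* NormedSpace.exp ((Δ : ℝ) • Γ) = v → ∑ i, v i = 1 → v = π)
    {φ : Fin m → ℝ → ℝ} (hφ : ∀ i, IsGauge f g i (φ i)) {v : ℝ}
    (hv : ∀ i, φ i 1 ≤ v) (hv0 : 0 ≤ v) (hΔ : 0 < Δ) (hvΔ : v * Δ ≤ 1) {ρ : ℝ} {β : Fin m → ℝ}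
    (hdiff : DifferenceCondition f g ρ β) {q : ℝ} (hq : 0 < q) (hq1 : 2 * q ≤ 1) (hqρ : 2 * q ≤ ρ)
    {c : Fin m → ℝ} (hc : ∀ i, 0 < c i)
    (hcon : ∀ i, (∑ j, NormedSpace.exp ((Δ : ℝ) • Γ) i j * c j) *
      (1 + q * Δ * β i + stepConst d * (v * Δ) ^ 2) < c i)
    {Ω : Type*} [MeasurableSpace Ω] {P : Measure Ω} [IsProbabilityMeasure P]
    {B : ℝ≥0 → Ω → EuclideanSpace ℝ (Fin d)} {r : Fin m → ℝ≥0 → Ω → Fin m}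
    (hB : IsBrownianMotion P B) (hr : ∀ i, IsMarkovChain P Γ i (r i))
    (hBr : ∀ i, IndepFun (fun ω t => B t ω) (fun ω t => r i t ω) P) :
    ∃! μ : Measure (EuclideanSpace ℝ (Fin n) × Fin m),
      IsInvariantLaw f g (fun i => gaugeInv (φ i) v) Δ P B r μ := by
  have hp : ∀ i, ∑ j, skeletonProb Γ Δ i j = 1 := fun i => (hr i).sum_skeletonProb Δ
  have hexp : ∀ i j, 0 ≤ NormedSpace.exp ((Δ : ℝ) • Γ) i j := fun i =>
    exp_nonneg_of_sum_skeletonProb hΓ (hp i)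
  have hπ1 : ∑ i, ENNReal.ofReal (π i) = 1 := by
    rw [← ENNReal.ofReal_sum_of_nonneg fun i _ => (hπ.2.2 i).le, hπ.1.2, ENNReal.ofReal_one]
  obtain ⟨κ, hκ, hcontr⟩ := exists_isContracting hφ hv hv0 hΔ hvΔ hdiff hq (by linarith) hqρ hexp
    hc hcon
  refine (existsUnique_congr fun μ => isInvariantLaw_iff hfg hB hr hBr μ).2 ?_
  exact hcontr.existsUnique_invariant (π := fun i => ENNReal.ofReal (π i)) (by positivity) hq1
    (fun i => (Real.toNNReal_pos.2 (hc i)).ne') hκ hp (fun i j => (continuous_truncStep hfg i j).measurable)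
    (continuous_truncStep_left hfg)
    (lintegral_truncStep_zero_ne_top hq (by linarith)) hπ1
    (sum_ofReal_mul_skeletonProb hπ hexp)
    fun v => eq_ofReal_of_sum_mul_skeletonProb hexp huniq

end Invariant

end SwitchingEM

end

theorem theorem4p10 {n d m : ℕ}
    (f : EuclideanSpace ℝ (Fin n) → Fin m → EuclideanSpace ℝ (Fin n))
    (g : EuclideanSpace ℝ (Fin n) → Fin m → Matrix (Fin n) (Fin d) ℝ)
    (hfg : SwitchingEM.LocallyLipschitzCoeff f g)
    (Γ : Matrix (Fin m) (Fin m) ℝ) (hΓ : SwitchingEM.IsGenerator Γ)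
    (π : Fin m → ℝ) (hπ : SwitchingEM.IsIrreducibleWith Γ π)
    (Q : Matrix (Fin n) (Fin n) ℝ) (hQ : Q.PosDef)
    (pbar : ℝ) (hpbar : 0 < pbar) (α : Fin m → ℝ)
    (hgrowth : SwitchingEM.GrowthCondition f g Q pbar α) (hα : ∑ i, π i * α i < 0)
    (ρ : ℝ) (hρ : 0 < ρ) (β : Fin m → ℝ)
    (hdiff : SwitchingEM.DifferenceCondition f g ρ β) (hβ : ∑ i, π i * β i < 0)
    (φ : Fin m → ℝ → ℝ) (hφ : ∀ i, SwitchingEM.IsGauge f g i (φ i))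
    (h : ℝ → ℝ) (hh : SwitchingEM.IsTruncationRate f g φ h) :
    ∃ Δ₀ : ℝ≥0, 0 < Δ₀ ∧ Δ₀ ≤ 1 ∧ ∀ Δ : ℝ≥0, 0 < Δ → Δ ≤ Δ₀ →
      ∀ (Ω : Type*) [MeasurableSpace Ω] (P : Measure Ω) [IsProbabilityMeasure P]
        (B : ℝ≥0 → Ω → EuclideanSpace ℝ (Fin d)) (r : Fin m → ℝ≥0 → Ω → Fin m),
        SwitchingEM.IsBrownianMotion P B →
        (∀ i, SwitchingEM.IsMarkovChain P Γ i (r i)) →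
        (∀ i, IndepFun (fun ω t => B t ω) (fun ω t => r i t ω) P) →
        ∃! μ : Measure (EuclideanSpace ℝ (Fin n) × Fin m),
          SwitchingEM.IsInvariantLaw f g (fun i => SwitchingEM.gaugeInv (φ i) (h Δ)) Δ P B r μ := by
  -- `q ≤ 1/2` makes the exponent `2q` at most `1`, for subadditivity; `q ≤ ρ/2` serves the
  -- condition on differences.
  obtain ⟨q, hq, hq0, c, hc, hcon⟩ := SwitchingEM.exists_weights hΓ hπ hβ
    (q₀ := min (1 / 2) (ρ / 2)) (by positivity)
  have hq1 : q ≤ 1 / 2 := hq0.trans (min_le_left _ _)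
  have hqρ : q ≤ ρ / 2 := hq0.trans (min_le_right _ _)
  have hsq := hh.tendsto_sq_mul
  -- The one-step error is `stepConst d * (hΔ)² = Δ * ε Δ` with this vanishing `ε`.
  have hcon' := hcon (fun Δ => SwitchingEM.stepConst d * (h Δ ^ 2 * Δ)) (by
    simpa using hsq.const_mul (SwitchingEM.stepConst d))
  obtain ⟨δ, hδ, hsub⟩ := mem_nhdsGT_iff_exists_Ioc_subset.1
    (((hcon'.and (SwitchingEM.eventually_skeleton_unique hΓ hπ)).and
      (hsq.eventually_le_const one_pos)).and (hh.tendsto.eventually_ge_atTop 0))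
  have hδ0 : 0 < δ := hδ
  refine ⟨⟨min δ 1, by positivity⟩, lt_min hδ0 one_pos, min_le_right δ 1, ?_⟩
  intro Δ hΔ hΔ₀ Ω _ P _ B r hB hr hBr
  have hΔ' : (0 : ℝ) < Δ := by exact_mod_cast hΔ
  have hΔδ : (Δ : ℝ) ≤ min δ 1 := hΔ₀
  have hΔ1 : (Δ : ℝ) ≤ 1 := hΔδ.trans (min_le_right _ _)
  obtain ⟨⟨⟨hweights, huniq⟩, hle⟩, hv0⟩ := hsub ⟨hΔ', hΔδ.trans (min_le_left _ _)⟩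
  -- `(hΔ)² = (h²Δ) Δ`, and both factors are at most `1`.
  have hvΔ : h Δ * Δ ≤ 1 := by
    refine (abs_le_one_iff_mul_self_le_one.2 ?_ |> le_of_abs_le)
    calc h Δ * Δ * (h Δ * Δ) = h Δ ^ 2 * Δ * Δ := by ring
      _ ≤ 1 := mul_le_one₀ hle hΔ'.le hΔ1
  refine SwitchingEM.existsUnique_isInvariantLaw hfg hΓ hπ huniq hφ (hh.gauge_le Δ ⟨hΔ', hΔ1⟩) hv0
    hΔ hvΔ hdiff hq (by linarith) (by linarith) hc (fun i => ?_) hB hr hBr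
  refine lt_of_eq_of_lt ?_ (hweights i)
  ring
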